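/- **Language and theories.** The language of category theory (plus constants) is dependently sorted: a sort of objects; for object-terms $A,B$ a sort $A\to B$ of arrows; formal identities $1_A$ and formal composites; equations only between arrow-terms of syntactically the same sort; connectives $\top,\bot,\wedge,\vee,\to$; and quantifiers over objects and over each arrow sort. A context is a finite list of declarations of object-variables and of arrow-variables $f:A\to B$ with $A,B$ constants or already declared. Provability is intuitionistic natural deduction in context (sorts may be empty), including the rules that $=$ is an equivalence relation respected by $\circ$ and the axioms of category theory. A theory $T$ is given by a set of axioms (sentences). For a context $\Delta$ and a proposition $P(\Delta)$, $\exists!\,\Delta\,P(\Delta)$ says that $\exists\Delta\,P(\Delta)$ and that for all $\Delta_1,\Delta_2$ with $P(\Delta_1)$ and $P(\Delta_2)$ there is a unique context isomorphism $\tau:\Delta_1\cong\Delta_2$, i.e. a family of isomorphisms $\tau_V:V_1\to V_2$, one for each object-variable $V$ of $\Delta$, with $g_2\circ\tau_A=\tau_B\circ g_1$ for each arrow-variable $g:A\to B$ of $\Delta$ (where $\tau_C=1_C$ for a constant $C$). **The extension $T_{comp}$.** Let $T$ be a theory in the pure language (no constants). Let $T_1$ be $T$ with, for each $(\Delta,P)$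 such that $T\vdash\exists!\,\Delta\,P(\Delta)$, new constants for the variables of $\Delta$ and the axiom that $P$ holds of them. Let $T_2$ be $T_1$ with, for each proposition $P(f)$ of $T_1$, with $f:c_1\to c_2$ and $c_1,c_2$ object-constants, such that $T_1\vdash\exists!\,f\,P(f)$, a new constant $c_P:c_1\to c_2$ and the axiom $P(c_P)$. Let $T_{comp}$ be obtained from $T_2$ by taking as arrow-constants the closed arrow-terms of $T_2$ modulo $T_2$-provable equality. The constants of $T_{comp}$ form a category, also denoted $T_{comp}$. **The Freyd cover, $T^*$ and $M$.** Assume that the category $T_{comp}$ has a terminal object $1$; let $\mathbf{Tiny}$ be a small category with a faithful functor to $\mathbf{Set}$ (a small subcategory of sets), and let $\Gamma:T_{comp}\to\mathbf{Tiny}$ be a functor whose composite with $\mathbf{Tiny}\to\mathbf{Set}$ is isomorphic to the global sections functor $A\mapsto\mathrm{Hom}(1,A)$. Let $F$ be the Artin gluing along $\Gamma$: objects are triples $(X,S,f:X\to\Gamma S)$ with $X\in\mathbf{Tiny}$, $S\in T_{comp}$, and arrows $(X,S,f)\to(Y,R,g)$ are pairs $(h:X\to Y,\ \varphi:S\to R)$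 with $g\circ h=\Gamma(\varphi)\circ f$. Write $(X,S,f)^-=S$ and $(h,\varphi)^-=\varphi$. The theory $T^*$ has the objects and arrows of $F$ as constants, and $T^*\vdash\phi$ if and only if $T_{comp}\vdash\phi^-$, where $\phi^-$ is $\phi$ with each constant $c$ replaced by $c^-$. Let $M$ be the set of equations $t_1=t_2$ between closed arrow-terms of $T^*$ of the same sort which denote equal arrows of $F$. **Friedman slash.** For sentences $\phi$ of $T^*$ define $FP(\phi)$ (Friedman-slashed and provable) recursively: $FP(t_1=t_2)$ iff $(t_1=t_2)\in M$; $FP$ commutes with $\wedge,\vee,\top,\bot$; $FP(\phi\to\xi)$ iff ($FP(\phi)$ implies $FP(\xi)$) and $T^*\vdash\phi\to\xi$; $FP(\exists x{:}W\,P(x))$ iff $FP(P(t))$ for some closed term $t$ of sort $W$; $FP(\forall x{:}W\,P(x))$ iff $FP(P(t))$ for all closed terms $t$ of sort $W$ and $T^*\vdash\forall x{:}W\,P(x)$. **Theorem.** Suppose that $FP(\phi)$ holds for every axiom $\phi$ of $T$ (a sentence of the pure language is also a sentence of $T^*$). Then: 1. $T$ is consistent: $T\not\vdash\bot$. 2.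 $T$ has the existence property: whenever $T\vdash\exists\Theta\,P(\Theta)$ for a context $\Theta$ and a proposition $P(\Theta)$, there are a context $\Delta$, a proposition $Q(\Delta)$ and a well-sorted assignment $c$ of terms in context $\Delta$ to the variables of $\Theta$ such that $T\vdash\exists!\,\Delta\,Q(\Delta)$ and $T\vdash\exists\Delta\,(Q(\Delta)\wedge P(c))$. 3. $T$ has the disjunction property: for all sentences $\phi,\xi$, if $T\vdash\phi\vee\xi$ then $T\vdash\phi$ or $T\vdash\xi$. -/

import Mathlib

open CategoryTheory

universe u v w

namespace CatTheory

/-! ## Almost-categories of terms and substitutions -/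

section Terms

variable {O : Type u} {O' : Type v} {O'' : Type w}

/-- Arrow-terms freely built, by formal identities and formal composition and without any
equations, from a family `H` of atomic arrow symbols. The object-terms are the elements of `O`,
so this is the almost-category of terms. -/
inductive Tm (H : O → O → Type u) : O → O → Type u
  | sym {a b : O} (h : H a b) : Tm H a b
  | id (a : O) : Tm H a a
  | comp {a b c : O} (g : Tm H b c) (f : Tm H a b) : Tm H a c

/-- The identity term between two object-terms that are the same. -/
def Tm.ofEq {H : O → O → Type u} {a b : O} (h : a = b) : Tm H a b :=
  match h with
  | rfl => Tm.id a

/-- Atomic arrow symbols after adjoining one new object symbol `none`. -/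
inductive AddOb (H : O → O → Type u) : Option O → Option O → Type u
  | old {a b : O} (h : H a b) : AddOb H (some a) (some b)

/-- Atomic arrow symbols after adjoining one new arrow symbol of sort `a₀ → b₀`. -/
inductive AddAr (H : O → O → Type u) (a₀ b₀ : O) : O → O → Type u
  | old {a b : O} (h : H a b) : AddAr H a₀ b₀ a b
  | new : AddAr H a₀ b₀ a₀ b₀

/-- An assignment of object-terms to object symbols and of suitably sorted arrow-terms to arrow
symbols; equivalently, a functor between the almost-categories of terms. -/
structure Asg (H : O → O → Type u) (H' : O' → O' → Type v) where
  ob : O → O'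
  ar : ∀ {a b : O}, H a b → Tm H' (ob a) (ob b)

variable {H : O → O → Type u} {H' : O' → O' → Type v} {H'' : O'' → O'' → Type w}

/-- The action of an assignment on arrow-terms. -/
def Tm.subst (σ : Asg H H') : {a b : O} → Tm H a b → Tm H' (σ.ob a) (σ.ob b)
  | _, _, .sym h => σ.ar h
  | _, _, .id a => .id (σ.ob a)
  | _, _, .comp g f => .comp (g.subst σ) (f.subst σ)

namespace Asg

/-- The identity assignment. -/
def id (H : O → O → Type u) : Asg H H where
  ob a := a
  ar h := .sym h

/-- The assignment first `σ`, then `τ`. -/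
def comp (σ : Asg H H') (τ : Asg H' H'') : Asg H H'' where
  ob a := τ.ob (σ.ob a)
  ar h := (σ.ar h).subst τ

/-- Weakening by an object symbol. -/
def wkOb (H : O → O → Type u) : Asg H (AddOb H) where
  ob a := some a
  ar h := .sym (.old h)

/-- Weakening by an arrow symbol. -/
def wkAr (H : O → O → Type u) (a₀ b₀ : O) : Asg H (AddAr H a₀ b₀) where
  ob a := a
  ar h := .sym (.old h)

/-- Extend an assignment by a value for a new object symbol. -/
def consOb (σ : Asg H H') (c : O') : Asg (AddOb H) H' where
  ob
    | none => c
    | some a => σ.ob a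
  ar
    | .old h => σ.ar h

/-- Extend an assignment by a value for a new arrow symbol. -/
def consAr (σ : Asg H H') {a₀ b₀ : O} (t : Tm H' (σ.ob a₀) (σ.ob b₀)) :
    Asg (AddAr H a₀ b₀) H' where
  ob a := σ.ob a
  ar
    | .old h => σ.ar h
    | .new => t

/-- Pass under an object binder. -/
def liftOb (σ : Asg H H') : Asg (AddOb H) (AddOb H') :=
  (σ.comp (wkOb H')).consOb none

/-- Pass under an arrow binder. -/
def liftAr (σ : Asg H H') (a₀ b₀ : O) :
    Asg (AddAr H a₀ b₀) (AddAr H' (σ.ob a₀) (σ.ob b₀)) :=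
  (σ.comp (wkAr H' (σ.ob a₀) (σ.ob b₀))).consAr (.sym .new)

end Asg

end Terms

/-! ## Constants, contexts, propositions -/

/-- A vocabulary of constants: constants of sort object, and for any two object-constants a
family of constants of the corresponding arrow sort. -/
structure Voc : Type (u + 1) where
  O : Type u
  H : O → O → Type u

/-- The vocabulary without constants: the pure language of category theory. -/
def Pure : Voc.{u} where
  O := PEmpty
  H a _ := a.elim

/-- The object-terms in a context with `n` object-variables: the object-constants and the
variables. `none` is the variable declared last. -/
def ObX (V : Voc.{u}) : ℕ → Type u
  | 0 => V.O
  | n + 1 => Option (ObX V n)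

/-- Contexts with `n` object-variables: lists of declarations, each either of an object-variable
or of an arrow-variable whose sort `a → b` is formed from object-terms available before. -/
inductive Tel (V : Voc.{u}) : ℕ → Type u
  | nil : Tel V 0
  | ob {n : ℕ} (Δ : Tel V n) : Tel V (n + 1)
  | ar {n : ℕ} (Δ : Tel V n) (a b : ObX V n) : Tel V n

/-- The atomic arrow-terms in a context: the arrow-constants and the arrow-variables. -/
def HomX {V : Voc.{u}} : {n : ℕ} → Tel V n → ObX V n → ObX V n → Type u
  | _, .nil => V.H
  | _, .ob Δ => AddOb (HomX Δ)
  | _, .ar Δ a b => AddAr (HomX Δ) a b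

/-- Propositions in a context. Only arrow-terms of syntactically the same sort can be equated,
and objects cannot be equated at all. -/
inductive Fml (V : Voc.{u}) : {n : ℕ} → Tel V n → Type u
  | eq {n : ℕ} {Δ : Tel V n} {a b : ObX V n} (f g : Tm (HomX Δ) a b) : Fml V Δ
  | top {n : ℕ} {Δ : Tel V n} : Fml V Δ
  | bot {n : ℕ} {Δ : Tel V n} : Fml V Δ
  | and {n : ℕ} {Δ : Tel V n} (φ ψ : Fml V Δ) : Fml V Δ
  | or {n : ℕ} {Δ : Tel V n} (φ ψ : Fml V Δ) : Fml V Δ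
  | imp {n : ℕ} {Δ : Tel V n} (φ ψ : Fml V Δ) : Fml V Δ
  | allOb {n : ℕ} {Δ : Tel V n} (φ : Fml V Δ.ob) : Fml V Δ
  | exOb {n : ℕ} {Δ : Tel V n} (φ : Fml V Δ.ob) : Fml V Δ
  | allAr {n : ℕ} {Δ : Tel V n} (a b : ObX V n) (φ : Fml V (Δ.ar a b)) : Fml V Δ
  | exAr {n : ℕ} {Δ : Tel V n} (a b : ObX V n) (φ : Fml V (Δ.ar a b)) : Fml V Δ

/-- Sentences are propositions in the empty context. -/
abbrev Sentence (V : Voc.{u}) : Type u := Fml V (Tel.nil : Tel V 0)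

/-- An assignment from one context to another; it may also replace constants. -/
abbrev CtxAsg {V : Voc.{u}} {W : Voc.{v}} {n m : ℕ} (Δ : Tel V n) (Δ' : Tel W m) :=
  Asg (HomX Δ) (HomX Δ')

namespace CtxAsg

variable {V : Voc.{u}} {W : Voc.{v}} {n m : ℕ}

/-- The identity assignment of a context. -/
def id (Δ : Tel V n) : CtxAsg Δ Δ := Asg.id (HomX Δ)

/-- Weakening by an object-variable. -/
def wkOb (Δ : Tel V n) : CtxAsg Δ Δ.ob := Asg.wkOb (HomX Δ)

/-- Weakening by an arrow-variable. -/
def wkAr (Δ : Tel V n) (a b : ObX V n) : CtxAsg Δ (Δ.ar a b) := Asg.wkAr (HomX Δ) a b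

variable {Δ : Tel V n} {Δ' : Tel W m}

/-- Extend an assignment by a value for a new object-variable. -/
def consOb (σ : CtxAsg Δ Δ') (c : ObX W m) : CtxAsg Δ.ob Δ' := Asg.consOb σ c

/-- Extend an assignment by a value for a new arrow-variable. -/
def consAr (σ : CtxAsg Δ Δ') {a b : ObX V n} (t : Tm (HomX Δ') (σ.ob a) (σ.ob b)) :
    CtxAsg (Δ.ar a b) Δ' := Asg.consAr σ t

/-- Pass under a quantifier over objects. -/
def liftOb (σ : CtxAsg Δ Δ') : CtxAsg Δ.ob Δ'.ob := Asg.liftOb σ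

/-- Pass under a quantifier over arrows. -/
def liftAr (σ : CtxAsg Δ Δ') (a b : ObX V n) :
    CtxAsg (Δ.ar a b) (Δ'.ar (σ.ob a) (σ.ob b)) := Asg.liftAr σ a b

end CtxAsg

/-- Simultaneous capture-avoiding substitution in a proposition. -/
def Fml.subst {V : Voc.{u}} {W : Voc.{v}} : {n m : ℕ} → {Δ : Tel V n} → {Δ' : Tel W m} →
    Fml V Δ → CtxAsg Δ Δ' → Fml W Δ'
  | _, _, _, _, .eq f g, σ => .eq (f.subst σ) (g.subst σ)
  | _, _, _, _, .top, _ => .top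
  | _, _, _, _, .bot, _ => .bot
  | _, _, _, _, .and φ ψ, σ => .and (φ.subst σ) (ψ.subst σ)
  | _, _, _, _, .or φ ψ, σ => .or (φ.subst σ) (ψ.subst σ)
  | _, _, _, _, .imp φ ψ, σ => .imp (φ.subst σ) (ψ.subst σ)
  | _, _, _, _, .allOb φ, σ => .allOb (φ.subst (CtxAsg.liftOb σ))
  | _, _, _, _, .exOb φ, σ => .exOb (φ.subst (CtxAsg.liftOb σ))
  | _, _, _, _, .allAr a b φ, σ =>
      .allAr (σ.ob a) (σ.ob b) (φ.subst (CtxAsg.liftAr σ a b))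
  | _, _, _, _, .exAr a b φ, σ =>
      .exAr (σ.ob a) (σ.ob b) (φ.subst (CtxAsg.liftAr σ a b))

section Weakening

variable {V : Voc.{u}} {n : ℕ} {Δ : Tel V n}

/-- Weakening of a proposition by an object-variable. -/
def Fml.wkOb (φ : Fml V Δ) : Fml V Δ.ob := φ.subst (CtxAsg.wkOb Δ)

/-- Weakening of a proposition by an arrow-variable. -/
def Fml.wkAr (a b : ObX V n) (φ : Fml V Δ) : Fml V (Δ.ar a b) :=
  φ.subst (CtxAsg.wkAr Δ a b)

/-- Instantiation of the last variable, an object-variable. -/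
def Fml.instOb (φ : Fml V Δ.ob) (c : ObX V n) : Fml V Δ :=
  φ.subst (CtxAsg.consOb (CtxAsg.id Δ) c)

/-- Instantiation of the last variable, an arrow-variable. -/
def Fml.instAr {a b : ObX V n} (φ : Fml V (Δ.ar a b)) (t : Tm (HomX Δ) a b) : Fml V Δ :=
  φ.subst (CtxAsg.consAr (CtxAsg.id Δ) t)

end Weakening

/-! ## Intuitionistic deduction -/

/-- Natural deduction for intuitionistic logic over the language of category theory:
`Deriv Δ Γ φ` says that, in the context `Δ`, the proposition `φ` follows from the propositions
in `Γ`. The rules for equality and the axioms of category theory are included. Contexts are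
tracked, so no sort is assumed to be inhabited. -/
inductive Deriv {V : Voc.{u}} : {n : ℕ} → (Δ : Tel V n) → Set (Fml V Δ) → Fml V Δ → Prop
  | hyp {n : ℕ} {Δ : Tel V n} {Γ : Set (Fml V Δ)} {φ : Fml V Δ} (h : φ ∈ Γ) : Deriv Δ Γ φ
  | topI {n : ℕ} {Δ : Tel V n} {Γ : Set (Fml V Δ)} : Deriv Δ Γ .top
  | botE {n : ℕ} {Δ : Tel V n} {Γ : Set (Fml V Δ)} {φ : Fml V Δ} (h : Deriv Δ Γ .bot) :
      Deriv Δ Γ φ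
  | andI {n : ℕ} {Δ : Tel V n} {Γ : Set (Fml V Δ)} {φ ψ : Fml V Δ} (h₁ : Deriv Δ Γ φ)
      (h₂ : Deriv Δ Γ ψ) : Deriv Δ Γ (.and φ ψ)
  | andE₁ {n : ℕ} {Δ : Tel V n} {Γ : Set (Fml V Δ)} {φ ψ : Fml V Δ}
      (h : Deriv Δ Γ (.and φ ψ)) : Deriv Δ Γ φ
  | andE₂ {n : ℕ} {Δ : Tel V n} {Γ : Set (Fml V Δ)} {φ ψ : Fml V Δ}
      (h : Deriv Δ Γ (.and φ ψ)) : Deriv Δ Γ ψ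
  | orI₁ {n : ℕ} {Δ : Tel V n} {Γ : Set (Fml V Δ)} {φ ψ : Fml V Δ} (h : Deriv Δ Γ φ) :
      Deriv Δ Γ (.or φ ψ)
  | orI₂ {n : ℕ} {Δ : Tel V n} {Γ : Set (Fml V Δ)} {φ ψ : Fml V Δ} (h : Deriv Δ Γ ψ) :
      Deriv Δ Γ (.or φ ψ)
  | orE {n : ℕ} {Δ : Tel V n} {Γ : Set (Fml V Δ)} {φ ψ χ : Fml V Δ}
      (h : Deriv Δ Γ (.or φ ψ)) (h₁ : Deriv Δ (insert φ Γ) χ) (h₂ : Deriv Δ (insert ψ Γ) χ) :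
      Deriv Δ Γ χ
  | impI {n : ℕ} {Δ : Tel V n} {Γ : Set (Fml V Δ)} {φ ψ : Fml V Δ}
      (h : Deriv Δ (insert φ Γ) ψ) : Deriv Δ Γ (.imp φ ψ)
  | impE {n : ℕ} {Δ : Tel V n} {Γ : Set (Fml V Δ)} {φ ψ : Fml V Δ}
      (h : Deriv Δ Γ (.imp φ ψ)) (h₁ : Deriv Δ Γ φ) : Deriv Δ Γ ψ
  | allObI {n : ℕ} {Δ : Tel V n} {Γ : Set (Fml V Δ)} {φ : Fml V Δ.ob}
      (h : Deriv Δ.ob (Fml.wkOb '' Γ) φ) : Deriv Δ Γ (.allOb φ)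
  | allObE {n : ℕ} {Δ : Tel V n} {Γ : Set (Fml V Δ)} {φ : Fml V Δ.ob}
      (h : Deriv Δ Γ (.allOb φ)) (c : ObX V n) : Deriv Δ Γ (φ.instOb c)
  | exObI {n : ℕ} {Δ : Tel V n} {Γ : Set (Fml V Δ)} {φ : Fml V Δ.ob} (c : ObX V n)
      (h : Deriv Δ Γ (φ.instOb c)) : Deriv Δ Γ (.exOb φ)
  | exObE {n : ℕ} {Δ : Tel V n} {Γ : Set (Fml V Δ)} {φ : Fml V Δ.ob} {ψ : Fml V Δ}
      (h : Deriv Δ Γ (.exOb φ)) (h₁ : Deriv Δ.ob (insert φ (Fml.wkOb '' Γ)) ψ.wkOb) :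
      Deriv Δ Γ ψ
  | allArI {n : ℕ} {Δ : Tel V n} {Γ : Set (Fml V Δ)} {a b : ObX V n} {φ : Fml V (Δ.ar a b)}
      (h : Deriv (Δ.ar a b) (Fml.wkAr a b '' Γ) φ) : Deriv Δ Γ (.allAr a b φ)
  | allArE {n : ℕ} {Δ : Tel V n} {Γ : Set (Fml V Δ)} {a b : ObX V n} {φ : Fml V (Δ.ar a b)}
      (h : Deriv Δ Γ (.allAr a b φ)) (t : Tm (HomX Δ) a b) : Deriv Δ Γ (φ.instAr t)
  | exArI {n : ℕ} {Δ : Tel V n} {Γ : Set (Fml V Δ)} {a b : ObX V n} {φ : Fml V (Δ.ar a b)}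
      (t : Tm (HomX Δ) a b) (h : Deriv Δ Γ (φ.instAr t)) : Deriv Δ Γ (.exAr a b φ)
  | exArE {n : ℕ} {Δ : Tel V n} {Γ : Set (Fml V Δ)} {a b : ObX V n} {φ : Fml V (Δ.ar a b)}
      {ψ : Fml V Δ} (h : Deriv Δ Γ (.exAr a b φ))
      (h₁ : Deriv (Δ.ar a b) (insert φ (Fml.wkAr a b '' Γ)) (ψ.wkAr a b)) : Deriv Δ Γ ψ
  | eqRefl {n : ℕ} {Δ : Tel V n} {Γ : Set (Fml V Δ)} {a b : ObX V n} (f : Tm (HomX Δ) a b) :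
      Deriv Δ Γ (.eq f f)
  | eqSymm {n : ℕ} {Δ : Tel V n} {Γ : Set (Fml V Δ)} {a b : ObX V n} {f g : Tm (HomX Δ) a b}
      (h : Deriv Δ Γ (.eq f g)) : Deriv Δ Γ (.eq g f)
  | eqTrans {n : ℕ} {Δ : Tel V n} {Γ : Set (Fml V Δ)} {a b : ObX V n}
      {f g k : Tm (HomX Δ) a b} (h₁ : Deriv Δ Γ (.eq f g)) (h₂ : Deriv Δ Γ (.eq g k)) :
      Deriv Δ Γ (.eq f k)
  | eqComp {n : ℕ} {Δ : Tel V n} {Γ : Set (Fml V Δ)} {a b c : ObX V n}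
      {f₁ f₂ : Tm (HomX Δ) a b} {g₁ g₂ : Tm (HomX Δ) b c} (h₁ : Deriv Δ Γ (.eq f₁ f₂))
      (h₂ : Deriv Δ Γ (.eq g₁ g₂)) : Deriv Δ Γ (.eq (.comp g₁ f₁) (.comp g₂ f₂))
  | assoc {n : ℕ} {Δ : Tel V n} {Γ : Set (Fml V Δ)} {a b c d : ObX V n}
      (f : Tm (HomX Δ) a b) (g : Tm (HomX Δ) b c) (h : Tm (HomX Δ) c d) :
      Deriv Δ Γ (.eq (.comp h (.comp g f)) (.comp (.comp h g) f))
  | idComp {n : ℕ} {Δ : Tel V n} {Γ : Set (Fml V Δ)} {a b : ObX V n} (f : Tm (HomX Δ) a b) :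
      Deriv Δ Γ (.eq f (.comp (.id b) f))
  | compId {n : ℕ} {Δ : Tel V n} {Γ : Set (Fml V Δ)} {a b : ObX V n} (f : Tm (HomX Δ) a b) :
      Deriv Δ Γ (.eq f (.comp f (.id a)))

/-- A theory in the language of category theory with the constants `V`, given by its axioms. The
rules of equality and the axioms of category theory need not be listed, they are built into
deduction. -/
abbrev Theory (V : Voc.{u}) : Type u := Set (Sentence V)

/-- `T.Proves φ` is `T ⊢ φ`. -/
def Theory.Proves {V : Voc.{u}} (T : Theory V) (φ : Sentence V) : Prop := Deriv Tel.nil T φ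

/-! ## Unique existence up to unique isomorphism -/

section Unique

variable {V : Voc.{u}}

/-- `∃ Δ, φ`. -/
def exTel : {n : ℕ} → (Δ : Tel V n) → Fml V Δ → Sentence V
  | _, .nil, φ => φ
  | _, .ob Δ, φ => exTel Δ (.exOb φ)
  | _, .ar Δ a b, φ => exTel Δ (.exAr a b φ)

/-- `∀ Δ, φ`. -/
def allTel : {n : ℕ} → (Δ : Tel V n) → Fml V Δ → Sentence V
  | _, .nil, φ => φ
  | _, .ob Δ, φ => allTel Δ (.allOb φ)
  | _, .ar Δ a b, φ => allTel Δ (.allAr a b φ)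

/-- An object-constant as an object-term. -/
def constOb : (n : ℕ) → V.O → ObX V n
  | 0, c => c
  | n + 1, c => some (constOb n c)

/-- An arrow-constant as an atomic arrow-term. -/
def constHom : {n : ℕ} → (Γ : Tel V n) → {a b : V.O} → V.H a b →
    HomX Γ (constOb n a) (constOb n b)
  | _, .nil, _, _, h => h
  | _, .ob Γ, _, _, h => AddOb.old (constHom Γ h)
  | _, .ar Γ _ _, _, _, h => AddAr.old (constHom Γ h)

/-- Object-terms of the first of two concatenated contexts. -/
def injL {m : ℕ} : (n : ℕ) → ObX V m → ObX V (m + n)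
  | 0, a => a
  | n + 1, a => some (injL n a)

/-- Object-terms of the second of two concatenated contexts. -/
def injR (m : ℕ) : (n : ℕ) → ObX V n → ObX V (m + n)
  | 0, c => constOb m c
  | _ + 1, none => none
  | n + 1, some a => some (injR m n a)

/-- The concatenation of `Γ` with a fresh copy of `Δ`. -/
def Tel.append {m : ℕ} (Γ : Tel V m) : {n : ℕ} → Tel V n → Tel V (m + n)
  | _, .nil => Γ
  | _, .ob Δ => .ob (Γ.append Δ)
  | _, .ar Δ a b => .ar (Γ.append Δ) (injR m _ a) (injR m _ b)

/-- Arrow symbols of the first of two concatenated contexts. -/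
def homL {m : ℕ} (Γ : Tel V m) : {n : ℕ} → (Δ : Tel V n) → {a b : ObX V m} → HomX Γ a b →
    HomX (Γ.append Δ) (injL n a) (injL n b)
  | _, .nil, _, _, h => h
  | _, .ob Δ, _, _, h => AddOb.old (homL Γ Δ h)
  | _, .ar Δ _ _, _, _, h => AddAr.old (homL Γ Δ h)

/-- Arrow symbols of the second of two concatenated contexts. -/
def homR {m : ℕ} (Γ : Tel V m) : {n : ℕ} → (Δ : Tel V n) → {a b : ObX V n} → HomX Δ a b →
    HomX (Γ.append Δ) (injR m n a) (injR m n b)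
  | _, .nil, _, _, h => constHom Γ h
  | _, .ob Δ, a, b, h =>
      match a, b, (h : AddOb (HomX Δ) a b) with
      | _, _, .old h => AddOb.old (homR Γ Δ h)
  | _, .ar Δ a₀ b₀, a, b, h =>
      match a, b, (h : AddAr (HomX Δ) a₀ b₀ a b) with
      | _, _, .old h => AddAr.old (homR Γ Δ h)
      | _, _, .new => AddAr.new

/-- The first of two concatenated contexts inside the concatenation. -/
def asgL {m n : ℕ} (Γ : Tel V m) (Δ : Tel V n) : CtxAsg Γ (Γ.append Δ) where
  ob := injL n
  ar h := .sym (homL Γ Δ h)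

/-- The second of two concatenated contexts inside the concatenation. -/
def asgR {m n : ℕ} (Γ : Tel V m) (Δ : Tel V n) : CtxAsg Δ (Γ.append Δ) where
  ob := injR m n
  ar h := .sym (homR Γ Δ h)

theorem injL_constOb (m : ℕ) : (n : ℕ) → (c : V.O) →
    injL n (constOb m c) = constOb (V := V) (m + n) c
  | 0, _ => rfl
  | n + 1, c => congrArg some (injL_constOb m n c)

theorem injR_constOb (m : ℕ) : (n : ℕ) → (c : V.O) →
    injR m n (constOb n c) = constOb (V := V) (m + n) c
  | 0, _ => rfl
  | n + 1, c => congrArg some (injR_constOb m n c)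

/-- `Γ` extended by one arrow-variable `s₁ v → s₂ v` for each object-variable `v` of a context
with `n` object-variables. -/
def tauTel {m : ℕ} (Γ : Tel V m) : (n : ℕ) → (s₁ s₂ : ObX V n → ObX V m) → Tel V m
  | 0, _, _ => Γ
  | n + 1, s₁, s₂ =>
      .ar (tauTel Γ n (fun a => s₁ (some a)) (fun a => s₂ (some a))) (s₁ none) (s₂ none)

/-- The weakening from `Γ` to `tauTel Γ n s₁ s₂`. -/
def tauWk {m : ℕ} (Γ : Tel V m) : (n : ℕ) → (s₁ s₂ : ObX V n → ObX V m) →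
    {a b : ObX V m} → HomX Γ a b → HomX (tauTel Γ n s₁ s₂) a b
  | 0, _, _, _, _, h => h
  | n + 1, s₁, s₂, _, _, h =>
      AddAr.old (tauWk Γ n (fun a => s₁ (some a)) (fun a => s₂ (some a)) h)

/-- The weakening from `Γ` to `tauTel Γ n s₁ s₂`, as an assignment. -/
def tauAsg {m : ℕ} (Γ : Tel V m) (n : ℕ) (s₁ s₂ : ObX V n → ObX V m) :
    CtxAsg Γ (tauTel Γ n s₁ s₂) where
  ob a := a
  ar h := .sym (tauWk Γ n s₁ s₂ h)

/-- The terms `τ_A`, for every object-term `A`: the new arrow-variable if `A` is a variable and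
the identity if `A` is a constant. -/
def tauTm {m : ℕ} (Γ : Tel V m) : (n : ℕ) → (s₁ s₂ : ObX V n → ObX V m) →
    (∀ c : V.O, s₁ (constOb n c) = s₂ (constOb n c)) →
    (A : ObX V n) → Tm (HomX (tauTel Γ n s₁ s₂)) (s₁ A) (s₂ A)
  | 0, _, _, hc, A => Tm.ofEq (hc A)
  | _ + 1, _, _, _, none => .sym AddAr.new
  | n + 1, s₁, s₂, hc, some A =>
      (tauTm Γ n (fun a => s₁ (some a)) (fun a => s₂ (some a)) hc A).subst
        (Asg.wkAr (HomX (tauTel Γ n (fun a => s₁ (some a)) (fun a => s₂ (some a))))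
          (s₁ none) (s₂ none))

/-- `∃ τ, φ`. -/
def exTau {m : ℕ} {Γ : Tel V m} : (n : ℕ) → (s₁ s₂ : ObX V n → ObX V m) →
    Fml V (tauTel Γ n s₁ s₂) → Fml V Γ
  | 0, _, _, φ => φ
  | n + 1, s₁, s₂, φ =>
      exTau n (fun a => s₁ (some a)) (fun a => s₂ (some a)) (.exAr (s₁ none) (s₂ none) φ)

/-- `∀ τ, φ`. -/
def allTau {m : ℕ} {Γ : Tel V m} : (n : ℕ) → (s₁ s₂ : ObX V n → ObX V m) →
    Fml V (tauTel Γ n s₁ s₂) → Fml V Γ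
  | 0, _, _, φ => φ
  | n + 1, s₁, s₂, φ =>
      allTau n (fun a => s₁ (some a)) (fun a => s₂ (some a)) (.allAr (s₁ none) (s₂ none) φ)

/-- The proposition that an arrow-term is an isomorphism. -/
def isoTm {m : ℕ} {Γ : Tel V m} {a b : ObX V m} (t : Tm (HomX Γ) a b) : Fml V Γ :=
  .exAr b a (.and
    (.eq (Δ := Γ.ar b a) (.comp (.sym AddAr.new) (t.subst (CtxAsg.wkAr Γ b a))) (.id a))
    (.eq (Δ := Γ.ar b a) (.comp (t.subst (CtxAsg.wkAr Γ b a)) (.sym AddAr.new)) (.id b)))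

/-- The proposition, in a context `Γ` in which `σ₁` and `σ₂` are two copies of `Δ`, that the
arrow-terms `τ` form a context isomorphism: `τ_V` is an isomorphism for each object-variable `V`
of `Δ`, and `g₂ ∘ τ_A = τ_B ∘ g₁` for each arrow-variable `g : A → B` of `Δ`. -/
def isoCtx {m : ℕ} {Γ : Tel V m} : {n : ℕ} → (Δ : Tel V n) → (σ₁ σ₂ : CtxAsg Δ Γ) →
    (∀ A : ObX V n, Tm (HomX Γ) (σ₁.ob A) (σ₂.ob A)) → Fml V Γ
  | _, .nil, _, _, _ => .top
  | _, .ob Δ, σ₁, σ₂, τ =>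
      .and (isoCtx Δ ((CtxAsg.wkOb Δ).comp σ₁) ((CtxAsg.wkOb Δ).comp σ₂)
        (fun A => τ (some A))) (isoTm (τ none))
  | _, .ar Δ a b, σ₁, σ₂, τ =>
      .and (isoCtx Δ ((CtxAsg.wkAr Δ a b).comp σ₁) ((CtxAsg.wkAr Δ a b).comp σ₂) τ)
        (.eq (.comp (σ₂.ar AddAr.new) (τ a)) (.comp (τ b) (σ₁.ar AddAr.new)))

/-- The proposition `τ = τ'`: equality at every object-variable. -/
def eqTau {m : ℕ} {Γ : Tel V m} : (n : ℕ) → {s₁ s₂ : ObX V n → ObX V m} →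
    (τ τ' : ∀ A : ObX V n, Tm (HomX Γ) (s₁ A) (s₂ A)) → Fml V Γ
  | 0, _, _, _, _ => .top
  | n + 1, _, _, τ, τ' =>
      .and (eqTau n (fun A => τ (some A)) (fun A => τ' (some A))) (.eq (τ none) (τ' none))

/-- In the concatenation of two copies of `Δ`: there is a unique context isomorphism from the
first copy to the second. -/
def uniqueIso {n : ℕ} (Δ : Tel V n) : Fml V (Δ.append Δ) :=
  let s₁ : ObX V n → ObX V (n + n) := injL n
  let s₂ : ObX V n → ObX V (n + n) := injR n n
  have hc : ∀ c : V.O, s₁ (constOb n c) = s₂ (constOb n c) := fun c =>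
    (injL_constOb n n c).trans (injR_constOb n n c).symm
  let Γ₁ := tauTel (Δ.append Δ) n s₁ s₂
  let w₁ : CtxAsg (Δ.append Δ) Γ₁ := tauAsg (Δ.append Δ) n s₁ s₂
  let τ₁ : ∀ A, Tm (HomX Γ₁) (s₁ A) (s₂ A) := tauTm (Δ.append Δ) n s₁ s₂ hc
  let Γ₂ := tauTel Γ₁ n s₁ s₂
  let w₂ : CtxAsg Γ₁ Γ₂ := tauAsg Γ₁ n s₁ s₂
  let τ₂ : ∀ A, Tm (HomX Γ₂) (s₁ A) (s₂ A) := tauTm Γ₁ n s₁ s₂ hc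
  let τ₁' : ∀ A, Tm (HomX Γ₂) (s₁ A) (s₂ A) := fun A => (τ₁ A).subst w₂
  .and
    (exTau n s₁ s₂ (isoCtx Δ ((asgL Δ Δ).comp w₁) ((asgR Δ Δ).comp w₁) τ₁))
    (allTau n s₁ s₂ (allTau n s₁ s₂ (.imp
      (.and
        (isoCtx Δ (((asgL Δ Δ).comp w₁).comp w₂) (((asgR Δ Δ).comp w₁).comp w₂) τ₁')
        (isoCtx Δ (((asgL Δ Δ).comp w₁).comp w₂) (((asgR Δ Δ).comp w₁).comp w₂) τ₂))
      (eqTau n τ₁' τ₂))))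

/-- `∃! Δ, P`: there is a `Δ` with `P`, and any two such are related by a unique context
isomorphism. -/
def exUnique {n : ℕ} (Δ : Tel V n) (P : Fml V Δ) : Sentence V :=
  .and (exTel Δ P)
    (allTel (Δ.append Δ)
      (.imp (.and (P.subst (asgL Δ Δ)) (P.subst (asgR Δ Δ))) (uniqueIso Δ)))

end Unique

/-! ## Consistency, disjunction and existence properties -/

def Theory.Consistent {V : Voc.{u}} (T : Theory V) : Prop := ¬ T.Proves .bot

def Theory.DisjunctionProperty {V : Voc.{u}} (T : Theory V) : Prop :=
  ∀ φ ψ : Sentence V, T.Proves (.or φ ψ) → T.Proves φ ∨ T.Proves ψ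

/-- The existence property of a theory without constants: if `T ⊢ ∃ Θ, P`, then some context `Δ`
and `Q` with `T ⊢ ∃! Δ, Q` and some assignment `c` of terms in context `Δ` to the variables of `Θ`
satisfy `T ⊢ ∃ Δ, (Q ∧ P(c))`. -/
def Theory.ExistenceProperty (T : Theory Pure.{u}) : Prop :=
  ∀ (n : ℕ) (Θ : Tel Pure.{u} n) (P : Fml Pure Θ), T.Proves (exTel Θ P) →
    ∃ (m : ℕ) (Δ : Tel Pure.{u} m) (c : CtxAsg Θ Δ) (Q : Fml Pure Δ),
      T.Proves (exUnique Δ Q) ∧ T.Proves (exTel Δ (.and Q (P.subst c)))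

/-! ## The term-complete definitional extension -/

/-- The sentences of the pure language are sentences over any vocabulary. -/
def ofPure (V : Voc.{v}) : CtxAsg (Tel.nil : Tel Pure.{u} 0) (Tel.nil : Tel V 0) where
  ob c := PEmpty.elim c
  ar {a _} _ := PEmpty.elim a

/-- The pairs `(Δ, P)` with `T ⊢ ∃! Δ, P`. -/
structure Descr (T : Theory Pure.{0}) where
  n : ℕ
  Δ : Tel Pure.{0} n
  P : Fml Pure Δ
  proves : T.Proves (exUnique Δ P)

/-- Object-constants of the first extension: one for each object-variable of each `Δ` with
`T ⊢ ∃! Δ, P`. -/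
def Ob1 (T : Theory Pure.{0}) : Type := Σ s : Descr T, ObX Pure.{0} s.n

/-- Arrow-constants of the first extension: one for each arrow-variable of each `Δ` with
`T ⊢ ∃! Δ, P`. -/
inductive Hom1 (T : Theory Pure.{0}) : Ob1 T → Ob1 T → Type
  | const (s : Descr T) {a b : ObX Pure.{0} s.n} (g : HomX s.Δ a b) : Hom1 T ⟨s, a⟩ ⟨s, b⟩

def Voc1 (T : Theory Pure.{0}) : Voc.{0} := ⟨Ob1 T, Hom1 T⟩

/-- The assignment of its constants to the variables of `Δ`. -/
def Descr.asg {T : Theory Pure.{0}} (s : Descr T) :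
    CtxAsg s.Δ (Tel.nil : Tel (Voc1 T) 0) where
  ob a := (⟨s, a⟩ : Ob1 T)
  ar g := .sym (Hom1.const s g)

/-- The first extension: `T` together with `P(c)` for the constants `c` of each pair `(Δ, P)`. -/
def Theory1 (T : Theory Pure.{0}) : Theory (Voc1 T) :=
  {φ | ∃ ψ ∈ T, φ = ψ.subst (ofPure (Voc1 T))} ∪ {φ | ∃ s : Descr T, φ = s.P.subst s.asg}

/-- Arrow-constants of the second extension: those of the first, and one for each `P` with
`∃! f : a → b, P(f)` provable in the first extension. -/
inductive Hom2 (T : Theory Pure.{0}) : Ob1 T → Ob1 T → Type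
  | old {a b : Ob1 T} (h : Hom1 T a b) : Hom2 T a b
  | const {a b : Ob1 T} (P : Fml (Voc1 T) (Tel.ar (V := Voc1 T) Tel.nil a b))
      (hP : (Theory1 T).Proves (exUnique (Tel.ar (V := Voc1 T) Tel.nil a b) P)) : Hom2 T a b

def Voc2 (T : Theory Pure.{0}) : Voc.{0} := ⟨Ob1 T, Hom2 T⟩

/-- The inclusion of the first extension into the second. -/
def incl12 (T : Theory Pure.{0}) :
    CtxAsg (Tel.nil : Tel (Voc1 T) 0) (Tel.nil : Tel (Voc2 T) 0) where
  ob a := a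
  ar h := .sym (Hom2.old h)

/-- The second extension: the first together with `P(c)` for each new constant `c`. -/
def Theory2 (T : Theory Pure.{0}) : Theory (Voc2 T) :=
  {φ | ∃ ψ ∈ Theory1 T, φ = ψ.subst (incl12 T)} ∪
  {φ | ∃ (a b : Ob1 T) (P : Fml (Voc1 T) (Tel.ar (V := Voc1 T) Tel.nil a b))
      (hP : (Theory1 T).Proves (exUnique (Tel.ar (V := Voc1 T) Tel.nil a b) P)),
      φ = P.subst (CtxAsg.consAr (incl12 T) (.sym (Hom2.const P hP)))}

/-- Closed arrow-terms of the second extension. -/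
abbrev Tm2 (T : Theory Pure.{0}) (a b : Ob1 T) : Type :=
  Tm (HomX (Tel.nil : Tel (Voc2 T) 0)) a b

/-- Provable equality of closed arrow-terms of the second extension. -/
def provEq (T : Theory Pure.{0}) (a b : Ob1 T) : Setoid (Tm2 T a b) where
  r f g := (Theory2 T).Proves (.eq f g)
  iseqv := ⟨fun f => Deriv.eqRefl f, fun h => Deriv.eqSymm h, fun h k => Deriv.eqTrans h k⟩

/-- The category formed by the constants of the term-complete extension: the objects are the
object-constants, and the arrows, which are the arrow-constants, are the closed arrow-terms of the
second extension up to provable equality. -/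
def TComp (T : Theory Pure.{0}) : Type := Ob1 T

instance (T : Theory Pure.{0}) : Category.{0} (TComp T) where
  Hom a b := Quotient (provEq T a b)
  id a := Quotient.mk (provEq T a a) (Tm.id (O := Ob1 T) a)
  comp {a b c} f g :=
    Quotient.map₂ (sa := provEq T a b) (sb := provEq T b c) (sc := provEq T a c)
      (fun f g => Tm.comp g f) (fun _ _ h _ _ k => Deriv.eqComp h k) f g
  id_comp {a b} f := by
    induction f using Quotient.inductionOn with
    | h f => exact Quotient.sound (s := provEq T a b) (Deriv.eqSymm (Deriv.compId f))
  comp_id {a b} f := by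
    induction f using Quotient.inductionOn with
    | h f => exact Quotient.sound (s := provEq T a b) (Deriv.eqSymm (Deriv.idComp f))
  assoc {a b c d} f g k := by
    induction f using Quotient.inductionOn with
    | h f =>
      induction g using Quotient.inductionOn with
      | h g =>
        induction k using Quotient.inductionOn with
        | h k => exact Quotient.sound (s := provEq T a d) (Deriv.assoc f g k)

/-- The vocabulary of the objects and arrows of a small category. -/
def catVoc (C : Type u) [SmallCategory C] : Voc.{u} := ⟨C, fun a b => (a ⟶ b)⟩

/-- The class of a closed arrow-term. -/
def Tm2.cls {T : Theory Pure.{0}} {a b : TComp T} (f : Tm2 T a b) : a ⟶ b :=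
  Quotient.mk (provEq T a b) f

/-- The passage from the second extension to the term-complete one. -/
def quot23 (T : Theory Pure.{0}) :
    CtxAsg (Tel.nil : Tel (Voc2 T) 0) (Tel.nil : Tel (catVoc (TComp T)) 0) where
  ob a := a
  ar h := .sym (Tm2.cls (.sym h))

/-- The term-complete definitional extension of `T`: the second extension, in which the closed
arrow-terms, up to provable equality, have become the arrow-constants. -/
def TCompTheory (T : Theory Pure.{0}) : Theory (catVoc (TComp T)) :=
  {φ | ∃ ψ ∈ Theory2 T, φ = ψ.subst (quot23 T)} ∪
  {φ | ∃ (a b : Ob1 T) (f : Tm2 T a b), φ = .eq (.sym (Tm2.cls f)) (f.subst (quot23 T))}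

/-! ## The Friedman slash -/

/-- A model for a theory: a congruence of closed arrow-terms that is contained in provable
equality. -/
structure Model {V : Voc.{u}} (T : Theory V) where
  rel : ∀ {a b : V.O}, Tm (HomX (Tel.nil : Tel V 0)) a b →
    Tm (HomX (Tel.nil : Tel V 0)) a b → Prop
  proves : ∀ {a b : V.O} {f g : Tm (HomX (Tel.nil : Tel V 0)) a b}, rel f g →
    T.Proves (.eq f g)
  equivalence : ∀ a b : V.O, Equivalence (rel (a := a) (b := b))
  comp : ∀ {a b c : V.O} {f₁ f₂ : Tm (HomX (Tel.nil : Tel V 0)) a b}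
    {g₁ g₂ : Tm (HomX (Tel.nil : Tel V 0)) b c}, rel f₁ f₂ → rel g₁ g₂ →
    rel (.comp g₁ f₁) (.comp g₂ f₂)

/-- `FPat T M φ ρ` is `FP_{T,M}(φ(ρ))` for a proposition `φ` in a context and an assignment `ρ` of
closed terms. -/
def FPat {V : Voc.{u}} (T : Theory V) (M : Model T) : {n : ℕ} → {Δ : Tel V n} → Fml V Δ →
    CtxAsg Δ (Tel.nil : Tel V 0) → Prop
  | _, _, .eq f g, ρ => M.rel (f.subst ρ) (g.subst ρ)
  | _, _, .top, _ => True
  | _, _, .bot, _ => False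
  | _, _, .and φ ψ, ρ => FPat T M φ ρ ∧ FPat T M ψ ρ
  | _, _, .or φ ψ, ρ => FPat T M φ ρ ∨ FPat T M ψ ρ
  | _, _, .imp φ ψ, ρ =>
      (FPat T M φ ρ → FPat T M ψ ρ) ∧ T.Proves ((Fml.imp φ ψ).subst ρ)
  | _, _, .allOb φ, ρ =>
      (∀ c : V.O, FPat T M φ (CtxAsg.consOb ρ c)) ∧ T.Proves ((Fml.allOb φ).subst ρ)
  | _, _, .exOb φ, ρ => ∃ c : V.O, FPat T M φ (CtxAsg.consOb ρ c)
  | _, _, .allAr a b φ, ρ =>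
      (∀ t : Tm (HomX (Tel.nil : Tel V 0)) (ρ.ob a) (ρ.ob b), FPat T M φ (CtxAsg.consAr ρ t)) ∧
        T.Proves ((Fml.allAr a b φ).subst ρ)
  | _, _, .exAr a b φ, ρ =>
      ∃ t : Tm (HomX (Tel.nil : Tel V 0)) (ρ.ob a) (ρ.ob b), FPat T M φ (CtxAsg.consAr ρ t)

/-- `FP_{T,M}(φ)`: the sentence `φ` is Friedman-slashed and provable. -/
def FP {V : Voc.{u}} (T : Theory V) (M : Model T) (φ : Sentence V) : Prop :=
  FPat T M φ (CtxAsg.id Tel.nil)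

/-! ## The Freyd cover -/

/-- The global sections functor `A ↦ {1 → A}` to sets. -/
def globalSections {T : Theory Pure.{0}} (one : TComp T) : TComp T ⥤ Type w :=
  coyoneda.obj (Opposite.op one) ⋙ uliftFunctor.{w}

section Freyd

variable {T : Theory Pure.{0}} {Tiny : Type u} [SmallCategory Tiny]

/-- Artin gluing along `Γ`: objects are triples `(X, S, X ⟶ Γ S)`, arrows are commutative
squares. -/
abbrev FreydCover (Γ : TComp T ⥤ Tiny) : Type u := Comma (𝟭 Tiny) Γ

/-- The projection `S ↦ S⁻`, `φ ↦ φ⁻` to the constants of the term-complete extension. -/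
def minus (Γ : TComp T ⥤ Tiny) :
    CtxAsg (Tel.nil : Tel (catVoc (FreydCover Γ)) 0) (Tel.nil : Tel (catVoc (TComp T)) 0) where
  ob := fun S : FreydCover Γ => S.right
  ar {a b} h := .sym (show (show FreydCover Γ from a).right ⟶ (show FreydCover Γ from b).right
    from CommaMorphism.right h)

/-- The theory whose constants are the objects and arrows of the Freyd cover, and which proves
`φ` when the term-complete extension proves `φ⁻`. -/
def TStar (Γ : TComp T ⥤ Tiny) : Theory (catVoc (FreydCover Γ)) :=
  {φ | (TCompTheory T).Proves (φ.subst (minus Γ))}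

/-- The value of a closed arrow-term built from the arrows of a small category `C`: the
retraction from terms to `C`. -/
def Tm.value {C : Type u} [SmallCategory C] :
    {a b : C} → Tm (HomX (Tel.nil : Tel (catVoc C) 0)) a b → (a ⟶ b)
  | _, _, .sym h => h
  | a, _, .id _ => 𝟙 a
  | _, _, .comp g f => f.value ≫ g.value

theorem TCompTheory.proves_cls {a b : TComp T} (f : Tm2 T a b) :
    (TCompTheory T).Proves (.eq (.sym (Tm2.cls f)) (f.subst (quot23 T))) :=
  Deriv.hyp (Or.inr ⟨a, b, f, rfl⟩)

/-- Every closed arrow-term of the term-complete extension that is of the form `t⁻` is provably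
equal to the arrow-constant that is its value. -/
theorem TCompTheory.proves_value (Γ : TComp T ⥤ Tiny) {a b : FreydCover Γ}
    (t : Tm (HomX (Tel.nil : Tel (catVoc (FreydCover Γ)) 0)) a b) :
    (TCompTheory T).Proves (.eq (t.subst (minus Γ))
      (.sym (show (a.right ⟶ b.right) from (Tm.value t).right))) := by
  induction t with
  | sym h => exact Deriv.eqRefl _
  | id a => exact Deriv.eqSymm (TCompTheory.proves_cls (T := T) (Tm.id a.right))
  | @comp a b c g f ihg ihf =>
    refine Deriv.eqTrans (Deriv.eqComp ihf ihg) ?_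
    change (TCompTheory T).Proves (.eq (.comp (.sym (Tm.value g).right) (.sym (Tm.value f).right))
      (.sym ((Tm.value f).right ≫ (Tm.value g).right)))
    generalize (Tm.value g).right = g'
    generalize (Tm.value f).right = f'
    induction f' using Quotient.inductionOn with
    | h f' =>
      induction g' using Quotient.inductionOn with
      | h g' =>
        exact Deriv.eqTrans (Deriv.eqComp (TCompTheory.proves_cls f') (TCompTheory.proves_cls g'))
          (Deriv.eqSymm (TCompTheory.proves_cls (T := T) (Tm.comp g' f')))

/-- The model given by the Freyd cover: two closed arrow-terms are identified when they denote
equal arrows of the Freyd cover. -/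
def freydModel (Γ : TComp T ⥤ Tiny) : Model (TStar Γ) where
  rel f g := Tm.value f = Tm.value g
  proves {a b f g} h := by
    refine Deriv.hyp ?_
    change (TCompTheory T).Proves (.eq (f.subst (minus Γ)) (g.subst (minus Γ)))
    refine Deriv.eqTrans (TCompTheory.proves_value Γ f) ?_
    rw [h]
    exact Deriv.eqSymm (TCompTheory.proves_value Γ g)
  equivalence _ _ := ⟨fun _ => rfl, fun h => h.symm, fun h k => h.trans k⟩
  comp {a b c f₁ f₂ g₁ g₂} h k := by
    change Tm.value f₁ ≫ Tm.value g₁ = Tm.value f₂ ≫ Tm.value g₂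
    rw [h, k]

end Freyd

end CatTheory

/-!
The argument has two halves: the Friedman slash produces closed witnesses over the Freyd cover, and
conservativity of the successive extensions of `T` turns these witnesses into definable ones.

*Slash.* The slashed and provable propositions are closed under deduction (`Deriv.FPat`). For
equations this needs only that the Freyd cover is a category. So every theorem of `T` is slashed
(`FP_of_proves`). As `⊥` is not slashed, `T` is consistent. A slashed disjunction has a slashed
disjunct, and a slashed `∃ Θ, P` has a slashed instance at closed terms (`FPat_exTel`). Slashed
sentences are provable in `TStar Γ`, so their projections are provable in the term-complete
extension (`TComp_proves_of_FP`). What remains is to bring such a proof down to `T`.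

*From the term-complete extension to the second one.* Choosing representatives of the classes of
closed terms interprets the former in the latter. Its axioms hold of the representatives, because
propositions are invariant under isomorphism (`CtxIso.transport`), in particular under replacing
terms by provably equal ones.

*From the second extension to the first.* A constant introduced for an arrow with `∃! f, P f` is
eliminated in favour of its graph `P`. A relational assignment (`RAsg`) gives a graph to each arrow
symbol, and propositions are translated along it (`Fml.star`), equations becoming inclusions of
graphs. The translation is sound when the graphs are functional (`Deriv.star`).

*From the first extension to `T`.* A deduction uses finitely many axioms (`Deriv.exists_finite`),
hence finitely many contexts with `∃! Δ, Q`. Concatenation of uniquely described contexts gives one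
in which all constants involved are interpreted (`IsDescr.append`, `exists_interp`). Adding the
arrows that the graphs describe keeps the context uniquely described (`IsDescr.consAr`), and the
graphs then have terms as values (`IsDescr.exists_values`). The result is `Theory2.exists_exTel`:
if the second extension proves `P` of closed terms, then `T` proves `P` of terms over a uniquely
described context. This is the existence property; for a sentence `P` it says that `T` proves `P`,
whence the disjunction property.

Deductions are handled through extensions of hypotheses: `Ext Γ Γ' w` says that the hypotheses
`Γ'`, possibly in a larger context or another vocabulary, imply `Γ` along the assignment `w`.
Introducing a variable becomes an argument at all extensions, and an existence statement provides a
witness at some extension.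
-/

universe x

namespace CatTheory

/-! ### Calculus of assignments -/

section Calculus

variable {O : Type u} {O' : Type v} {O'' : Type w} {O''' : Type x}
  {H : O → O → Type u} {H' : O' → O' → Type v} {H'' : O'' → O'' → Type w}
  {H''' : O''' → O''' → Type x}

theorem Asg.ext' {σ τ : Asg H H'} (hob : ∀ a, σ.ob a = τ.ob a)
    (har : ∀ {a b : O} (h : H a b), HEq (σ.ar h) (τ.ar h)) : σ = τ := by
  obtain ⟨o₁, r₁⟩ := σ
  obtain ⟨o₂, r₂⟩ := τ
  obtain rfl : o₁ = o₂ := funext hob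
  congr 1
  funext a b h
  exact eq_of_heq (har h)

theorem Tm.subst_id {a b : O} (t : Tm H a b) : t.subst (Asg.id H) = t := by
  induction t with
  | sym h => rfl
  | id a => rfl
  | comp g f ihg ihf =>
    exact congrArg₂ Tm.comp ihg ihf

theorem Tm.subst_subst {a b : O} (t : Tm H a b) (σ : Asg H H') (τ : Asg H' H'') :
    (t.subst σ).subst τ = t.subst (σ.comp τ) := by
  induction t with
  | sym h => rfl
  | id a => rfl
  | comp g f ihg ihf =>
    change Tm.comp ((g.subst σ).subst τ) ((f.subst σ).subst τ) = _
    rw [ihg, ihf]; rfl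

theorem Asg.comp_assoc (σ : Asg H H') (τ : Asg H' H'') (υ : Asg H'' H''') :
    (σ.comp τ).comp υ = σ.comp (τ.comp υ) := by
  refine Asg.ext' (fun _ => rfl) (fun h => heq_of_eq ?_)
  exact Tm.subst_subst _ _ _

theorem Asg.comp_id (σ : Asg H H') : σ.comp (Asg.id H') = σ :=
  Asg.ext' (fun _ => rfl) (fun _ => heq_of_eq (Tm.subst_id _))

end Calculus

/-! ### Substitution in propositions -/

section CtxCalculus

variable {V : Voc.{u}} {W : Voc.{v}} {U : Voc.{w}} {n m k : ℕ}
  {Δ : Tel V n} {Δ' : Tel W m} {Δ'' : Tel U k}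

/-- Equality of assignments of an extended context, checked on the old symbols as one equation
between assignments and on the new object separately. -/
theorem CtxAsg.ext_ob {σ τ : CtxAsg Δ.ob Δ'}
    (h : Asg.comp (CtxAsg.wkOb Δ) σ = Asg.comp (CtxAsg.wkOb Δ) τ) (h' : σ.ob none = τ.ob none) :
    σ = τ := by
  refine Asg.ext' ?_ ?_
  · rintro (_ | a)
    · exact h'
    · exact congrFun (congrArg Asg.ob h) a
  · rintro _ _ ⟨h₁⟩
    exact congr_arg_heq (fun ρ : CtxAsg Δ Δ' => ρ.ar h₁) h

/-- The analogue of `CtxAsg.ext_ob` for a new arrow. The common restriction `σ` is a separate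
argument, and the new values are compared by `HEq`, as their sorts agree only propositionally. -/
theorem CtxAsg.ext_ar {a b : ObX V n} {σ : CtxAsg Δ Δ'} {τ₁ τ₂ : CtxAsg (Δ.ar a b) Δ'}
    (h₁ : Asg.comp (CtxAsg.wkAr Δ a b) τ₁ = σ) (h₂ : Asg.comp (CtxAsg.wkAr Δ a b) τ₂ = σ)
    (h' : HEq (τ₁.ar AddAr.new) (τ₂.ar AddAr.new)) : τ₁ = τ₂ := by
  subst h₁
  refine Asg.ext' ?_ ?_
  · intro c
    exact (congrFun (congrArg Asg.ob h₂) c).symm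
  · rintro _ _ (h | _)
    · exact (congr_arg_heq (fun ρ : CtxAsg Δ Δ' => ρ.ar h) h₂).symm
    · exact h'

theorem CtxAsg.consOb_eta (σ : CtxAsg Δ.ob Δ') :
    CtxAsg.consOb (Asg.comp (CtxAsg.wkOb Δ) σ) (σ.ob none) = σ :=
  CtxAsg.ext_ob rfl rfl

theorem CtxAsg.consAr_eta {a b : ObX V n} (σ : CtxAsg (Δ.ar a b) Δ') :
    CtxAsg.consAr (Asg.comp (CtxAsg.wkAr Δ a b) σ) (σ.ar AddAr.new) = σ :=
  CtxAsg.ext_ar rfl rfl HEq.rfl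

theorem CtxAsg.consAr_congr {a b : ObX V n} {σ τ : CtxAsg Δ Δ'} (h : σ = τ)
    {t : Tm (HomX Δ') (σ.ob a) (σ.ob b)} {t' : Tm (HomX Δ') (τ.ob a) (τ.ob b)} (ht : HEq t t') :
    CtxAsg.consAr σ t = CtxAsg.consAr τ t' := by
  subst h
  rw [eq_of_heq ht]

theorem CtxAsg.exists_consOb (σ : CtxAsg Δ.ob Δ') : ∃ σ' c, σ = CtxAsg.consOb σ' c :=
  ⟨_, _, (CtxAsg.consOb_eta σ).symm⟩

theorem CtxAsg.exists_consAr {a b : ObX V n} (σ : CtxAsg (Δ.ar a b) Δ') :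
    ∃ (σ' : CtxAsg Δ Δ') (t : Tm (HomX Δ') (σ'.ob a) (σ'.ob b)), σ = CtxAsg.consAr σ' t :=
  ⟨_, _, (CtxAsg.consAr_eta σ).symm⟩

theorem CtxAsg.comp_id (σ : CtxAsg Δ Δ') : Asg.comp σ (CtxAsg.id Δ') = σ := Asg.comp_id σ

theorem CtxAsg.consOb_comp (σ : CtxAsg Δ Δ') (c : ObX W m) (τ : CtxAsg Δ' Δ'') :
    Asg.comp (CtxAsg.consOb σ c) τ = CtxAsg.consOb (Asg.comp σ τ) (τ.ob c) :=
  CtxAsg.ext_ob rfl rfl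

theorem CtxAsg.consAr_comp (σ : CtxAsg Δ Δ') {a b : ObX V n}
    (t : Tm (HomX Δ') (σ.ob a) (σ.ob b)) (τ : CtxAsg Δ' Δ'') :
    Asg.comp (CtxAsg.consAr σ t) τ
      = CtxAsg.consAr (Asg.comp σ τ) (a := a) (b := b) (t.subst τ) :=
  CtxAsg.ext_ar rfl rfl HEq.rfl

theorem CtxAsg.wkOb_liftOb (σ : CtxAsg Δ Δ') :
    Asg.comp (CtxAsg.wkOb Δ) (CtxAsg.liftOb σ) = Asg.comp σ (CtxAsg.wkOb Δ') := rfl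

theorem CtxAsg.wkAr_liftAr (σ : CtxAsg Δ Δ') (a b : ObX V n) :
    Asg.comp (CtxAsg.wkAr Δ a b) (CtxAsg.liftAr σ a b)
      = Asg.comp σ (CtxAsg.wkAr Δ' (σ.ob a) (σ.ob b)) := rfl

theorem CtxAsg.liftOb_id : CtxAsg.liftOb (CtxAsg.id Δ) = CtxAsg.id Δ.ob :=
  CtxAsg.ext_ob rfl rfl

theorem CtxAsg.liftAr_id (a b : ObX V n) :
    CtxAsg.liftAr (CtxAsg.id Δ) a b = CtxAsg.id (Δ.ar a b) :=
  CtxAsg.ext_ar rfl rfl HEq.rfl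

theorem CtxAsg.liftOb_consOb (σ : CtxAsg Δ Δ') (τ : CtxAsg Δ' Δ'') (c : ObX U k) :
    Asg.comp (CtxAsg.liftOb σ) (CtxAsg.consOb τ c) = CtxAsg.consOb (Asg.comp σ τ) c :=
  CtxAsg.ext_ob (by
    rw [← Asg.comp_assoc, CtxAsg.wkOb_liftOb, Asg.comp_assoc]; rfl) rfl

theorem CtxAsg.liftAr_consAr (σ : CtxAsg Δ Δ') (τ : CtxAsg Δ' Δ'') (a b : ObX V n)
    (t : Tm (HomX Δ'') (τ.ob (σ.ob a)) (τ.ob (σ.ob b))) :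
    Asg.comp (CtxAsg.liftAr σ a b) (CtxAsg.consAr τ t)
      = CtxAsg.consAr (Asg.comp σ τ) (a := a) (b := b) t :=
  CtxAsg.ext_ar (σ := Asg.comp σ τ) (by
    rw [← Asg.comp_assoc, CtxAsg.wkAr_liftAr, Asg.comp_assoc]; rfl) rfl HEq.rfl

theorem CtxAsg.liftOb_comp (σ : CtxAsg Δ Δ') (τ : CtxAsg Δ' Δ'') :
    CtxAsg.liftOb (Asg.comp σ τ) = Asg.comp (CtxAsg.liftOb σ) (CtxAsg.liftOb τ) := by
  refine CtxAsg.ext_ob ?_ rfl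
  rw [← Asg.comp_assoc, CtxAsg.wkOb_liftOb, CtxAsg.wkOb_liftOb, Asg.comp_assoc, Asg.comp_assoc,
    CtxAsg.wkOb_liftOb]

theorem CtxAsg.liftAr_comp (σ : CtxAsg Δ Δ') (τ : CtxAsg Δ' Δ'') (a b : ObX V n) :
    CtxAsg.liftAr (Asg.comp σ τ) a b
      = Asg.comp (CtxAsg.liftAr σ a b) (CtxAsg.liftAr τ (σ.ob a) (σ.ob b)) := by
  refine CtxAsg.ext_ar rfl ?_ HEq.rfl
  exact (Asg.comp_assoc σ (CtxAsg.wkAr Δ' (σ.ob a) (σ.ob b))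
    (CtxAsg.liftAr τ (σ.ob a) (σ.ob b))).trans
    (Asg.comp_assoc σ τ (CtxAsg.wkAr Δ'' (τ.ob (σ.ob a)) (τ.ob (σ.ob b)))).symm

theorem Fml.subst_id (φ : Fml V Δ) : φ.subst (CtxAsg.id Δ) = φ := by
  induction φ with
  | eq f g => exact congrArg₂ Fml.eq (Tm.subst_id f) (Tm.subst_id g)
  | top => rfl
  | bot => rfl
  | and φ ψ h₁ h₂ => exact congrArg₂ Fml.and h₁ h₂
  | or φ ψ h₁ h₂ => exact congrArg₂ Fml.or h₁ h₂
  | imp φ ψ h₁ h₂ => exact congrArg₂ Fml.imp h₁ h₂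
  | allOb φ h =>
    refine congrArg Fml.allOb ?_
    rw [CtxAsg.liftOb_id]; exact h
  | exOb φ h =>
    refine congrArg Fml.exOb ?_
    rw [CtxAsg.liftOb_id]; exact h
  | allAr a b φ h =>
    refine congrArg (Fml.allAr a b) ?_
    exact (congrArg φ.subst (CtxAsg.liftAr_id a b)).trans h
  | exAr a b φ h =>
    refine congrArg (Fml.exAr a b) ?_
    exact (congrArg φ.subst (CtxAsg.liftAr_id a b)).trans h

theorem Fml.subst_subst (φ : Fml V Δ) (σ : CtxAsg Δ Δ') (τ : CtxAsg Δ' Δ'') :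
    (φ.subst σ).subst τ = φ.subst (Asg.comp σ τ) := by
  induction φ generalizing m k with
  | eq f g => exact congrArg₂ Fml.eq (Tm.subst_subst f σ τ) (Tm.subst_subst g σ τ)
  | top => rfl
  | bot => rfl
  | and φ ψ h₁ h₂ => exact congrArg₂ Fml.and (h₁ _ _) (h₂ _ _)
  | or φ ψ h₁ h₂ => exact congrArg₂ Fml.or (h₁ _ _) (h₂ _ _)
  | imp φ ψ h₁ h₂ => exact congrArg₂ Fml.imp (h₁ _ _) (h₂ _ _)
  | allOb φ h =>
    refine congrArg Fml.allOb ?_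
    rw [CtxAsg.liftOb_comp]; exact h _ _
  | exOb φ h =>
    refine congrArg Fml.exOb ?_
    rw [CtxAsg.liftOb_comp]; exact h _ _
  | allAr a b φ h =>
    refine congrArg (Fml.allAr _ _) ?_
    exact (h _ _).trans (congrArg φ.subst (CtxAsg.liftAr_comp σ τ a b).symm)
  | exAr a b φ h =>
    refine congrArg (Fml.exAr _ _) ?_
    exact (h _ _).trans (congrArg φ.subst (CtxAsg.liftAr_comp σ τ a b).symm)

theorem Fml.wkOb_subst (φ : Fml V Δ) (σ : CtxAsg Δ.ob Δ') :
    φ.wkOb.subst σ = φ.subst (Asg.comp (CtxAsg.wkOb Δ) σ) := Fml.subst_subst _ _ _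

theorem Fml.wkAr_subst {a b : ObX V n} (φ : Fml V Δ) (σ : CtxAsg (Δ.ar a b) Δ') :
    (φ.wkAr a b).subst σ = φ.subst (Asg.comp (CtxAsg.wkAr Δ a b) σ) := Fml.subst_subst _ _ _

theorem Fml.subst_wkOb (φ : Fml V Δ) (σ : CtxAsg Δ Δ') :
    (φ.subst σ).wkOb = φ.subst (Asg.comp σ (CtxAsg.wkOb Δ')) := Fml.subst_subst _ _ _

theorem Fml.subst_wkAr (φ : Fml V Δ) (σ : CtxAsg Δ Δ') (a b : ObX W m) :
    (φ.subst σ).wkAr a b = φ.subst (Asg.comp σ (CtxAsg.wkAr Δ' a b)) := Fml.subst_subst _ _ _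

theorem Fml.instOb_subst (φ : Fml V Δ.ob) (c : ObX V n) (σ : CtxAsg Δ Δ') :
    (φ.instOb c).subst σ = φ.subst (CtxAsg.consOb σ (σ.ob c)) :=
  (Fml.subst_subst _ _ _).trans (congrArg φ.subst (CtxAsg.consOb_comp _ _ _))

theorem Fml.instAr_subst {a b : ObX V n} (φ : Fml V (Δ.ar a b)) (t : Tm (HomX Δ) a b)
    (σ : CtxAsg Δ Δ') :
    (φ.instAr t).subst σ = φ.subst (CtxAsg.consAr σ (t.subst σ)) :=
  (Fml.subst_subst _ _ _).trans (congrArg φ.subst (CtxAsg.consAr_comp _ _ _))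

theorem Fml.liftOb_instOb (φ : Fml V Δ.ob) (σ : CtxAsg Δ Δ') (c : ObX W m) :
    (φ.subst (CtxAsg.liftOb σ)).instOb c = φ.subst (CtxAsg.consOb σ c) :=
  (Fml.subst_subst _ _ _).trans (congrArg φ.subst
    ((CtxAsg.liftOb_consOb _ _ _).trans (by rw [CtxAsg.comp_id])))

theorem CtxAsg.liftAr_inst (σ : CtxAsg Δ Δ') {a b : ObX V n}
    (t : Tm (HomX Δ') (σ.ob a) (σ.ob b)) :
    Asg.comp (CtxAsg.liftAr σ a b) (CtxAsg.consAr (CtxAsg.id Δ') t) = CtxAsg.consAr σ t :=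
  CtxAsg.ext_ar (σ := σ) ((Asg.comp_assoc σ (CtxAsg.wkAr Δ' (σ.ob a) (σ.ob b))
    (CtxAsg.consAr (CtxAsg.id Δ') t)).trans (CtxAsg.comp_id σ)) rfl HEq.rfl

theorem Fml.liftAr_instAr {a b : ObX V n} (φ : Fml V (Δ.ar a b)) (σ : CtxAsg Δ Δ')
    (t : Tm (HomX Δ') (σ.ob a) (σ.ob b)) :
    (φ.subst (CtxAsg.liftAr σ a b)).instAr t = φ.subst (CtxAsg.consAr σ t) :=
  (Fml.subst_subst _ _ _).trans (congrArg φ.subst (CtxAsg.liftAr_inst _ _))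

end CtxCalculus

/-! ### Deductions and substitution -/

section Deduction

variable {V : Voc.{u}} {W : Voc.{v}} {n m : ℕ}

theorem Deriv.of_eq {Δ : Tel V n} {Γ : Set (Fml V Δ)} {φ ψ : Fml V Δ} (h : Deriv Δ Γ φ)
    (e : φ = ψ) : Deriv Δ Γ ψ := e ▸ h

theorem Deriv.mono {Δ : Tel V n} {Γ Γ' : Set (Fml V Δ)} {φ : Fml V Δ} (h : Deriv Δ Γ φ)
    (hΓ : Γ ⊆ Γ') : Deriv Δ Γ' φ := by
  induction h with
  | hyp h => exact .hyp (hΓ h)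
  | topI => exact .topI
  | botE _ ih => exact .botE (ih hΓ)
  | andI _ _ ih₁ ih₂ => exact .andI (ih₁ hΓ) (ih₂ hΓ)
  | andE₁ _ ih => exact .andE₁ (ih hΓ)
  | andE₂ _ ih => exact .andE₂ (ih hΓ)
  | orI₁ _ ih => exact .orI₁ (ih hΓ)
  | orI₂ _ ih => exact .orI₂ (ih hΓ)
  | orE _ _ _ ih ih₁ ih₂ =>
    exact .orE (ih hΓ) (ih₁ (Set.insert_subset_insert hΓ)) (ih₂ (Set.insert_subset_insert hΓ))
  | impI _ ih => exact .impI (ih (Set.insert_subset_insert hΓ))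
  | impE _ _ ih ih₁ => exact .impE (ih hΓ) (ih₁ hΓ)
  | allObI _ ih => exact .allObI (ih (Set.image_mono hΓ))
  | allObE _ c ih => exact .allObE (ih hΓ) c
  | exObI c _ ih => exact .exObI c (ih hΓ)
  | exObE _ _ ih ih₁ =>
    exact .exObE (ih hΓ) (ih₁ (Set.insert_subset_insert (Set.image_mono hΓ)))
  | allArI _ ih => exact .allArI (ih (Set.image_mono hΓ))
  | allArE _ c ih => exact .allArE (ih hΓ) c
  | exArI c _ ih => exact .exArI c (ih hΓ)
  | exArE _ _ ih ih₁ =>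
    exact .exArE (ih hΓ) (ih₁ (Set.insert_subset_insert (Set.image_mono hΓ)))
  | eqRefl f => exact .eqRefl f
  | eqSymm _ ih => exact .eqSymm (ih hΓ)
  | eqTrans _ _ ih₁ ih₂ => exact .eqTrans (ih₁ hΓ) (ih₂ hΓ)
  | eqComp _ _ ih₁ ih₂ => exact .eqComp (ih₁ hΓ) (ih₂ hΓ)
  | assoc f g h => exact .assoc f g h
  | idComp f => exact .idComp f
  | compId f => exact .compId f

theorem image_subst_wkOb {Δ : Tel V n} {Δ' : Tel W m} (Γ : Set (Fml V Δ)) (σ : CtxAsg Δ Δ') :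
    (fun φ => Fml.subst φ (CtxAsg.liftOb σ)) '' (Fml.wkOb '' Γ)
      = Fml.wkOb '' ((fun φ => Fml.subst φ σ) '' Γ) := by
  rw [Set.image_image, Set.image_image]
  refine Set.image_congr fun φ _ => ?_
  rw [Fml.wkOb_subst, Fml.subst_wkOb, CtxAsg.wkOb_liftOb]

theorem image_subst_wkAr {Δ : Tel V n} {Δ' : Tel W m} (Γ : Set (Fml V Δ)) (σ : CtxAsg Δ Δ')
    (a b : ObX V n) :
    (fun φ => Fml.subst φ (CtxAsg.liftAr σ a b)) '' (Fml.wkAr a b '' Γ)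
      = Fml.wkAr (σ.ob a) (σ.ob b) '' ((fun φ => Fml.subst φ σ) '' Γ) := by
  rw [Set.image_image, Set.image_image]
  refine Set.image_congr fun φ _ => ?_
  rw [Fml.wkAr_subst, Fml.subst_wkAr, CtxAsg.wkAr_liftAr]

/-- Deductions are stable under every assignment, including those that replace constants and
change the vocabulary. -/
theorem Deriv.subst_image {Δ : Tel V n} {Γ : Set (Fml V Δ)} {φ : Fml V Δ} (h : Deriv Δ Γ φ) :
    ∀ {m : ℕ} {Δ' : Tel W m} (σ : CtxAsg Δ Δ'),
      Deriv Δ' ((fun ψ => Fml.subst ψ σ) '' Γ) (φ.subst σ) := by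
  induction h with
  | hyp h => intro m Δ' σ; exact .hyp (Set.mem_image_of_mem _ h)
  | topI => intro m Δ' σ; exact .topI
  | botE _ ih => intro m Δ' σ; exact .botE (ih σ)
  | andI _ _ ih₁ ih₂ => intro m Δ' σ; exact .andI (ih₁ σ) (ih₂ σ)
  | andE₁ _ ih => intro m Δ' σ; exact .andE₁ (ih σ)
  | andE₂ _ ih => intro m Δ' σ; exact .andE₂ (ih σ)
  | orI₁ _ ih => intro m Δ' σ; exact .orI₁ (ih σ)
  | orI₂ _ ih => intro m Δ' σ; exact .orI₂ (ih σ)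
  | orE _ _ _ ih ih₁ ih₂ =>
    intro m Δ' σ
    refine .orE (ih σ) ?_ ?_
    · have := ih₁ σ; rwa [Set.image_insert_eq] at this
    · have := ih₂ σ; rwa [Set.image_insert_eq] at this
  | impI _ ih =>
    intro m Δ' σ
    refine .impI ?_
    have := ih σ; rwa [Set.image_insert_eq] at this
  | impE _ _ ih ih₁ => intro m Δ' σ; exact .impE (ih σ) (ih₁ σ)
  | allObI _ ih =>
    intro m Δ' σ
    refine .allObI ?_
    rw [← image_subst_wkOb]; exact ih _
  | @allObE _ _ _ φ _ c ih =>
    intro m Δ' σ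
    have := Deriv.allObE (ih σ) (σ.ob c)
    rwa [Fml.liftOb_instOb, ← Fml.instOb_subst] at this
  | @exObI _ _ _ φ c _ ih =>
    intro m Δ' σ
    refine Deriv.exObI (σ.ob c) ?_
    rw [Fml.liftOb_instOb, ← Fml.instOb_subst]; exact ih σ
  | exObE _ _ ih ih₁ =>
    intro m Δ' σ
    refine Deriv.exObE (ih σ) ?_
    have := ih₁ (CtxAsg.liftOb σ)
    rwa [Set.image_insert_eq, image_subst_wkOb, Fml.wkOb_subst, CtxAsg.wkOb_liftOb,
      ← Fml.subst_wkOb] at this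
  | allArI _ ih =>
    intro m Δ' σ
    refine .allArI ?_
    rw [← image_subst_wkAr]; exact ih _
  | @allArE _ _ _ _ _ φ _ c ih =>
    intro m Δ' σ
    have := Deriv.allArE (ih σ) (c.subst σ)
    rwa [Fml.liftAr_instAr, ← Fml.instAr_subst] at this
  | @exArI _ _ _ _ _ φ c _ ih =>
    intro m Δ' σ
    refine Deriv.exArI (c.subst σ) ?_
    rw [Fml.liftAr_instAr, ← Fml.instAr_subst]; exact ih σ
  | exArE _ _ ih ih₁ =>
    intro m Δ' σ
    refine Deriv.exArE (ih σ) ?_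
    have := ih₁ (CtxAsg.liftAr σ _ _)
    rwa [Set.image_insert_eq, image_subst_wkAr, Fml.wkAr_subst, CtxAsg.wkAr_liftAr,
      ← Fml.subst_wkAr] at this
  | eqRefl f => intro m Δ' σ; exact .eqRefl _
  | eqSymm _ ih => intro m Δ' σ; exact .eqSymm (ih σ)
  | eqTrans _ _ ih₁ ih₂ => intro m Δ' σ; exact .eqTrans (ih₁ σ) (ih₂ σ)
  | eqComp _ _ ih₁ ih₂ => intro m Δ' σ; exact .eqComp (ih₁ σ) (ih₂ σ)
  | assoc f g h => intro m Δ' σ; exact .assoc _ _ _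
  | idComp f => intro m Δ' σ; exact .idComp _
  | compId f => intro m Δ' σ; exact .compId _

theorem Deriv.insert_cut {Δ : Tel V n} {Γ Γ' : Set (Fml V Δ)} (h : ∀ γ ∈ Γ, Deriv Δ Γ' γ)
    (ψ : Fml V Δ) : ∀ γ ∈ insert ψ Γ, Deriv Δ (insert ψ Γ') γ := by
  rintro γ (rfl | hγ)
  · exact .hyp (Set.mem_insert _ _)
  · exact (h γ hγ).mono (Set.subset_insert _ _)

theorem Deriv.wkOb_image {Δ : Tel V n} {Γ : Set (Fml V Δ)} {φ : Fml V Δ} (h : Deriv Δ Γ φ) :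
    Deriv Δ.ob (Fml.wkOb '' Γ) φ.wkOb := h.subst_image (CtxAsg.wkOb Δ)

theorem Deriv.wkAr_image {Δ : Tel V n} {Γ : Set (Fml V Δ)} {φ : Fml V Δ} (h : Deriv Δ Γ φ)
    (a b : ObX V n) :
    Deriv (Δ.ar a b) (Fml.wkAr a b '' Γ) (φ.wkAr a b) := h.subst_image (CtxAsg.wkAr Δ a b)

theorem Deriv.cut {Δ : Tel V n} {Γ : Set (Fml V Δ)} {φ : Fml V Δ} (h : Deriv Δ Γ φ) :
    ∀ {Γ' : Set (Fml V Δ)}, (∀ γ ∈ Γ, Deriv Δ Γ' γ) → Deriv Δ Γ' φ := by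
  have wO : ∀ {n : ℕ} {Δ : Tel V n} {Γ Γ' : Set (Fml V Δ)}, (∀ γ ∈ Γ, Deriv Δ Γ' γ) →
      ∀ γ ∈ Fml.wkOb '' Γ, Deriv Δ.ob (Fml.wkOb '' Γ') γ := by
    rintro n Δ Γ Γ' h _ ⟨γ, hγ, rfl⟩
    exact (h γ hγ).wkOb_image
  have wA : ∀ {n : ℕ} {Δ : Tel V n} {Γ Γ' : Set (Fml V Δ)} (a b : ObX V n),
      (∀ γ ∈ Γ, Deriv Δ Γ' γ) →
      ∀ γ ∈ Fml.wkAr a b '' Γ, Deriv (Δ.ar a b) (Fml.wkAr a b '' Γ') γ := by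
    rintro n Δ Γ Γ' a b h _ ⟨γ, hγ, rfl⟩
    exact (h γ hγ).wkAr_image a b
  induction h with
  | hyp h => intro Γ' H; exact H _ h
  | topI => intro Γ' H; exact .topI
  | botE _ ih => intro Γ' H; exact .botE (ih H)
  | andI _ _ ih₁ ih₂ => intro Γ' H; exact .andI (ih₁ H) (ih₂ H)
  | andE₁ _ ih => intro Γ' H; exact .andE₁ (ih H)
  | andE₂ _ ih => intro Γ' H; exact .andE₂ (ih H)
  | orI₁ _ ih => intro Γ' H; exact .orI₁ (ih H)
  | orI₂ _ ih => intro Γ' H; exact .orI₂ (ih H)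
  | orE _ _ _ ih ih₁ ih₂ =>
    intro Γ' H
    exact .orE (ih H) (ih₁ (Deriv.insert_cut H _)) (ih₂ (Deriv.insert_cut H _))
  | impI _ ih => intro Γ' H; exact .impI (ih (Deriv.insert_cut H _))
  | impE _ _ ih ih₁ => intro Γ' H; exact .impE (ih H) (ih₁ H)
  | allObI _ ih => intro Γ' H; exact .allObI (ih (wO H))
  | allObE _ c ih => intro Γ' H; exact .allObE (ih H) c
  | exObI c _ ih => intro Γ' H; exact .exObI c (ih H)
  | exObE _ _ ih ih₁ =>
    intro Γ' H
    exact .exObE (ih H) (ih₁ (Deriv.insert_cut (wO H) _))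
  | allArI _ ih => intro Γ' H; exact .allArI (ih (wA _ _ H))
  | allArE _ c ih => intro Γ' H; exact .allArE (ih H) c
  | exArI c _ ih => intro Γ' H; exact .exArI c (ih H)
  | exArE _ _ ih ih₁ =>
    intro Γ' H
    exact .exArE (ih H) (ih₁ (Deriv.insert_cut (wA _ _ H) _))
  | eqRefl f => intro Γ' H; exact .eqRefl f
  | eqSymm _ ih => intro Γ' H; exact .eqSymm (ih H)
  | eqTrans _ _ ih₁ ih₂ => intro Γ' H; exact .eqTrans (ih₁ H) (ih₂ H)
  | eqComp _ _ ih₁ ih₂ => intro Γ' H; exact .eqComp (ih₁ H) (ih₂ H)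
  | assoc f g h => intro Γ' H; exact .assoc f g h
  | idComp f => intro Γ' H; exact .idComp f
  | compId f => intro Γ' H; exact .compId f

/-- `w : Γ ⟶ Γ'` extends hypotheses: the hypotheses `Γ` hold, along the assignment `w`, under the
hypotheses `Γ'`. -/
def Ext {Δ : Tel V n} {Δ' : Tel W m} (Γ : Set (Fml V Δ)) (Γ' : Set (Fml W Δ'))
    (w : CtxAsg Δ Δ') : Prop :=
  ∀ γ ∈ Γ, Deriv Δ' Γ' (γ.subst w)

/-- Stability under substitution and cut, in one step. -/
theorem Deriv.subst {Δ : Tel V n} {Δ' : Tel W m} {Γ : Set (Fml V Δ)} {Γ' : Set (Fml W Δ')}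
    {φ : Fml V Δ} (h : Deriv Δ Γ φ) {w : CtxAsg Δ Δ'} (hw : Ext Γ Γ' w) :
    Deriv Δ' Γ' (φ.subst w) := by
  refine (h.subst_image w).cut ?_
  rintro _ ⟨γ, hγ, rfl⟩
  exact hw γ hγ

section Extension

variable {Δ : Tel V n} {Γ : Set (Fml V Δ)}

theorem Ext.refl : Ext Γ Γ (CtxAsg.id Δ) := fun γ hγ => by
  rw [Fml.subst_id]; exact .hyp hγ

theorem Ext.image {Δ' : Tel W m} (w : CtxAsg Δ Δ') :
    Ext Γ ((fun ψ => Fml.subst ψ w) '' Γ) w := fun _ hγ => .hyp (Set.mem_image_of_mem _ hγ)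

theorem Ext.mono {Δ' : Tel W m} {Γ' Γ'' : Set (Fml W Δ')} {w : CtxAsg Δ Δ'} (h : Ext Γ Γ' w)
    (h' : Γ' ⊆ Γ'') : Ext Γ Γ'' w := fun γ hγ => (h γ hγ).mono h'

theorem Ext.trans {U : Voc.{x}} {k : ℕ} {Δ' : Tel W m} {Δ'' : Tel U k} {Γ' : Set (Fml W Δ')}
    {Γ'' : Set (Fml U Δ'')} {w : CtxAsg Δ Δ'} {w' : CtxAsg Δ' Δ''} (h : Ext Γ Γ' w)
    (h' : Ext Γ' Γ'' w') : Ext Γ Γ'' (Asg.comp w w') := fun γ hγ =>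
  ((h γ hγ).subst h').of_eq (Fml.subst_subst _ _ _)

theorem Ext.wkOb : Ext Γ (Fml.wkOb '' Γ) (CtxAsg.wkOb Δ) := Ext.image _

theorem Ext.wkAr (a b : ObX V n) : Ext Γ (Fml.wkAr a b '' Γ) (CtxAsg.wkAr Δ a b) := Ext.image _

end Extension

/-! ### Rules for substituted propositions -/

/-! The rules below are stated for `φ.subst σ` rather than for `φ`, and the rules with side
conditions on variables quantify over all extensions of the hypotheses. An argument by such rules
reads like one about elements at later stages, and never manipulates weakenings. -/

section Rules

variable {Δ : Tel V n} {E : Tel W m} {Γ : Set (Fml W E)} {σ : CtxAsg Δ E}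

theorem Deriv.allOb_elim {φ : Fml V Δ.ob} (h : Deriv E Γ ((Fml.allOb φ).subst σ)) (c : ObX W m) :
    Deriv E Γ (φ.subst (CtxAsg.consOb σ c)) :=
  (Deriv.allObE h c).of_eq (Fml.liftOb_instOb _ _ _)

theorem Deriv.allAr_elim {a b : ObX V n} {φ : Fml V (Δ.ar a b)}
    (h : Deriv E Γ ((Fml.allAr a b φ).subst σ)) (t : Tm (HomX E) (σ.ob a) (σ.ob b)) :
    Deriv E Γ (φ.subst (CtxAsg.consAr σ t)) :=
  (Deriv.allArE h t).of_eq (Fml.liftAr_instAr _ _ _)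

theorem Deriv.exOb_intro {φ : Fml V Δ.ob} (c : ObX W m)
    (h : Deriv E Γ (φ.subst (CtxAsg.consOb σ c))) : Deriv E Γ ((Fml.exOb φ).subst σ) :=
  Deriv.exObI c (h.of_eq (Fml.liftOb_instOb _ _ _).symm)

theorem Deriv.exAr_intro {a b : ObX V n} {φ : Fml V (Δ.ar a b)}
    (t : Tm (HomX E) (σ.ob a) (σ.ob b)) (h : Deriv E Γ (φ.subst (CtxAsg.consAr σ t))) :
    Deriv E Γ ((Fml.exAr a b φ).subst σ) :=
  Deriv.exArI t (h.of_eq (Fml.liftAr_instAr _ _ _).symm)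

/-- To prove a universal statement, prove its instances at all extensions. -/
theorem Deriv.allOb_intro {φ : Fml V Δ.ob}
    (h : ∀ {k : ℕ} (E' : Tel W k) (Γ' : Set (Fml W E')) (w : CtxAsg E E'), Ext Γ Γ' w →
      ∀ c : ObX W k, Deriv E' Γ' (φ.subst (CtxAsg.consOb (Asg.comp σ w) c))) :
    Deriv E Γ ((Fml.allOb φ).subst σ) :=
  Deriv.allObI (h E.ob _ (CtxAsg.wkOb E) Ext.wkOb none)

theorem Deriv.allAr_intro {a b : ObX V n} {φ : Fml V (Δ.ar a b)}
    (h : ∀ {k : ℕ} (E' : Tel W k) (Γ' : Set (Fml W E')) (w : CtxAsg E E'), Ext Γ Γ' w →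
      ∀ t : Tm (HomX E') (w.ob (σ.ob a)) (w.ob (σ.ob b)),
        Deriv E' Γ' (φ.subst (CtxAsg.consAr (Asg.comp σ w) (a := a) (b := b) t))) :
    Deriv E Γ ((Fml.allAr a b φ).subst σ) :=
  Deriv.allArI (h (E.ar _ _) _ (CtxAsg.wkAr E (σ.ob a) (σ.ob b)) (Ext.wkAr _ _) (.sym AddAr.new))

theorem Deriv.imp_intro {φ ψ : Fml V Δ}
    (h : ∀ Γ' : Set (Fml W E), Γ ⊆ Γ' → Deriv E Γ' (φ.subst σ) → Deriv E Γ' (ψ.subst σ)) :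
    Deriv E Γ ((Fml.imp φ ψ).subst σ) :=
  Deriv.impI (h _ (Set.subset_insert _ _) (.hyp (Set.mem_insert _ _)))

/-- To use an existential statement, use a witness at an extension. -/
theorem Deriv.exOb_elim {φ : Fml V Δ.ob} {χ : Fml W E} (h : Deriv E Γ ((Fml.exOb φ).subst σ))
    (H : ∀ {k : ℕ} (E' : Tel W k) (Γ' : Set (Fml W E')) (w : CtxAsg E E'), Ext Γ Γ' w →
      ∀ c : ObX W k, Deriv E' Γ' (φ.subst (CtxAsg.consOb (Asg.comp σ w) c)) →
        Deriv E' Γ' (χ.subst w)) :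
    Deriv E Γ χ :=
  Deriv.exObE h (H E.ob _ (CtxAsg.wkOb E) (Ext.wkOb.mono (Set.subset_insert _ _)) none
    (.hyp (Set.mem_insert _ _)))

theorem Deriv.exAr_elim {a b : ObX V n} {φ : Fml V (Δ.ar a b)} {χ : Fml W E}
    (h : Deriv E Γ ((Fml.exAr a b φ).subst σ))
    (H : ∀ {k : ℕ} (E' : Tel W k) (Γ' : Set (Fml W E')) (w : CtxAsg E E'), Ext Γ Γ' w →
      ∀ t : Tm (HomX E') (w.ob (σ.ob a)) (w.ob (σ.ob b)),
        Deriv E' Γ' (φ.subst (CtxAsg.consAr (Asg.comp σ w) (a := a) (b := b) t)) →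
        Deriv E' Γ' (χ.subst w)) :
    Deriv E Γ χ :=
  Deriv.exArE h (H (E.ar _ _) _ (CtxAsg.wkAr E (σ.ob a) (σ.ob b))
    ((Ext.wkAr _ _).mono (Set.subset_insert _ _)) (.sym AddAr.new) (.hyp (Set.mem_insert _ _)))

end Rules

end Deduction

/-! ### Soundness of the Friedman slash -/

section Slash

variable {V : Voc.{u}} {T : Theory V} {M : Model T}

/-- Slashed propositions are provable: provability is built into the clauses for `→` and `∀`,
and is inherited in the other clauses. -/
theorem FPat.proves {n : ℕ} {Δ : Tel V n} (φ : Fml V Δ) (ρ : CtxAsg Δ (Tel.nil : Tel V 0))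
    (h : FPat T M φ ρ) : T.Proves (φ.subst ρ) := by
  induction φ with
  | eq f g => exact M.proves h
  | top => exact .topI
  | bot => exact h.elim
  | and φ ψ h₁ h₂ => exact .andI (h₁ ρ h.1) (h₂ ρ h.2)
  | or φ ψ h₁ h₂ =>
    rcases h with h | h
    · exact .orI₁ (h₁ ρ h)
    · exact .orI₂ (h₂ ρ h)
  | imp φ ψ h₁ h₂ => exact h.2
  | allOb φ ih => exact h.2
  | exOb φ ih =>
    obtain ⟨c, hc⟩ := h
    exact Deriv.exObI c ((ih _ hc).of_eq (Fml.liftOb_instOb (Δ' := Tel.nil) φ ρ c).symm)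
  | allAr a b φ ih => exact h.2
  | exAr a b φ ih =>
    obtain ⟨t, ht⟩ := h
    exact Deriv.exArI t ((ih _ ht).of_eq (Fml.liftAr_instAr (Δ' := Tel.nil) φ ρ t).symm)

/-- The slash of a substituted proposition is the slash at the composite assignment. -/
theorem FPat_subst {n : ℕ} {Δ : Tel V n} (φ : Fml V Δ) :
    ∀ {m : ℕ} {Δ' : Tel V m} (σ : CtxAsg Δ Δ') (ρ : CtxAsg Δ' (Tel.nil : Tel V 0)),
      FPat T M (φ.subst σ) ρ ↔ FPat T M φ (Asg.comp σ ρ) := by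
  induction φ with
  | eq f g =>
    intro m Δ' σ ρ
    change M.rel ((f.subst σ).subst ρ) ((g.subst σ).subst ρ)
      ↔ M.rel (f.subst (Asg.comp σ ρ)) (g.subst (Asg.comp σ ρ))
    rw [Tm.subst_subst, Tm.subst_subst]
    exact Iff.rfl
  | top => exact fun _ _ => Iff.rfl
  | bot => exact fun _ _ => Iff.rfl
  | and φ ψ h₁ h₂ => exact fun σ ρ => and_congr (h₁ σ ρ) (h₂ σ ρ)
  | or φ ψ h₁ h₂ => exact fun σ ρ => or_congr (h₁ σ ρ) (h₂ σ ρ)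
  | imp φ ψ h₁ h₂ =>
    exact fun σ ρ => and_congr (imp_congr (h₁ σ ρ) (h₂ σ ρ))
      (iff_of_eq (congrArg T.Proves (Fml.subst_subst (Fml.imp φ ψ) σ ρ)))
  | allOb φ ih =>
    exact fun σ ρ => and_congr (forall_congr' fun c => (ih _ _).trans
      (iff_of_eq (congrArg (FPat T M φ) (CtxAsg.liftOb_consOb σ ρ c))))
      (iff_of_eq (congrArg T.Proves (Fml.subst_subst (Fml.allOb φ) σ ρ)))
  | exOb φ ih =>
    exact fun σ ρ => exists_congr fun c => (ih _ _).trans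
      (iff_of_eq (congrArg (FPat T M φ) (CtxAsg.liftOb_consOb σ ρ c)))
  | allAr a b φ ih =>
    exact fun σ ρ => and_congr (forall_congr' fun t => (ih _ _).trans
      (iff_of_eq (congrArg (FPat T M φ) (CtxAsg.liftAr_consAr σ ρ a b t))))
      (iff_of_eq (congrArg T.Proves (Fml.subst_subst (Fml.allAr a b φ) σ ρ)))
  | exAr a b φ ih =>
    exact fun σ ρ => exists_congr fun t => (ih _ _).trans
      (iff_of_eq (congrArg (FPat T M φ) (CtxAsg.liftAr_consAr σ ρ a b t)))

/-- Soundness of the Friedman slash for deductions in context: the propositions that are slashed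
and provable are closed under the rules, as soon as the model satisfies the category axioms. -/
theorem Deriv.FPat (hassoc : ∀ {a b c d : V.O} (f : Tm (HomX (Tel.nil : Tel V 0)) a b)
      (g : Tm (HomX (Tel.nil : Tel V 0)) b c) (h : Tm (HomX (Tel.nil : Tel V 0)) c d),
      M.rel (.comp h (.comp g f)) (.comp (.comp h g) f))
    (hidComp : ∀ {a b : V.O} (f : Tm (HomX (Tel.nil : Tel V 0)) a b), M.rel f (.comp (.id b) f))
    (hcompId : ∀ {a b : V.O} (f : Tm (HomX (Tel.nil : Tel V 0)) a b), M.rel f (.comp f (.id a)))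
    {n : ℕ} {Δ : Tel V n} {Γ : Set (Fml V Δ)} {φ : Fml V Δ} (h : Deriv Δ Γ φ) :
    ∀ ρ : CtxAsg Δ (Tel.nil : Tel V 0), (∀ γ ∈ Γ, CatTheory.FPat T M γ ρ) →
      CatTheory.FPat T M φ ρ := by
  -- The provability halves of the clauses for `→` and `∀`.
  have pr : ∀ {n : ℕ} {Δ : Tel V n} {Γ : Set (Fml V Δ)} {φ : Fml V Δ}, Deriv Δ Γ φ →
      ∀ ρ : CtxAsg Δ (Tel.nil : Tel V 0), (∀ γ ∈ Γ, CatTheory.FPat T M γ ρ) →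
      T.Proves (φ.subst ρ) := fun h ρ H => h.subst fun γ hγ => FPat.proves γ ρ (H γ hγ)
  have ins : ∀ {n : ℕ} {Δ : Tel V n} {Γ : Set (Fml V Δ)} {φ : Fml V Δ}
      {ρ : CtxAsg Δ (Tel.nil : Tel V 0)}, (∀ γ ∈ Γ, CatTheory.FPat T M γ ρ) →
      CatTheory.FPat T M φ ρ → ∀ γ ∈ insert φ Γ, CatTheory.FPat T M γ ρ := by
    rintro n Δ Γ φ ρ H H' γ (rfl | hγ)
    · exact H'
    · exact H γ hγ
  have wO : ∀ {n : ℕ} {Δ : Tel V n} {Γ : Set (Fml V Δ)} {ρ : CtxAsg Δ (Tel.nil : Tel V 0)},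
      (∀ γ ∈ Γ, CatTheory.FPat T M γ ρ) → ∀ c,
      ∀ γ ∈ Fml.wkOb '' Γ, CatTheory.FPat T M γ (CtxAsg.consOb ρ c) := by
    rintro n Δ Γ ρ H c _ ⟨γ, hγ, rfl⟩
    exact (FPat_subst _ _ _).2 (H γ hγ)
  have wA : ∀ {n : ℕ} {Δ : Tel V n} {Γ : Set (Fml V Δ)} {ρ : CtxAsg Δ (Tel.nil : Tel V 0)}
      {a b : ObX V n}, (∀ γ ∈ Γ, CatTheory.FPat T M γ ρ) →
      ∀ t : Tm (HomX (Tel.nil : Tel V 0)) (ρ.ob a) (ρ.ob b),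
      ∀ γ ∈ Fml.wkAr a b '' Γ, CatTheory.FPat T M γ (CtxAsg.consAr ρ t) := by
    rintro n Δ Γ ρ a b H c _ ⟨γ, hγ, rfl⟩
    exact (FPat_subst _ _ _).2 (H γ hγ)
  induction h with
  | hyp h => exact fun ρ H => H _ h
  | topI => exact fun ρ H => trivial
  | botE _ ih => exact fun ρ H => (ih ρ H).elim
  | andI _ _ ih₁ ih₂ => exact fun ρ H => ⟨ih₁ ρ H, ih₂ ρ H⟩
  | andE₁ _ ih => exact fun ρ H => (ih ρ H).1
  | andE₂ _ ih => exact fun ρ H => (ih ρ H).2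
  | orI₁ _ ih => exact fun ρ H => Or.inl (ih ρ H)
  | orI₂ _ ih => exact fun ρ H => Or.inr (ih ρ H)
  | orE _ _ _ ih ih₁ ih₂ =>
    exact fun ρ H => (ih ρ H).elim (fun h => ih₁ ρ (ins H h)) (fun h => ih₂ ρ (ins H h))
  | impI h ih => exact fun ρ H => ⟨fun h' => ih ρ (ins H h'), pr (.impI h) ρ H⟩
  | impE _ _ ih ih₁ => exact fun ρ H => (ih ρ H).1 (ih₁ ρ H)
  | allObI h ih => exact fun ρ H => ⟨fun c => ih _ (wO H c), pr (.allObI h) ρ H⟩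
  | allObE _ c ih =>
    intro ρ H
    refine (FPat_subst _ _ _).2 ?_
    rw [CtxAsg.consOb_comp]
    exact (ih ρ H).1 _
  | exObI c _ ih =>
    intro ρ H
    have := (FPat_subst _ _ _).1 (ih ρ H)
    rw [CtxAsg.consOb_comp] at this
    exact ⟨_, this⟩
  | exObE _ _ ih ih₁ =>
    intro ρ H
    obtain ⟨c, hc⟩ := ih ρ H
    exact (FPat_subst _ _ _).1 (ih₁ _ (ins (wO H c) hc))
  | allArI h ih => exact fun ρ H => ⟨fun c => ih _ (wA H c), pr (.allArI h) ρ H⟩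
  | @allArE _ Δ _ _ _ φ _ t ih =>
    intro ρ H
    exact (FPat_subst _ _ _).2 ((congrArg (CatTheory.FPat T M φ)
      (CtxAsg.consAr_comp (CtxAsg.id Δ) t ρ)).mpr ((ih ρ H).1 _))
  | @exArI _ Δ _ _ _ φ t _ ih =>
    intro ρ H
    exact ⟨_, (congrArg (CatTheory.FPat T M φ)
      (CtxAsg.consAr_comp (CtxAsg.id Δ) t ρ)).mp ((FPat_subst _ _ _).1 (ih ρ H))⟩
  | exArE _ _ ih ih₁ =>
    intro ρ H
    obtain ⟨c, hc⟩ := ih ρ H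
    exact (FPat_subst _ _ _).1 (ih₁ _ (ins (wA H c) hc))
  | eqRefl f => exact fun ρ H => (M.equivalence _ _).refl _
  | eqSymm _ ih => exact fun ρ H => (M.equivalence _ _).symm (ih ρ H)
  | eqTrans _ _ ih₁ ih₂ => exact fun ρ H => (M.equivalence _ _).trans (ih₁ ρ H) (ih₂ ρ H)
  | eqComp _ _ ih₁ ih₂ => exact fun ρ H => M.comp (ih₁ ρ H) (ih₂ ρ H)
  | assoc f g h => exact fun ρ H => hassoc _ _ _
  | idComp f => exact fun ρ H => hidComp _
  | compId f => exact fun ρ H => hcompId _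

/-- A slashed existential statement over a context has closed witnesses for all its variables. -/
theorem FPat_exTel {n : ℕ} (Θ : Tel Pure.{v} n) (P : Fml Pure Θ)
    (h : FPat T M ((exTel Θ P).subst (ofPure V)) (CtxAsg.id Tel.nil)) :
    ∃ θ : CtxAsg Θ (Tel.nil : Tel V 0), FPat T M (P.subst θ) (CtxAsg.id Tel.nil) := by
  induction Θ with
  | nil => exact ⟨_, h⟩
  | ob Θ ih =>
    obtain ⟨θ, c, hc⟩ := ih _ h
    refine ⟨CtxAsg.consOb θ c, ?_⟩
    exact (congrArg (fun φ => FPat T M φ (CtxAsg.id Tel.nil)) (Fml.liftOb_instOb P θ c)).mp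
      ((FPat_subst _ _ _).2 ((congrArg (FPat T M _) (CtxAsg.comp_id _)).mpr hc))
  | ar Θ a b ih =>
    obtain ⟨θ, t, ht⟩ := ih _ h
    refine ⟨CtxAsg.consAr θ t, ?_⟩
    exact (congrArg (fun φ => FPat T M φ (CtxAsg.id Tel.nil)) (Fml.liftAr_instAr P θ t)).mp
      ((FPat_subst _ _ _).2 ((congrArg (FPat T M _) (CtxAsg.comp_id _)).mpr ht))

end Slash

/-! ### The slash over the Freyd cover -/

section FreydSlash

variable {T : Theory Pure.{0}} {Tiny : Type u} [SmallCategory Tiny] {Γ : TComp T ⥤ Tiny}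

/-- The theorems of `T` are slashed and provable when its axioms are. -/
theorem FP_of_proves
    (hFP : ∀ φ ∈ T, FP (TStar Γ) (freydModel Γ) (φ.subst (ofPure (catVoc (FreydCover Γ)))))
    {φ : Sentence Pure} (h : T.Proves φ) :
    FP (TStar Γ) (freydModel Γ) (φ.subst (ofPure (catVoc (FreydCover Γ)))) := by
  refine Deriv.FPat (M := freydModel Γ) (fun f g h => ?_) (fun f => ?_) (fun f => ?_)
    (Deriv.subst_image h (ofPure (catVoc (FreydCover Γ)))) (CtxAsg.id Tel.nil) ?_
  -- The equations of `M` are those that hold in the Freyd cover, which is a category.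
  · exact (Category.assoc f.value g.value h.value)
  · exact (Category.comp_id f.value).symm
  · exact (Category.id_comp f.value).symm
  · rintro _ ⟨γ, hγ, rfl⟩
    exact hFP γ hγ

/-- Provability in `TStar Γ` is by definition provability in the term-complete extension of the
projected proposition. -/
theorem TComp_proves_of_FP {φ : Sentence (catVoc (FreydCover Γ))}
    (h : FP (TStar Γ) (freydModel Γ) φ) : (TCompTheory T).Proves (φ.subst (minus Γ)) := by
  have h' : (TStar Γ).Proves φ := by
    have := FPat.proves _ _ h
    rwa [Fml.subst_id] at this
  exact Deriv.subst h' fun γ hγ => hγ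

end FreydSlash

/-! ### The category of terms under hypotheses -/

section TermCategory

variable {W : Voc.{u}} {m : ℕ} {E : Tel W m}

theorem Deriv.ext {V : Voc.{v}} {n k : ℕ} {Δ : Tel V n} {E' : Tel W k} {Γ : Set (Fml W E)}
    {Γ' : Set (Fml W E')} {φ : Fml V Δ} {σ : CtxAsg Δ E} (h : Deriv E Γ (φ.subst σ))
    {w : CtxAsg E E'} (hw : Ext Γ Γ' w) : Deriv E' Γ' (φ.subst (Asg.comp σ w)) :=
  (h.subst hw).of_eq (Fml.subst_subst _ _ _)

/-- Provable equality of arrow-terms under the hypotheses `Γ`. -/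
def termSetoid (Γ : Set (Fml W E)) (a b : ObX W m) : Setoid (Tm (HomX E) a b) where
  r f g := Deriv E Γ (.eq f g)
  iseqv := ⟨fun f => .eqRefl f, fun h => .eqSymm h, fun h k => .eqTrans h k⟩

/-- The objects of the category of terms under the hypotheses `Γ`: the object-terms. The arrows
are the arrow-terms up to provable equality. -/
structure TermCat (Γ : Set (Fml W E)) : Type u where
  ob : ObX W m

instance (Γ : Set (Fml W E)) : Category.{u} (TermCat Γ) where
  Hom a b := Quotient (termSetoid Γ a.ob b.ob)
  id a := Quotient.mk _ (Tm.id a.ob)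
  comp f g := Quotient.map₂ (fun f g => Tm.comp g f) (fun _ _ h _ _ k => Deriv.eqComp h k) f g
  id_comp f := Quotient.inductionOn f fun f => Quotient.sound (Deriv.eqSymm (.compId f))
  comp_id f := Quotient.inductionOn f fun f => Quotient.sound (Deriv.eqSymm (.idComp f))
  assoc f g h := Quotient.inductionOn₃ f g h fun f g h => Quotient.sound (Deriv.assoc f g h)

/-- The arrow denoted by an arrow-term. -/
def Tm.arrow (Γ : Set (Fml W E)) {a b : ObX W m} (t : Tm (HomX E) a b) :
    (⟨a⟩ : TermCat Γ) ⟶ ⟨b⟩ := Quotient.mk (termSetoid Γ a b) t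

variable {Γ : Set (Fml W E)} {a b c : ObX W m}

theorem arrow_eq_iff {f g : Tm (HomX E) a b} :
    f.arrow Γ = g.arrow Γ ↔ Deriv E Γ (.eq f g) :=
  ⟨fun h => Quotient.exact h, fun h => Quotient.sound h⟩

theorem arrow_comp (g : Tm (HomX E) b c) (f : Tm (HomX E) a b) :
    (Tm.comp g f).arrow Γ = f.arrow Γ ≫ g.arrow Γ := rfl

theorem arrow_eq_subst {k : ℕ} {E' : Tel W k} {Γ' : Set (Fml W E')} {f g : Tm (HomX E) a b}
    (h : f.arrow Γ = g.arrow Γ) {w : CtxAsg E E'} (hw : Ext Γ Γ' w) :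
    (f.subst w).arrow Γ' = (g.subst w).arrow Γ' :=
  arrow_eq_iff.2 ((arrow_eq_iff.1 h).subst hw)

theorem arrow_eq_mono {Γ' : Set (Fml W E)} {f g : Tm (HomX E) a b}
    (h : f.arrow Γ = g.arrow Γ) (hΓ : Γ ⊆ Γ') : f.arrow Γ' = g.arrow Γ' :=
  arrow_eq_iff.2 ((arrow_eq_iff.1 h).mono hΓ)

end TermCategory

/-! ### Invariance under isomorphism -/

section Invariance

variable {V : Voc.{u}} {W : Voc.{v}} {n m k : ℕ} {Δ : Tel V n} {E : Tel W m} {E' : Tel W k}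
  {Γ : Set (Fml W E)} {Γ' : Set (Fml W E')}

/-- An isomorphism, under the hypotheses `Γ`, between two interpretations of the context `Δ`: a
natural family of arrow-terms together with an inverse family. -/
structure CtxIso (Γ : Set (Fml W E)) (σ₁ σ₂ : CtxAsg Δ E) where
  hom : ∀ A, Tm (HomX E) (σ₁.ob A) (σ₂.ob A)
  inv : ∀ A, Tm (HomX E) (σ₂.ob A) (σ₁.ob A)
  hom_inv : ∀ A, (hom A).arrow Γ ≫ (inv A).arrow Γ = 𝟙 _
  inv_hom : ∀ A, (inv A).arrow Γ ≫ (hom A).arrow Γ = 𝟙 _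
  naturality : ∀ {a b : ObX V n} (h : HomX Δ a b),
    (hom a).arrow Γ ≫ (σ₂.ar h).arrow Γ = (σ₁.ar h).arrow Γ ≫ (hom b).arrow Γ

namespace CtxIso

variable {σ₁ σ₂ : CtxAsg Δ E}

/-- A square that commutes with an isomorphism commutes with its inverse. -/
theorem conj (I : CtxIso Γ σ₁ σ₂) {a b : ObX V n} {t₁ : Tm (HomX E) (σ₁.ob a) (σ₁.ob b)}
    {t₂ : Tm (HomX E) (σ₂.ob a) (σ₂.ob b)}
    (h : (I.hom a).arrow Γ ≫ t₂.arrow Γ = t₁.arrow Γ ≫ (I.hom b).arrow Γ) :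
    (I.inv a).arrow Γ ≫ t₁.arrow Γ = t₂.arrow Γ ≫ (I.inv b).arrow Γ := by
  have e : t₁.arrow Γ = (I.hom a).arrow Γ ≫ t₂.arrow Γ ≫ (I.inv b).arrow Γ := by
    rw [← Category.assoc, h, Category.assoc, I.hom_inv, Category.comp_id]
  rw [e, ← Category.assoc, I.inv_hom, Category.id_comp]

/-- The inverse isomorphism. -/
def symm (I : CtxIso Γ σ₁ σ₂) : CtxIso Γ σ₂ σ₁ where
  hom := I.inv
  inv := I.hom
  hom_inv := I.inv_hom
  inv_hom := I.hom_inv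
  naturality h := I.conj (I.naturality h)

/-- An isomorphism persists along extensions. -/
def ext (I : CtxIso Γ σ₁ σ₂) {w : CtxAsg E E'} (hw : Ext Γ Γ' w) :
    CtxIso Γ' (Asg.comp σ₁ w) (Asg.comp σ₂ w) where
  hom A := (I.hom A).subst w
  inv A := (I.inv A).subst w
  hom_inv A := arrow_eq_subst (f := Tm.comp (I.inv A) (I.hom A)) (g := Tm.id _) (I.hom_inv A) hw
  inv_hom A := arrow_eq_subst (f := Tm.comp (I.hom A) (I.inv A)) (g := Tm.id _) (I.inv_hom A) hw
  naturality {a b} h := arrow_eq_subst (f := Tm.comp (σ₂.ar h) (I.hom a))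
    (g := Tm.comp (I.hom b) (σ₁.ar h)) (I.naturality h) hw

/-- Extension by one object. -/
def consOb (I : CtxIso Γ σ₁ σ₂) (c : ObX W m) :
    CtxIso Γ (CtxAsg.consOb σ₁ c) (CtxAsg.consOb σ₂ c) where
  hom
    | none => Tm.id c
    | some A => I.hom A
  inv
    | none => Tm.id c
    | some A => I.inv A
  hom_inv
    | none => Category.id_comp _
    | some A => I.hom_inv A
  inv_hom
    | none => Category.id_comp _
    | some A => I.inv_hom A
  naturality
    | .old h => I.naturality h

/-- Extension by two corresponding arrows. -/
def consAr (I : CtxIso Γ σ₁ σ₂) {a b : ObX V n} {t₁ : Tm (HomX E) (σ₁.ob a) (σ₁.ob b)}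
    {t₂ : Tm (HomX E) (σ₂.ob a) (σ₂.ob b)}
    (ht : (I.hom a).arrow Γ ≫ t₂.arrow Γ = t₁.arrow Γ ≫ (I.hom b).arrow Γ) :
    CtxIso Γ (CtxAsg.consAr σ₁ t₁) (CtxAsg.consAr σ₂ t₂) where
  hom := I.hom
  inv := I.inv
  hom_inv := I.hom_inv
  inv_hom := I.inv_hom
  naturality
    | .old h => I.naturality h
    | .new => ht

/-- An isomorphism persists when hypotheses are added. -/
def mono (I : CtxIso Γ σ₁ σ₂) {Γ' : Set (Fml W E)} (hΓ : Γ ⊆ Γ') : CtxIso Γ' σ₁ σ₂ where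
  hom := I.hom
  inv := I.inv
  hom_inv A := arrow_eq_mono (f := Tm.comp (I.inv A) (I.hom A)) (g := Tm.id _) (I.hom_inv A) hΓ
  inv_hom A := arrow_eq_mono (f := Tm.comp (I.hom A) (I.inv A)) (g := Tm.id _) (I.inv_hom A) hΓ
  naturality {a b} h := arrow_eq_mono (f := Tm.comp (σ₂.ar h) (I.hom a))
    (g := Tm.comp (I.hom b) (σ₁.ar h)) (I.naturality h) hΓ

/-- Transport of an arrow along the isomorphism corresponds to it. -/
theorem hom_comp_conj (I : CtxIso Γ σ₁ σ₂) {a b : ObX V n}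
    (t : Tm (HomX E) (σ₁.ob a) (σ₁.ob b)) :
    (I.hom a).arrow Γ ≫ (Tm.comp (I.hom b) (.comp t (I.inv a))).arrow Γ
      = t.arrow Γ ≫ (I.hom b).arrow Γ := by
  rw [arrow_comp, arrow_comp, ← Category.assoc, ← Category.assoc, I.hom_inv, Category.id_comp]

theorem conj_comp_hom (I : CtxIso Γ σ₁ σ₂) {a b : ObX V n}
    (t : Tm (HomX E) (σ₂.ob a) (σ₂.ob b)) :
    (I.hom a).arrow Γ ≫ t.arrow Γ
      = (Tm.comp (I.inv b) (.comp t (I.hom a))).arrow Γ ≫ (I.hom b).arrow Γ := by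
  rw [arrow_comp, arrow_comp, Category.assoc, Category.assoc, I.inv_hom, Category.comp_id]

/-- Naturality extends from arrow symbols to arrow-terms. -/
theorem naturality_tm (I : CtxIso Γ σ₁ σ₂) {a b : ObX V n} (t : Tm (HomX Δ) a b) :
    (I.hom a).arrow Γ ≫ (t.subst σ₂).arrow Γ = (t.subst σ₁).arrow Γ ≫ (I.hom b).arrow Γ := by
  induction t with
  | sym h => exact I.naturality h
  | id a => exact (Category.comp_id _).trans (Category.id_comp _).symm
  | comp g f ihg ihf =>
    change _ ≫ (f.subst σ₂).arrow Γ ≫ (g.subst σ₂).arrow Γ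
      = ((f.subst σ₁).arrow Γ ≫ (g.subst σ₁).arrow Γ) ≫ _
    rw [← Category.assoc, ihf, Category.assoc, ihg, Category.assoc]

end CtxIso

/-- Propositions cannot distinguish isomorphic interpretations of their context, because equations
are only between arrow-terms of the same sort. An arrow quantified over on one side corresponds to
its conjugate on the other. -/
theorem CtxIso.transport (φ : Fml V Δ) :
    ∀ {m : ℕ} {E : Tel W m} {Γ : Set (Fml W E)} {σ₁ σ₂ : CtxAsg Δ E}, CtxIso Γ σ₁ σ₂ →
      Deriv E Γ (φ.subst σ₁) → Deriv E Γ (φ.subst σ₂) := by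
  induction φ with
  | eq f g =>
    intro m E Γ σ₁ σ₂ I h
    have h' := arrow_eq_iff.2 h
    refine arrow_eq_iff.1 ?_
    have cancel : ∀ {a b} (t : Tm (HomX E) (σ₂.ob a) b),
        t.arrow Γ = (I.inv a).arrow Γ ≫ (I.hom a).arrow Γ ≫ t.arrow Γ := fun t => by
      rw [← Category.assoc, I.inv_hom, Category.id_comp]
    rw [cancel (f.subst σ₂), cancel (g.subst σ₂), I.naturality_tm, I.naturality_tm, h']
  | top => exact fun _ h => h
  | bot => exact fun _ h => h
  | and φ ψ h₁ h₂ => exact fun I h => .andI (h₁ I (.andE₁ h)) (h₂ I (.andE₂ h))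
  | or φ ψ h₁ h₂ =>
    intro m E Γ σ₁ σ₂ I h
    exact .orE h
      (.orI₁ (h₁ (I.mono (Set.subset_insert _ _)) (.hyp (Set.mem_insert _ _))))
      (.orI₂ (h₂ (I.mono (Set.subset_insert _ _)) (.hyp (Set.mem_insert _ _))))
  | imp φ ψ h₁ h₂ =>
    exact fun I h => Deriv.imp_intro fun Γ' hΓ h' =>
      h₂ (I.mono hΓ) (.impE (h.mono hΓ) (h₁ (I.mono hΓ).symm h'))
  | allOb φ ih =>
    exact fun I h => Deriv.allOb_intro fun E' Γ' w hw c =>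
      ih ((I.ext hw).consOb c) ((h.ext hw).allOb_elim c)
  | exOb φ ih =>
    exact fun I h => Deriv.exOb_elim h fun E' Γ' w hw c hc =>
      (Deriv.exOb_intro c (ih ((I.ext hw).consOb c) hc)).of_eq (Fml.subst_subst _ _ _).symm
  | allAr a b φ ih =>
    intro m E Γ σ₁ σ₂ I h
    refine Deriv.allAr_intro fun E' Γ' w hw t => ?_
    exact ih ((I.ext hw).consAr ((I.ext hw).conj_comp_hom t)) ((h.ext hw).allAr_elim
      (.comp ((I.ext hw).inv b) (.comp t ((I.ext hw).hom a))))
  | exAr a b φ ih =>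
    intro m E Γ σ₁ σ₂ I h
    refine Deriv.exAr_elim h fun E' Γ' w hw t ht => ?_
    exact (Deriv.exAr_intro (.comp ((I.ext hw).hom b) (.comp t ((I.ext hw).inv a)))
      (ih ((I.ext hw).consAr ((I.ext hw).hom_comp_conj t)) ht)).of_eq
      (Fml.subst_subst _ _ _).symm

end Invariance

section ProvEq

variable {V : Voc.{u}} {W : Voc.{v}} {n m : ℕ} {Δ : Tel V n} {E : Tel W m} {Γ : Set (Fml W E)}

/-- Two interpretations that agree on objects, and on arrow symbols up to provable equality, are
isomorphic. -/
def CtxIso.ofProvEq (o : ObX V n → ObX W m)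
    (r₁ r₂ : ∀ {a b : ObX V n}, HomX Δ a b → Tm (HomX E) (o a) (o b))
    (h : ∀ {a b : ObX V n} (h : HomX Δ a b), Deriv E Γ (.eq (r₁ h) (r₂ h))) :
    CtxIso (Δ := Δ) Γ ⟨o, r₁⟩ ⟨o, r₂⟩ where
  hom A := Tm.id (o A)
  inv A := Tm.id (o A)
  hom_inv _ := Category.id_comp _
  inv_hom _ := Category.id_comp _
  naturality g := (Category.id_comp _).trans
    ((arrow_eq_iff.2 (h g)).symm.trans (Category.comp_id _).symm)

end ProvEq

/-! ### Representatives of classes of closed terms -/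

section Representatives

variable {T : Theory Pure.{0}}

/-- The choice of a closed arrow-term of the second extension for each arrow-constant of the
term-complete extension. -/
noncomputable def rep (T : Theory Pure.{0}) :
    CtxAsg (Tel.nil : Tel (catVoc (TComp T)) 0) (Tel.nil : Tel (Voc2 T) 0) where
  ob a := a
  ar {a b} q := Quotient.out (s := provEq T a b) q

/-- Replacing each closed term by the representative of its class changes it only up to provable
equality. -/
noncomputable def repIso (T : Theory Pure.{0}) :
    CtxIso (Theory2 T) (CtxAsg.id _) (Asg.comp (quot23 T) (rep T)) :=
  CtxIso.ofProvEq (V := Voc2 T) (n := 0) (Δ := Tel.nil) (fun a => a) (fun h => .sym h)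
    (fun {a b} h => Quotient.out (s := provEq T a b) (Tm2.cls (.sym h)))
    (fun {a b} h => Setoid.symm' (provEq T a b)
      (Quotient.mk_out (s := provEq T a b) (Tm.sym h : Tm2 T a b)))

/-- The axioms of the term-complete extension hold of the representatives. For the axioms of the
second extension, the constants have been replaced by provably equal terms; the other axioms
identify each class with a term that lies in it. -/
theorem ext_rep : Ext (TCompTheory T) (Theory2 T) (rep T) := by
  rintro _ (⟨ψ, hψ, rfl⟩ | ⟨a, b, f, rfl⟩)
  · rw [Fml.subst_subst]
    refine CtxIso.transport ψ (repIso T) ?_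
    rw [Fml.subst_id]
    exact .hyp hψ
  · have h₁ : Deriv Tel.nil (Theory2 T)
        (.eq (Quotient.out (s := provEq T a b) (Tm2.cls f)) f) :=
      Quotient.mk_out (s := provEq T a b) f
    have h₂ := (repIso T).naturality_tm f
    refine Deriv.eqTrans h₁ ?_
    have h₃ : Deriv Tel.nil (Theory2 T)
        (.eq f (f.subst (Asg.comp (quot23 T) (rep T)))) := by
      refine arrow_eq_iff.1 ?_
      have := (Category.id_comp _).symm.trans (h₂.trans (Category.comp_id _))
      refine (Eq.trans ?_ this.symm)
      exact congrArg (Tm.arrow (Theory2 T)) (Tm.subst_id f).symm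
    exact h₃.of_eq (congrArg (Fml.eq f) (Tm.subst_subst f (quot23 T) (rep T)).symm)

end Representatives

/-! ### Graphs of arrow-terms -/

section Star

variable {V : Voc.{u}} {W : Voc.{v}} {U : Voc.{w}} {n m k : ℕ}

theorem Tm.wkAr_subst_liftAr {E : Tel W m} {E' : Tel U k} {a b c d : ObX W m}
    (t : Tm (HomX E) c d) (θ : CtxAsg E E') :
    (t.subst (CtxAsg.wkAr E a b)).subst (CtxAsg.liftAr θ a b)
      = (t.subst θ).subst (CtxAsg.wkAr E' (θ.ob a) (θ.ob b)) :=
  (Tm.subst_subst t (CtxAsg.wkAr E a b) (CtxAsg.liftAr θ a b)).trans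
    (Tm.subst_subst t θ (CtxAsg.wkAr E' (θ.ob a) (θ.ob b))).symm

theorem Tm.wkAr_subst_consAr {E : Tel W m} {E' : Tel U k} {a b c d : ObX W m}
    (t : Tm (HomX E) c d) (θ : CtxAsg E E') (y : Tm (HomX E') (θ.ob a) (θ.ob b)) :
    (t.subst (CtxAsg.wkAr E a b)).subst (CtxAsg.consAr θ y) = t.subst θ :=
  Tm.subst_subst t (CtxAsg.wkAr E a b) (CtxAsg.consAr θ y)

/-- The graph of a term: the proposition that the last arrow-variable is equal to it. -/
def eqNew {E : Tel W m} {a b : ObX W m} (t : Tm (HomX E) a b) : Fml W (E.ar a b) :=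
  .eq (Δ := E.ar a b) (.sym AddAr.new) (t.subst (CtxAsg.wkAr E a b))

theorem eqNew_liftAr {E : Tel W m} {E' : Tel U k} {a b : ObX W m} (t : Tm (HomX E) a b)
    (θ : CtxAsg E E') : (eqNew t).subst (CtxAsg.liftAr θ a b) = eqNew (t.subst θ) :=
  congrArg (Fml.eq (Δ := E'.ar (θ.ob a) (θ.ob b)) (.sym AddAr.new)) (Tm.wkAr_subst_liftAr t θ)

theorem eqNew_consAr {E : Tel W m} {E' : Tel U k} {a b : ObX W m} (t : Tm (HomX E) a b)
    (θ : CtxAsg E E') (y : Tm (HomX E') (θ.ob a) (θ.ob b)) :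
    (eqNew t).subst (CtxAsg.consAr θ y) = .eq y (t.subst θ) :=
  congrArg (Fml.eq y) (Tm.wkAr_subst_consAr t θ y)

/-- Weakening by the three arrow-variables of sorts `a → c`, `a → b` and `b → c`. -/
def wk₃ (E : Tel W m) (a b c : ObX W m) : CtxAsg E (((E.ar a c).ar a b).ar b c) :=
  Asg.comp (Asg.comp (CtxAsg.wkAr E a c) (CtxAsg.wkAr (E.ar a c) a b))
    (CtxAsg.wkAr ((E.ar a c).ar a b) b c)

/-- With `y`, `u`, `v` the last three variables: `F(u)` and `G(v)` and `y = v ∘ u`. -/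
def compBody {E : Tel W m} {a b c : ObX W m} (F : Fml W (E.ar a b)) (G : Fml W (E.ar b c)) :
    Fml W (((E.ar a c).ar a b).ar b c) :=
  .and (.and
    (F.subst (CtxAsg.consAr (wk₃ E a b c) (a := a) (b := b) (.sym (AddAr.old AddAr.new))))
    (G.subst (CtxAsg.consAr (wk₃ E a b c) (a := b) (b := c) (.sym AddAr.new))))
    (.eq (Δ := ((E.ar a c).ar a b).ar b c) (.sym (AddAr.old (AddAr.old AddAr.new)))
      (.comp (.sym AddAr.new) (.sym (AddAr.old AddAr.new))))

/-- The graph of a composite, from the graphs of the factors. -/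
def compGph {E : Tel W m} {a b c : ObX W m} (F : Fml W (E.ar a b)) (G : Fml W (E.ar b c)) :
    Fml W (E.ar a c) :=
  .exAr (Δ := E.ar a c) a b (.exAr (Δ := (E.ar a c).ar a b) b c (compBody F G))

theorem compGph_liftAr {E : Tel W m} {E' : Tel U k} {a b c : ObX W m} (F : Fml W (E.ar a b))
    (G : Fml W (E.ar b c)) (θ : CtxAsg E E') :
    (compGph F G).subst (CtxAsg.liftAr θ a c)
      = compGph (F.subst (CtxAsg.liftAr θ a b)) (G.subst (CtxAsg.liftAr θ b c)) := by
  let L : CtxAsg (((E.ar a c).ar a b).ar b c) (((E'.ar (θ.ob a) (θ.ob c)).ar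
      (θ.ob a) (θ.ob b)).ar (θ.ob b) (θ.ob c)) :=
    CtxAsg.liftAr (CtxAsg.liftAr (CtxAsg.liftAr θ a c) a b) b c
  have hw : Asg.comp (wk₃ E a b c) L = Asg.comp θ (wk₃ E' (θ.ob a) (θ.ob b) (θ.ob c)) := by
    let w₁ := CtxAsg.wkAr E' (θ.ob a) (θ.ob c)
    let w₂ := CtxAsg.wkAr (E'.ar (θ.ob a) (θ.ob c)) (θ.ob a) (θ.ob b)
    let w₃ := CtxAsg.wkAr ((E'.ar (θ.ob a) (θ.ob c)).ar (θ.ob a) (θ.ob b)) (θ.ob b) (θ.ob c)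
    exact (congrArg (fun ρ => Asg.comp ρ w₃) (Asg.comp_assoc θ w₁ w₂)).trans
      (Asg.comp_assoc θ (Asg.comp w₁ w₂) w₃)
  have e : ∀ {p q : ObX W m} (K : Fml W (E.ar p q))
      (s : Tm (HomX (((E.ar a c).ar a b).ar b c)) p q),
      (K.subst (CtxAsg.consAr (wk₃ E a b c) (a := p) (b := q) s)).subst L
        = (K.subst (CtxAsg.liftAr θ p q)).subst
          (CtxAsg.consAr (wk₃ E' (θ.ob a) (θ.ob b) (θ.ob c)) (a := θ.ob p) (b := θ.ob q)
            (s.subst L)) := by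
    intro p q K s
    rw [Fml.subst_subst, Fml.subst_subst]
    refine congrArg K.subst ?_
    exact CtxAsg.ext_ar (σ := Asg.comp θ (wk₃ E' (θ.ob a) (θ.ob b) (θ.ob c))) hw
      (Asg.comp_assoc θ (CtxAsg.wkAr E' (θ.ob p) (θ.ob q))
        (CtxAsg.consAr (wk₃ E' (θ.ob a) (θ.ob b) (θ.ob c)) (a := θ.ob p) (b := θ.ob q)
          (s.subst L))) HEq.rfl
  exact congrArg (Fml.exAr _ _) (congrArg (Fml.exAr _ _) (congrArg₂ Fml.and
    (congrArg₂ Fml.and (e F (.sym (AddAr.old AddAr.new))) (e G (.sym AddAr.new))) rfl))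

/-- Evaluation of a proposition weakened to the context of `y`, `u`, `v`. -/
theorem wk₃_cons {E : Tel W m} {E' : Tel U k} {a b c : ObX W m} (σ : CtxAsg E E')
    (y : Tm (HomX E') (σ.ob a) (σ.ob c)) (u : Tm (HomX E') (σ.ob a) (σ.ob b))
    (v : Tm (HomX E') (σ.ob b) (σ.ob c)) {p q : ObX W m} (K : Fml W (E.ar p q))
    (s : Tm (HomX (((E.ar a c).ar a b).ar b c)) p q) :
    (K.subst (CtxAsg.consAr (wk₃ E a b c) (a := p) (b := q) s)).subst
      (CtxAsg.consAr (Δ := (E.ar a c).ar a b) (CtxAsg.consAr (Δ := E.ar a c)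
        (CtxAsg.consAr σ y) (a := a) (b := b) u) (a := b) (b := c) v)
      = K.subst (CtxAsg.consAr σ (a := p) (b := q) (s.subst (CtxAsg.consAr (Δ := (E.ar a c).ar a b)
        (CtxAsg.consAr (Δ := E.ar a c) (CtxAsg.consAr σ y) (a := a) (b := b) u)
          (a := b) (b := c) v))) := by
  rw [Fml.subst_subst]
  exact congrArg K.subst (CtxAsg.ext_ar rfl rfl HEq.rfl)

theorem compBody_subst {E : Tel W m} {E' : Tel U k} {a b c : ObX W m} (F : Fml W (E.ar a b))
    (G : Fml W (E.ar b c)) (σ : CtxAsg E E')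
    (y : Tm (HomX E') (σ.ob a) (σ.ob c)) (u : Tm (HomX E') (σ.ob a) (σ.ob b))
    (v : Tm (HomX E') (σ.ob b) (σ.ob c)) :
    (compBody F G).subst (CtxAsg.consAr (Δ := (E.ar a c).ar a b) (CtxAsg.consAr (Δ := E.ar a c)
        (CtxAsg.consAr σ y) (a := a) (b := b) u) (a := b) (b := c) v)
      = .and (.and (F.subst (CtxAsg.consAr σ u)) (G.subst (CtxAsg.consAr σ v)))
        (.eq y (.comp v u)) :=
  congrArg₂ Fml.and (congrArg₂ Fml.and (wk₃_cons σ y u v F (.sym (AddAr.old AddAr.new)))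
    (wk₃_cons σ y u v G (.sym AddAr.new))) rfl

theorem compGph_intro {E : Tel W m} {E' : Tel U k} {Γ : Set (Fml U E')} {a b c : ObX W m}
    {F : Fml W (E.ar a b)} {G : Fml W (E.ar b c)} {σ : CtxAsg E E'}
    {y : Tm (HomX E') (σ.ob a) (σ.ob c)} (u : Tm (HomX E') (σ.ob a) (σ.ob b))
    (v : Tm (HomX E') (σ.ob b) (σ.ob c)) (hu : Deriv E' Γ (F.subst (CtxAsg.consAr σ u)))
    (hv : Deriv E' Γ (G.subst (CtxAsg.consAr σ v))) (hy : Deriv E' Γ (.eq y (.comp v u))) :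
    Deriv E' Γ ((compGph F G).subst (CtxAsg.consAr σ y)) :=
  Deriv.exAr_intro (σ := CtxAsg.consAr σ y) u (Deriv.exAr_intro v
    ((Deriv.andI (.andI hu hv) hy).of_eq (compBody_subst F G σ y u v).symm))

/-- To use the graph of a composite at `y`, factor `y` at an extension. -/
theorem compGph_elim {E : Tel W m} {E' : Tel U k} {Γ : Set (Fml U E')} {a b c : ObX W m}
    {F : Fml W (E.ar a b)} {G : Fml W (E.ar b c)} {σ : CtxAsg E E'}
    {y : Tm (HomX E') (σ.ob a) (σ.ob c)} {χ : Fml U E'}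
    (h : Deriv E' Γ ((compGph F G).subst (CtxAsg.consAr σ y)))
    (H : ∀ {l : ℕ} (E'' : Tel U l) (Γ' : Set (Fml U E'')) (w : CtxAsg E' E''), Ext Γ Γ' w →
      ∀ (u : Tm (HomX E'') (w.ob (σ.ob a)) (w.ob (σ.ob b)))
        (v : Tm (HomX E'') (w.ob (σ.ob b)) (w.ob (σ.ob c))),
        Deriv E'' Γ' (F.subst (CtxAsg.consAr (Asg.comp σ w) (a := a) (b := b) u)) →
        Deriv E'' Γ' (G.subst (CtxAsg.consAr (Asg.comp σ w) (a := b) (b := c) v)) →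
        Deriv E'' Γ' (.eq (y.subst w) (.comp v u)) → Deriv E'' Γ' (χ.subst w)) :
    Deriv E' Γ χ := by
  refine Deriv.exAr_elim (σ := CtxAsg.consAr σ y) h fun E₁ Γ₁ w₁ hw₁ u hu => ?_
  refine Deriv.exAr_elim hu fun E₂ Γ₂ w₂ hw₂ v hv => ?_
  have hσ : Asg.comp (CtxAsg.consAr (Δ := E.ar a c) (Asg.comp (CtxAsg.consAr σ y) w₁)
      (a := a) (b := b) u) w₂ = CtxAsg.consAr (Δ := E.ar a c) (CtxAsg.consAr
        (Asg.comp σ (Asg.comp w₁ w₂)) (a := a) (b := c) (y.subst (Asg.comp w₁ w₂)))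
        (a := a) (b := b) (u.subst w₂) := by
    refine CtxAsg.ext_ar (σ := CtxAsg.consAr
        (Asg.comp σ (Asg.comp w₁ w₂)) (a := a) (b := c) (y.subst (Asg.comp w₁ w₂))) ?_ rfl HEq.rfl
    refine CtxAsg.ext_ar (σ := Asg.comp σ (Asg.comp w₁ w₂)) (Asg.comp_assoc σ w₁ w₂) rfl ?_
    exact heq_of_eq (Tm.subst_subst y w₁ w₂)
  have hv' := hv.of_eq ((congrArg (compBody F G).subst
    (CtxAsg.consAr_congr (a := b) (b := c) (t := v) (t' := v) hσ HEq.rfl)).trans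
    (compBody_subst F G (Asg.comp σ (Asg.comp w₁ w₂)) (y.subst (Asg.comp w₁ w₂))
      (u.subst w₂) v))
  exact (H E₂ Γ₂ (Asg.comp w₁ w₂) (hw₁.trans hw₂) (u.subst w₂) v (.andE₁ (.andE₁ hv'))
    (.andE₂ (.andE₁ hv')) (.andE₂ hv')).of_eq (Fml.subst_subst _ _ _).symm

end Star

/-! ### Functional graphs -/

section Functional

variable {V : Voc.{u}} {W : Voc.{v}} {n m k : ℕ}

/-- The identity isomorphism. -/
def CtxIso.refl {Δ : Tel V n} {E : Tel W m} (Γ : Set (Fml W E)) (σ : CtxAsg Δ E) :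
    CtxIso Γ σ σ :=
  CtxIso.ofProvEq σ.ob σ.ar σ.ar (fun _ => .eqRefl _)

/-- Provably equal arrow-terms may be substituted for each other. -/
theorem Deriv.replace {Δ : Tel V n} {E : Tel W m} {Γ : Set (Fml W E)} {σ : CtxAsg Δ E}
    {a b : ObX V n} {φ : Fml V (Δ.ar a b)} {t t' : Tm (HomX E) (σ.ob a) (σ.ob b)}
    (h : Deriv E Γ (φ.subst (CtxAsg.consAr σ t))) (e : Deriv E Γ (.eq t t')) :
    Deriv E Γ (φ.subst (CtxAsg.consAr σ t')) :=
  CtxIso.transport φ ((CtxIso.refl Γ σ).consAr ((Category.id_comp _).trans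
    ((arrow_eq_iff.2 e).symm.trans (Category.comp_id _).symm))) h

theorem Fml.consAr_subst {U : Voc.{w}} {Δ : Tel V n} {E : Tel W m} {E' : Tel U k}
    {a b : ObX V n} (φ : Fml V (Δ.ar a b)) (σ : CtxAsg Δ E)
    (t : Tm (HomX E) (σ.ob a) (σ.ob b)) (w : CtxAsg E E') :
    (φ.subst (CtxAsg.consAr σ t)).subst w
      = φ.subst (CtxAsg.consAr (Asg.comp σ w) (a := a) (b := b) (t.subst w)) :=
  (Fml.subst_subst _ _ _).trans (congrArg φ.subst (CtxAsg.consAr_comp σ t w))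

/-- Under the hypotheses `Γ`, exactly one arrow `a → b` satisfies `G`. Uniqueness is required at
all extensions; `atMostOne` expresses it by a proposition. -/
structure Functional {E : Tel W m} (Γ : Set (Fml W E)) {a b : ObX W m} (G : Fml W (E.ar a b)) :
    Prop where
  total : Deriv E Γ (.exAr a b G)
  unique : ∀ {k : ℕ} (E' : Tel W k) (Γ' : Set (Fml W E')) (w : CtxAsg E E'), Ext Γ Γ' w →
    ∀ t t' : Tm (HomX E') (w.ob a) (w.ob b), Deriv E' Γ' (G.subst (CtxAsg.consAr w t)) →
      Deriv E' Γ' (G.subst (CtxAsg.consAr w t')) → Deriv E' Γ' (.eq t t')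

namespace Functional

variable {E : Tel W m} {Γ : Set (Fml W E)} {a b c : ObX W m}

/-- The arrow that satisfies a functional `G` may be used, at an extension. -/
theorem elim {G : Fml W (E.ar a b)} (h : Functional Γ G) {k : ℕ} {E' : Tel W k}
    {Γ' : Set (Fml W E')} {w : CtxAsg E E'} (hw : Ext Γ Γ' w) {χ : Fml W E'}
    (H : ∀ {l : ℕ} (E'' : Tel W l) (Γ'' : Set (Fml W E'')) (w' : CtxAsg E' E''), Ext Γ' Γ'' w' →
      ∀ t : Tm (HomX E'') (w'.ob (w.ob a)) (w'.ob (w.ob b)),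
        Deriv E'' Γ'' (G.subst (CtxAsg.consAr (Asg.comp w w') (a := a) (b := b) t)) →
        Deriv E'' Γ'' (χ.subst w')) : Deriv E' Γ' χ :=
  Deriv.exAr_elim (h.total.subst hw) H

theorem eqNew (t : Tm (HomX E) a b) : Functional Γ (CatTheory.eqNew t) := by
  constructor
  · refine (Deriv.exAr_intro (σ := CtxAsg.id E) t ?_).of_eq (Fml.subst_id _)
    exact (Deriv.eqRefl t).of_eq ((eqNew_consAr t (CtxAsg.id E) t).trans
      (congrArg (Fml.eq t) (Tm.subst_id t))).symm
  · intro k E' Γ' w _ y y' hy hy'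
    exact .eqTrans (hy.of_eq (eqNew_consAr t w y)) (.eqSymm (hy'.of_eq (eqNew_consAr t w y')))

theorem compGph {F : Fml W (E.ar a b)} {G : Fml W (E.ar b c)} (hF : Functional Γ F)
    (hG : Functional Γ G) : Functional Γ (CatTheory.compGph F G) := by
  constructor
  · refine hF.elim Ext.refl fun E₁ Γ₁ w₁ hw₁ s hs => ?_
    refine hG.elim hw₁ fun E₂ Γ₂ w₂ hw₂ t ht => ?_
    refine Deriv.of_eq ?_ (Fml.subst_subst _ w₁ w₂).symm
    refine Deriv.exAr_intro (σ := Asg.comp w₁ w₂) (.comp t (s.subst w₂)) ?_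
    exact compGph_intro (σ := Asg.comp w₁ w₂) (s.subst w₂) t
      ((hs.subst hw₂).of_eq (Fml.consAr_subst F w₁ s w₂)) ht (.eqRefl _)
  · intro k E' Γ' w hw y y' hy hy'
    refine compGph_elim hy fun E₁ Γ₁ w₁ hw₁ s t hs ht hst => ?_
    refine compGph_elim ((hy'.subst hw₁).of_eq (Fml.consAr_subst _ _ _ _))
      fun E₂ Γ₂ w₂ hw₂ s' t' hs' ht' hst' => ?_
    have hww : Ext Γ Γ₂ (Asg.comp (Asg.comp w w₁) w₂) := (hw.trans hw₁).trans hw₂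
    have e₁ := hF.unique E₂ Γ₂ _ hww (s.subst w₂) s'
      ((hs.subst hw₂).of_eq (Fml.consAr_subst F (Asg.comp w w₁) s w₂)) hs'
    have e₂ := hG.unique E₂ Γ₂ _ hww (t.subst w₂) t'
      ((ht.subst hw₂).of_eq (Fml.consAr_subst G (Asg.comp w w₁) t w₂)) ht'
    exact .eqTrans (hst.subst hw₂) (.eqTrans (.eqComp e₁ e₂) (.eqSymm hst'))

end Functional

end Functional

section AtMostOne

variable {V : Voc.{u}} {m k : ℕ} {E : Tel V m} {a b : ObX V m} {G : Fml V (E.ar a b)}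

/-- At most one arrow satisfies `G`, as a proposition. -/
def atMostOne (G : Fml V (E.ar a b)) : Fml V E :=
  .allAr a b (.allAr a b (.imp
    (.and (G.subst (CtxAsg.wkAr (E.ar a b) a b))
      (G.subst (CtxAsg.consAr (Asg.comp (CtxAsg.wkAr E a b) (CtxAsg.wkAr (E.ar a b) a b))
        (a := a) (b := b) (.sym AddAr.new))))
    (.eq (Δ := (E.ar a b).ar a b) (.sym (AddAr.old AddAr.new)) (.sym AddAr.new))))

theorem atMostOne_left {W : Voc.{v}} {E' : Tel W k} (w : CtxAsg E E')
    (t t' : Tm (HomX E') (w.ob a) (w.ob b)) :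
    (G.subst (CtxAsg.wkAr (E.ar a b) a b)).subst
      (CtxAsg.consAr (CtxAsg.consAr w t) (a := a) (b := b) t') = G.subst (CtxAsg.consAr w t) :=
  Fml.subst_subst _ _ _

theorem atMostOne_right {W : Voc.{v}} {E' : Tel W k} (w : CtxAsg E E')
    (t t' : Tm (HomX E') (w.ob a) (w.ob b)) :
    (G.subst (CtxAsg.consAr (Asg.comp (CtxAsg.wkAr E a b) (CtxAsg.wkAr (E.ar a b) a b))
      (a := a) (b := b) (.sym AddAr.new))).subst
      (CtxAsg.consAr (CtxAsg.consAr w t) (a := a) (b := b) t') = G.subst (CtxAsg.consAr w t') :=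
  (Fml.subst_subst _ _ _).trans (congrArg G.subst (CtxAsg.ext_ar rfl rfl HEq.rfl))

theorem atMostOne_elim {W : Voc.{v}} {E' : Tel W k} {Γ' : Set (Fml W E')} {w : CtxAsg E E'}
    (h : Deriv E' Γ' ((atMostOne G).subst w)) {t t' : Tm (HomX E') (w.ob a) (w.ob b)}
    (ht : Deriv E' Γ' (G.subst (CtxAsg.consAr w t)))
    (ht' : Deriv E' Γ' (G.subst (CtxAsg.consAr w t'))) : Deriv E' Γ' (.eq t t') :=
  Deriv.impE (Deriv.allAr_elim (Deriv.allAr_elim h t) t')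
    (.andI (ht.of_eq (atMostOne_left w t t').symm) (ht'.of_eq (atMostOne_right w t t').symm))

theorem Functional.atMostOne {Γ : Set (Fml V E)} (h : Functional Γ G) :
    Deriv E Γ (atMostOne G) := by
  refine (Deriv.allAr_intro (σ := CtxAsg.id E) fun E₁ Γ₁ w₁ hw₁ t => ?_).of_eq (Fml.subst_id _)
  refine Deriv.allAr_intro fun E₂ Γ₂ w₂ hw₂ t' => Deriv.imp_intro fun Γ₃ hΓ hG => ?_
  have ec : CtxAsg.consAr (Asg.comp (CtxAsg.consAr (Asg.comp (CtxAsg.id E) w₁) t) w₂)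
      (a := a) (b := b) t' = CtxAsg.consAr (CtxAsg.consAr (Asg.comp w₁ w₂) (a := a) (b := b)
        (t.subst w₂)) (a := a) (b := b) t' :=
    CtxAsg.consAr_congr (a := a) (b := b) (CtxAsg.consAr_comp w₁ t w₂) HEq.rfl
  have hG' := hG.of_eq (congrArg (Fml.subst _) ec)
  exact h.unique E₂ Γ₃ _ ((hw₁.trans hw₂).mono hΓ) (t.subst w₂) t'
    ((Deriv.andE₁ hG').of_eq (atMostOne_left _ _ _))
    ((Deriv.andE₂ hG').of_eq (atMostOne_right _ _ _))

/-- Functionality is preserved by assignments, also by those that replace constants. -/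
theorem Functional.subst {W : Voc.{v}} {E' : Tel W k} {Γ : Set (Fml V E)}
    {Γ' : Set (Fml W E')} {r : CtxAsg E E'} (h : Functional Γ G) (hr : Ext Γ Γ' r) :
    Functional Γ' (G.subst (CtxAsg.liftAr r a b)) := by
  refine ⟨h.total.subst hr, fun E₁ Γ₁ w hw t t' ht ht' => ?_⟩
  have e : ∀ t, (G.subst (CtxAsg.liftAr r a b)).subst (CtxAsg.consAr w t)
      = G.subst (CtxAsg.consAr (Asg.comp r w) (a := a) (b := b) t) := fun t =>
    (Fml.subst_subst _ _ _).trans (congrArg G.subst (CtxAsg.liftAr_consAr r w a b t))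
  exact atMostOne_elim (h.atMostOne.subst (hr.trans hw)) (ht.of_eq (e t)) (ht'.of_eq (e t'))

theorem Functional.mono {Γ Γ' : Set (Fml V E)} (h : Functional Γ G) (hΓ : Γ ⊆ Γ') :
    Functional Γ' G :=
  ⟨h.total.mono hΓ, fun E' Γ'' w hw => h.unique E' Γ'' w fun γ hγ => hw γ (hΓ hγ)⟩

end AtMostOne

/-! ### Relational assignments and translation of propositions -/

section RAsg

/-- A relational assignment: it assigns object-terms to object-terms, and to each arrow symbol a
proposition about an arrow, thought of as the graph of the arrow that is assigned to it. -/
structure RAsg {V : Voc.{u}} {W : Voc.{v}} {n m : ℕ} (Δ : Tel V n) (E : Tel W m) where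
  ob : ObX V n → ObX W m
  gr : ∀ {a b : ObX V n}, HomX Δ a b → Fml W (E.ar (ob a) (ob b))

variable {V : Voc.{u}} {W : Voc.{v}} {U : Voc.{w}} {n m k : ℕ} {Δ : Tel V n} {E : Tel W m}

namespace RAsg

theorem ext' {ρ τ : RAsg Δ E} (hob : ∀ a, ρ.ob a = τ.ob a)
    (hgr : ∀ {a b : ObX V n} (h : HomX Δ a b), HEq (ρ.gr h) (τ.gr h)) : ρ = τ := by
  obtain ⟨o₁, r₁⟩ := ρ
  obtain ⟨o₂, r₂⟩ := τ
  obtain rfl : o₁ = o₂ := funext hob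
  congr 1
  funext a b h
  exact eq_of_heq (hgr h)

/-- The relational assignment given by an assignment. -/
def ofAsg (σ : CtxAsg Δ E) : RAsg Δ E where
  ob := σ.ob
  gr h := eqNew (σ.ar h)

/-- The action of assignments of the target context. -/
def subst {E' : Tel U k} (ρ : RAsg Δ E) (θ : CtxAsg E E') : RAsg Δ E' where
  ob a := θ.ob (ρ.ob a)
  gr h := (ρ.gr h).subst (CtxAsg.liftAr θ _ _)

/-- Extension by a value for a new object-variable. -/
def consOb (ρ : RAsg Δ E) (c : ObX W m) : RAsg Δ.ob E where
  ob
    | none => c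
    | some a => ρ.ob a
  gr
    | .old h => ρ.gr h

/-- Extension by a graph for a new arrow-variable. -/
def consAr (ρ : RAsg Δ E) {a b : ObX V n} (G : Fml W (E.ar (ρ.ob a) (ρ.ob b))) :
    RAsg (Δ.ar a b) E where
  ob := ρ.ob
  gr
    | .old h => ρ.gr h
    | .new => G

/-- Pass under an object binder. -/
def liftOb (ρ : RAsg Δ E) : RAsg Δ.ob E.ob := (ρ.subst (CtxAsg.wkOb E)).consOb none

/-- Pass under an arrow binder. -/
def liftAr (ρ : RAsg Δ E) (a b : ObX V n) : RAsg (Δ.ar a b) (E.ar (ρ.ob a) (ρ.ob b)) :=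
  (ρ.subst (CtxAsg.wkAr E (ρ.ob a) (ρ.ob b))).consAr (a := a) (b := b)
    (eqNew (.sym AddAr.new))

/-- The graph of an arrow-term. -/
def gph (ρ : RAsg Δ E) : {a b : ObX V n} → Tm (HomX Δ) a b → Fml W (E.ar (ρ.ob a) (ρ.ob b))
  | _, _, .sym h => ρ.gr h
  | _, _, .id a => eqNew (.id (ρ.ob a))
  | _, _, .comp g f => compGph (ρ.gph f) (ρ.gph g)

/-- An assignment followed by a relational assignment. -/
def precomp {Δ' : Tel U k} (σ : CtxAsg Δ' Δ) (ρ : RAsg Δ E) : RAsg Δ' E where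
  ob a := ρ.ob (σ.ob a)
  gr h := ρ.gph (σ.ar h)

end RAsg

/-- The translation of a proposition along a relational assignment: arrow symbols are replaced
by their graphs, and an equation by the inclusion of the first graph in the second, which amounts
to equality when the graphs are functional. -/
def Fml.star : {n : ℕ} → {Δ : Tel V n} → Fml V Δ → {m : ℕ} → {E : Tel W m} → RAsg Δ E → Fml W E
  | _, _, .eq f g, _, _, ρ => .allAr _ _ (.imp (ρ.gph f) (ρ.gph g))
  | _, _, .top, _, _, _ => .top
  | _, _, .bot, _, _, _ => .bot
  | _, _, .and φ ψ, _, _, ρ => .and (φ.star ρ) (ψ.star ρ)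
  | _, _, .or φ ψ, _, _, ρ => .or (φ.star ρ) (ψ.star ρ)
  | _, _, .imp φ ψ, _, _, ρ => .imp (φ.star ρ) (ψ.star ρ)
  | _, _, .allOb φ, _, _, ρ => .allOb (φ.star ρ.liftOb)
  | _, _, .exOb φ, _, _, ρ => .exOb (φ.star ρ.liftOb)
  | _, _, .allAr a b φ, _, _, ρ => .allAr (ρ.ob a) (ρ.ob b) (φ.star (ρ.liftAr a b))
  | _, _, .exAr a b φ, _, _, ρ => .exAr (ρ.ob a) (ρ.ob b) (φ.star (ρ.liftAr a b))

namespace RAsg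

theorem gph_subst {E' : Tel U k} (ρ : RAsg Δ E) (θ : CtxAsg E E') {a b : ObX V n}
    (t : Tm (HomX Δ) a b) :
    (ρ.subst θ).gph t = (ρ.gph t).subst (CtxAsg.liftAr θ (ρ.ob a) (ρ.ob b)) := by
  induction t with
  | sym h => rfl
  | id a => exact (eqNew_liftAr (Tm.id (ρ.ob a)) θ).symm
  | comp g f ihg ihf => exact (congrArg₂ compGph ihf ihg).trans (compGph_liftAr _ _ _).symm

theorem subst_subst {U' : Voc.{x}} {l : ℕ} {E' : Tel U k} {E'' : Tel U' l} (ρ : RAsg Δ E)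
    (θ : CtxAsg E E') (θ' : CtxAsg E' E'') :
    (ρ.subst θ).subst θ' = ρ.subst (Asg.comp θ θ') := by
  refine ext' (fun _ => rfl) fun h => heq_of_eq ?_
  exact (Fml.subst_subst _ _ _).trans (congrArg (ρ.gr h).subst (CtxAsg.liftAr_comp θ θ' _ _).symm)

theorem subst_id (ρ : RAsg Δ E) : ρ.subst (CtxAsg.id E) = ρ := by
  refine ext' (fun _ => rfl) fun h => heq_of_eq ?_
  exact (congrArg (ρ.gr h).subst (CtxAsg.liftAr_id _ _)).trans (Fml.subst_id _)

theorem consOb_subst {E' : Tel U k} (ρ : RAsg Δ E) (c : ObX W m) (θ : CtxAsg E E') :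
    (ρ.consOb c).subst θ = (ρ.subst θ).consOb (θ.ob c) := by
  refine ext' ?_ ?_
  · rintro (_ | a) <;> rfl
  · rintro _ _ ⟨h⟩; exact HEq.rfl

theorem consAr_subst {E' : Tel U k} (ρ : RAsg Δ E) {a b : ObX V n}
    (G : Fml W (E.ar (ρ.ob a) (ρ.ob b))) (θ : CtxAsg E E') :
    (ρ.consAr G).subst θ
      = (ρ.subst θ).consAr (a := a) (b := b) (G.subst (CtxAsg.liftAr θ (ρ.ob a) (ρ.ob b))) := by
  refine ext' (fun _ => rfl) ?_
  rintro _ _ (h | _) <;> exact HEq.rfl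

theorem liftOb_subst {E' : Tel U k} (ρ : RAsg Δ E) (θ : CtxAsg E E') :
    (ρ.subst θ).liftOb = ρ.liftOb.subst (CtxAsg.liftOb θ) := by
  refine Eq.trans ?_ (consOb_subst _ _ _).symm
  exact congrArg (fun τ : RAsg Δ E'.ob => τ.consOb (none : Option (ObX U k)))
    ((subst_subst ρ θ (CtxAsg.wkOb E')).trans
      (subst_subst ρ (CtxAsg.wkOb E) (CtxAsg.liftOb θ)).symm)

theorem consAr_congr {ρ τ : RAsg Δ E} (h : ρ = τ) {a b : ObX V n}
    {F : Fml W (E.ar (ρ.ob a) (ρ.ob b))} {G : Fml W (E.ar (τ.ob a) (τ.ob b))} (hFG : HEq F G) :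
    ρ.consAr F = τ.consAr G := by
  subst h
  rw [eq_of_heq hFG]

theorem liftAr_subst {E' : Tel U k} (ρ : RAsg Δ E) (θ : CtxAsg E E') (a b : ObX V n) :
    (ρ.subst θ).liftAr a b = (ρ.liftAr a b).subst (CtxAsg.liftAr θ (ρ.ob a) (ρ.ob b)) := by
  refine Eq.trans ?_ (consAr_subst _ _ _).symm
  refine consAr_congr (a := a) (b := b)
    ((subst_subst ρ θ (CtxAsg.wkAr E' (θ.ob (ρ.ob a)) (θ.ob (ρ.ob b)))).trans
      (subst_subst ρ (CtxAsg.wkAr E (ρ.ob a) (ρ.ob b))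
        (CtxAsg.liftAr θ (ρ.ob a) (ρ.ob b))).symm) (heq_of_eq ?_)
  exact (eqNew_liftAr (E := E.ar (ρ.ob a) (ρ.ob b)) (a := ρ.ob a) (b := ρ.ob b)
    (.sym AddAr.new) (CtxAsg.liftAr θ (ρ.ob a) (ρ.ob b))).symm

/-- The graph of a substituted term is its graph along the composite relational assignment. -/
theorem gph_precomp {Δ' : Tel U k} (σ : CtxAsg Δ' Δ) (ρ : RAsg Δ E) {a b : ObX U k}
    (t : Tm (HomX Δ') a b) : (precomp σ ρ).gph t = ρ.gph (t.subst σ) := by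
  induction t with
  | sym h => rfl
  | id a => rfl
  | comp g f ihg ihf => exact congrArg₂ compGph ihf ihg

theorem precomp_consOb {Δ' : Tel U k} (σ : CtxAsg Δ' Δ) (c : ObX V n) (ρ : RAsg Δ E) :
    precomp (CtxAsg.consOb σ c) ρ = (precomp σ ρ).consOb (ρ.ob c) := by
  refine ext' ?_ ?_
  · rintro (_ | a) <;> rfl
  · rintro _ _ ⟨h⟩; exact HEq.rfl

theorem precomp_consAr {Δ' : Tel U k} (σ : CtxAsg Δ' Δ) {a b : ObX U k}
    (t : Tm (HomX Δ) (σ.ob a) (σ.ob b)) (ρ : RAsg Δ E) :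
    precomp (CtxAsg.consAr σ t) ρ = (precomp σ ρ).consAr (a := a) (b := b) (ρ.gph t) := by
  refine ext' (fun _ => rfl) ?_
  rintro _ _ (h | _) <;> exact HEq.rfl

theorem precomp_precomp {U' : Voc.{x}} {l : ℕ} {Δ' : Tel U k} {Δ'' : Tel U' l}
    (σ : CtxAsg Δ'' Δ') (τ : CtxAsg Δ' Δ) (ρ : RAsg Δ E) :
    precomp σ (precomp τ ρ) = precomp (Asg.comp σ τ) ρ :=
  ext' (fun _ => rfl) fun _ => heq_of_eq (gph_precomp _ _ _)

theorem precomp_subst {U' : Voc.{x}} {l : ℕ} {Δ' : Tel U k} {E' : Tel U' l} (σ : CtxAsg Δ' Δ)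
    (ρ : RAsg Δ E) (θ : CtxAsg E E') : (precomp σ ρ).subst θ = precomp σ (ρ.subst θ) :=
  ext' (fun _ => rfl) fun _ => heq_of_eq (gph_subst _ _ _).symm

theorem precomp_liftOb {Δ' : Tel U k} (σ : CtxAsg Δ' Δ) (ρ : RAsg Δ E) :
    precomp (CtxAsg.liftOb σ) ρ.liftOb = (precomp σ ρ).liftOb := by
  refine (precomp_consOb _ _ _).trans ?_
  refine congrArg (fun τ : RAsg Δ' E.ob => τ.consOb (none : Option (ObX W m))) ?_
  refine (precomp_precomp σ (CtxAsg.wkOb Δ) ρ.liftOb).symm.trans ?_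
  exact (precomp_subst σ ρ (CtxAsg.wkOb E)).symm

theorem precomp_liftAr {Δ' : Tel U k} (σ : CtxAsg Δ' Δ) (ρ : RAsg Δ E) (a b : ObX U k) :
    precomp (CtxAsg.liftAr σ a b) (ρ.liftAr (σ.ob a) (σ.ob b)) = (precomp σ ρ).liftAr a b := by
  refine (precomp_consAr (Asg.comp σ (CtxAsg.wkAr Δ (σ.ob a) (σ.ob b))) (a := a) (b := b)
    (.sym AddAr.new) (ρ.liftAr (σ.ob a) (σ.ob b))).trans ?_
  refine consAr_congr ?_ HEq.rfl
  refine (precomp_precomp σ (CtxAsg.wkAr Δ (σ.ob a) (σ.ob b))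
    (ρ.liftAr (σ.ob a) (σ.ob b))).symm.trans ?_
  exact (precomp_subst σ ρ (CtxAsg.wkAr E (ρ.ob (σ.ob a)) (ρ.ob (σ.ob b)))).symm

end RAsg

/-- Substitution in a translated proposition acts on the graphs. -/
theorem Fml.star_subst (φ : Fml V Δ) : ∀ {m k : ℕ} {E : Tel W m} {E' : Tel U k} (ρ : RAsg Δ E)
    (θ : CtxAsg E E'), (φ.star ρ).subst θ = φ.star (ρ.subst θ) := by
  induction φ with
  | eq f g =>
    exact fun ρ θ => congrArg (Fml.allAr _ _) (congrArg₂ Fml.imp (ρ.gph_subst θ f).symm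
      (ρ.gph_subst θ g).symm)
  | top => exact fun _ _ => rfl
  | bot => exact fun _ _ => rfl
  | and φ ψ h₁ h₂ => exact fun ρ θ => congrArg₂ Fml.and (h₁ ρ θ) (h₂ ρ θ)
  | or φ ψ h₁ h₂ => exact fun ρ θ => congrArg₂ Fml.or (h₁ ρ θ) (h₂ ρ θ)
  | imp φ ψ h₁ h₂ => exact fun ρ θ => congrArg₂ Fml.imp (h₁ ρ θ) (h₂ ρ θ)
  | allOb φ ih =>
    exact fun ρ θ => congrArg Fml.allOb ((ih _ _).trans (congrArg φ.star (ρ.liftOb_subst θ).symm))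
  | exOb φ ih =>
    exact fun ρ θ => congrArg Fml.exOb ((ih _ _).trans (congrArg φ.star (ρ.liftOb_subst θ).symm))
  | allAr a b φ ih =>
    exact fun ρ θ => congrArg (Fml.allAr _ _)
      ((ih _ _).trans (congrArg φ.star (ρ.liftAr_subst θ a b).symm))
  | exAr a b φ ih =>
    exact fun ρ θ => congrArg (Fml.exAr _ _)
      ((ih _ _).trans (congrArg φ.star (ρ.liftAr_subst θ a b).symm))

/-- The translation of a substituted proposition is its translation along the composite relational
assignment. -/
theorem Fml.subst_star {Δ' : Tel U k} (φ : Fml U Δ') :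
    ∀ {n m : ℕ} {Δ : Tel V n} {E : Tel W m} (σ : CtxAsg Δ' Δ) (ρ : RAsg Δ E),
      (φ.subst σ).star ρ = φ.star (RAsg.precomp σ ρ) := by
  induction φ with
  | eq f g =>
    exact fun σ ρ => congrArg (Fml.allAr _ _) (congrArg₂ Fml.imp (ρ.gph_precomp σ f).symm
      (ρ.gph_precomp σ g).symm)
  | top => exact fun _ _ => rfl
  | bot => exact fun _ _ => rfl
  | and φ ψ h₁ h₂ => exact fun σ ρ => congrArg₂ Fml.and (h₁ σ ρ) (h₂ σ ρ)
  | or φ ψ h₁ h₂ => exact fun σ ρ => congrArg₂ Fml.or (h₁ σ ρ) (h₂ σ ρ)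
  | imp φ ψ h₁ h₂ => exact fun σ ρ => congrArg₂ Fml.imp (h₁ σ ρ) (h₂ σ ρ)
  | allOb φ ih =>
    exact fun σ ρ => congrArg Fml.allOb
      ((ih _ _).trans (congrArg φ.star (RAsg.precomp_liftOb σ ρ)))
  | exOb φ ih =>
    exact fun σ ρ => congrArg Fml.exOb
      ((ih _ _).trans (congrArg φ.star (RAsg.precomp_liftOb σ ρ)))
  | allAr a b φ ih =>
    exact fun σ ρ => congrArg (Fml.allAr _ _)
      ((ih _ _).trans (congrArg φ.star (RAsg.precomp_liftAr σ ρ a b)))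
  | exAr a b φ ih =>
    exact fun σ ρ => congrArg (Fml.exAr _ _)
      ((ih _ _).trans (congrArg φ.star (RAsg.precomp_liftAr σ ρ a b)))

end RAsg

/-! ### Quantifier rules with generic variables -/

section Generic

variable {W : Voc.{u}} {m : ℕ} {E : Tel W m} {Γ : Set (Fml W E)}

theorem Fml.wkOb_new (ψ : Fml W E.ob) :
    ψ.subst (CtxAsg.consOb (CtxAsg.wkOb E) (none : Option (ObX W m))) = ψ :=
  (congrArg ψ.subst (CtxAsg.consOb_eta (CtxAsg.id E.ob))).trans (Fml.subst_id ψ)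

theorem Fml.wkAr_new {a b : ObX W m} (ψ : Fml W (E.ar a b)) :
    ψ.subst (CtxAsg.consAr (CtxAsg.wkAr E a b) (a := a) (b := b) (.sym AddAr.new)) = ψ :=
  (congrArg ψ.subst (CtxAsg.consAr_eta (CtxAsg.id (E.ar a b)))).trans (Fml.subst_id ψ)

theorem Deriv.allOb_generic {ψ : Fml W E.ob} (h : Deriv E Γ (.allOb ψ)) :
    Deriv E.ob (Fml.wkOb '' Γ) ψ :=
  ((h.subst Ext.wkOb).allOb_elim none).of_eq (Fml.wkOb_new ψ)

theorem Deriv.allAr_generic {a b : ObX W m} {ψ : Fml W (E.ar a b)}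
    (h : Deriv E Γ (.allAr a b ψ)) : Deriv (E.ar a b) (Fml.wkAr a b '' Γ) ψ :=
  ((h.subst (Ext.wkAr a b)).allAr_elim (.sym AddAr.new)).of_eq (Fml.wkAr_new ψ)

theorem Deriv.exOb_congr {ψ ψ' : Fml W E.ob} (h : Deriv E Γ (.exOb ψ))
    (H : ∀ Γ' : Set (Fml W E.ob), Fml.wkOb '' Γ ⊆ Γ' → Deriv E.ob Γ' ψ → Deriv E.ob Γ' ψ') :
    Deriv E Γ (.exOb ψ') :=
  .exObE h (Deriv.exOb_intro (σ := CtxAsg.wkOb E) none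
    ((H _ (Set.subset_insert _ _) (.hyp (Set.mem_insert _ _))).of_eq (Fml.wkOb_new ψ').symm))

theorem Deriv.exAr_congr {a b : ObX W m} {ψ ψ' : Fml W (E.ar a b)} (h : Deriv E Γ (.exAr a b ψ))
    (H : ∀ Γ' : Set (Fml W (E.ar a b)), Fml.wkAr a b '' Γ ⊆ Γ' → Deriv (E.ar a b) Γ' ψ →
      Deriv (E.ar a b) Γ' ψ') :
    Deriv E Γ (.exAr a b ψ') :=
  .exArE h (Deriv.exAr_intro (σ := CtxAsg.wkAr E a b) (.sym AddAr.new)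
    ((H _ (Set.subset_insert _ _) (.hyp (Set.mem_insert _ _))).of_eq (Fml.wkAr_new ψ').symm))

end Generic

/-! ### Translations along equivalent graphs -/

section StarLemmas

variable {V : Voc.{u}} {W : Voc.{v}} {n m : ℕ} {Δ : Tel V n} {E : Tel W m} {Γ : Set (Fml W E)}

theorem star_eq_intro {ρ : RAsg Δ E} {a b : ObX V n} {f g : Tm (HomX Δ) a b}
    (h : ∀ {k : ℕ} (E' : Tel W k) (Γ' : Set (Fml W E')) (w : CtxAsg E E'), Ext Γ Γ' w →
      ∀ y : Tm (HomX E') (w.ob (ρ.ob a)) (w.ob (ρ.ob b)),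
        Deriv E' Γ' ((ρ.gph f).subst (CtxAsg.consAr w y)) →
        Deriv E' Γ' ((ρ.gph g).subst (CtxAsg.consAr w y))) :
    Deriv E Γ ((Fml.eq f g).star ρ) := by
  refine Deriv.of_eq ?_ (Fml.subst_id _)
  exact Deriv.allAr_intro fun E' Γ' w hw y => Deriv.imp_intro fun Γ'' hΓ hf =>
    h E' Γ'' w (hw.mono hΓ) y hf

theorem star_eq_elim {ρ : RAsg Δ E} {a b : ObX V n} {f g : Tm (HomX Δ) a b}
    (h : Deriv E Γ ((Fml.eq f g).star ρ)) {k : ℕ} {E' : Tel W k} {Γ' : Set (Fml W E')}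
    {w : CtxAsg E E'} (hw : Ext Γ Γ' w) {y : Tm (HomX E') (w.ob (ρ.ob a)) (w.ob (ρ.ob b))}
    (hf : Deriv E' Γ' ((ρ.gph f).subst (CtxAsg.consAr w y))) :
    Deriv E' Γ' ((ρ.gph g).subst (CtxAsg.consAr w y)) :=
  .impE ((h.subst hw).allAr_elim y) hf

/-- Two assignments of graphs are provably equivalent. They share the assignment `o` of
object-terms, so that their graphs have the same sorts. -/
def GrEquiv (Γ : Set (Fml W E)) (o : ObX V n → ObX W m)
    (r₁ r₂ : ∀ {a b : ObX V n}, HomX Δ a b → Fml W (E.ar (o a) (o b))) : Prop :=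
  ∀ (a b : ObX V n) (h : HomX Δ a b) {k : ℕ} (E' : Tel W k) (Γ' : Set (Fml W E'))
    (w : CtxAsg E E'), Ext Γ Γ' w → ∀ t : Tm (HomX E') (w.ob (o a)) (w.ob (o b)),
    (Deriv E' Γ' ((r₁ h).subst (CtxAsg.consAr w t)) ↔
      Deriv E' Γ' ((r₂ h).subst (CtxAsg.consAr w t)))

namespace GrEquiv

variable {o : ObX V n → ObX W m}
  {r₁ r₂ : ∀ {a b : ObX V n}, HomX Δ a b → Fml W (E.ar (o a) (o b))}

theorem symm (h : GrEquiv Γ o r₁ r₂) : GrEquiv Γ o r₂ r₁ :=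
  fun a b g _ E' Γ' w hw t => (h a b g E' Γ' w hw t).symm

theorem mono (h : GrEquiv Γ o r₁ r₂) {Γ₁ : Set (Fml W E)} (hΓ : Γ ⊆ Γ₁) :
    GrEquiv Γ₁ o r₁ r₂ :=
  fun a b g _ E' Γ' w hw t => h a b g E' Γ' w (fun γ hγ => hw γ (hΓ hγ)) t

theorem subst (h : GrEquiv Γ o r₁ r₂) {k : ℕ} {E' : Tel W k} {Γ' : Set (Fml W E')}
    {θ : CtxAsg E E'} (hθ : Ext Γ Γ' θ) :
    GrEquiv Γ' (fun a => θ.ob (o a)) ((RAsg.mk o r₁).subst θ).gr ((RAsg.mk o r₂).subst θ).gr := by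
  intro a b g l E'' Γ'' w hw t
  have e : ∀ r : Fml W (E.ar (o a) (o b)),
      (r.subst (CtxAsg.liftAr θ (o a) (o b))).subst (CtxAsg.consAr w t)
        = r.subst (CtxAsg.consAr (Asg.comp θ w) (a := o a) (b := o b) t) := fun r =>
    (Fml.subst_subst _ _ _).trans (congrArg r.subst (CtxAsg.liftAr_consAr θ w _ _ t))
  exact (iff_of_eq (congrArg (Deriv E'' Γ'') (e _))).trans
    ((h a b g E'' Γ'' _ (hθ.trans hw) t).trans (iff_of_eq (congrArg (Deriv E'' Γ'') (e _).symm)))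

theorem liftOb (h : GrEquiv Γ o r₁ r₂) :
    GrEquiv (Δ := Δ.ob) (Fml.wkOb '' Γ) (RAsg.mk o r₁).liftOb.ob (RAsg.mk o r₁).liftOb.gr
      (RAsg.mk o r₂).liftOb.gr := by
  rintro _ _ ⟨g⟩
  exact h.subst Ext.wkOb _ _ g

theorem liftAr (h : GrEquiv Γ o r₁ r₂) (a b : ObX V n) :
    GrEquiv (Δ := Δ.ar a b) (Fml.wkAr (o a) (o b) '' Γ) ((RAsg.mk o r₁).liftAr a b).ob
      ((RAsg.mk o r₁).liftAr a b).gr ((RAsg.mk o r₂).liftAr a b).gr := by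
  rintro _ _ (g | _)
  · exact h.subst (Ext.wkAr _ _) _ _ g
  · exact fun _ _ _ _ _ => Iff.rfl

theorem gph (h : GrEquiv Γ o r₁ r₂) {a b : ObX V n} (t : Tm (HomX Δ) a b) :
    ∀ {k : ℕ} {E' : Tel W k} {Γ' : Set (Fml W E')} {w : CtxAsg E E'}, Ext Γ Γ' w →
      ∀ y : Tm (HomX E') (w.ob (o a)) (w.ob (o b)),
        Deriv E' Γ' (((RAsg.mk o r₁).gph t).subst (CtxAsg.consAr w y)) →
        Deriv E' Γ' (((RAsg.mk o r₂).gph t).subst (CtxAsg.consAr w y)) := by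
  induction t with
  | sym g => exact fun hw y => (h _ _ g _ _ _ hw y).1
  | id a => exact fun _ _ h => h
  | comp g f ihg ihf =>
    intro k E' Γ' w hw y hy
    refine compGph_elim hy fun E₁ Γ₁ w₁ hw₁ s t hs ht hst => ?_
    refine Deriv.of_eq ?_ (Fml.consAr_subst _ _ _ _).symm
    exact compGph_intro s t (ihf (hw.trans hw₁) s hs) (ihg (hw.trans hw₁) t ht) hst

end GrEquiv

/-- The translation of a proposition does not change, up to provable equivalence, when graphs are
replaced by equivalent ones. -/
theorem GrEquiv.star (φ : Fml V Δ) :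
    ∀ {m : ℕ} {E : Tel W m} {Γ : Set (Fml W E)} {o : ObX V n → ObX W m}
      {r₁ r₂ : ∀ {a b : ObX V n}, HomX Δ a b → Fml W (E.ar (o a) (o b))},
      GrEquiv Γ o r₁ r₂ → Deriv E Γ (φ.star (RAsg.mk o r₁)) →
      Deriv E Γ (φ.star (RAsg.mk o r₂)) := by
  induction φ with
  | eq f g =>
    exact fun h hfg => star_eq_intro fun E' Γ' w hw y hy =>
      h.gph g hw y (star_eq_elim hfg hw (h.symm.gph f hw y hy))
  | top => exact fun _ h => h
  | bot => exact fun _ h => h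
  | and φ ψ h₁ h₂ => exact fun I h => .andI (h₁ I (.andE₁ h)) (h₂ I (.andE₂ h))
  | or φ ψ h₁ h₂ =>
    exact fun I h => .orE h
      (.orI₁ (h₁ (I.mono (Set.subset_insert _ _)) (.hyp (Set.mem_insert _ _))))
      (.orI₂ (h₂ (I.mono (Set.subset_insert _ _)) (.hyp (Set.mem_insert _ _))))
  | imp φ ψ h₁ h₂ =>
    exact fun I h => .impI (h₂ (I.mono (Set.subset_insert _ _)) (.impE
      (h.mono (Set.subset_insert _ _))
      (h₁ (I.mono (Set.subset_insert _ _)).symm (.hyp (Set.mem_insert _ _)))))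
  | allOb φ ih => exact fun I h => .allObI (ih I.liftOb h.allOb_generic)
  | exOb φ ih => exact fun I h => h.exOb_congr fun Γ' hΓ h' => ih (I.liftOb.mono hΓ) h'
  | allAr a b φ ih => exact fun I h => .allArI (ih (I.liftAr a b) h.allAr_generic)
  | exAr a b φ ih => exact fun I h => h.exAr_congr fun Γ' hΓ h' => ih ((I.liftAr a b).mono hΓ) h'

namespace RAsg

theorem ofAsg_liftOb (σ : CtxAsg Δ E) : (ofAsg σ).liftOb = ofAsg (CtxAsg.liftOb σ) := by
  refine ext' ?_ ?_
  · rintro (_ | a) <;> rfl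
  · rintro _ _ ⟨h⟩
    exact heq_of_eq (eqNew_liftAr (σ.ar h) (CtxAsg.wkOb E))

theorem ofAsg_liftAr (σ : CtxAsg Δ E) (a b : ObX V n) :
    (ofAsg σ).liftAr a b = ofAsg (CtxAsg.liftAr σ a b) := by
  refine ext' (fun _ => rfl) ?_
  rintro _ _ (h | _)
  · exact heq_of_eq (eqNew_liftAr (σ.ar h) (CtxAsg.wkAr E (σ.ob a) (σ.ob b)))
  · exact HEq.rfl

/-- Along an assignment, the graph of a term is the graph of the substituted term. -/
theorem gph_ofAsg (σ : CtxAsg Δ E) {a b : ObX V n} (t : Tm (HomX Δ) a b) :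
    ∀ {k : ℕ} {E' : Tel W k} {Γ' : Set (Fml W E')} {w : CtxAsg E E'}
      (y : Tm (HomX E') (w.ob (σ.ob a)) (w.ob (σ.ob b))),
        Deriv E' Γ' (((ofAsg σ).gph t).subst (CtxAsg.consAr w y)) ↔
        Deriv E' Γ' (.eq y ((t.subst σ).subst w)) := by
  induction t with
  | sym g => exact fun y => iff_of_eq (congrArg _ (eqNew_consAr _ _ _))
  | id a => exact fun y => iff_of_eq (congrArg _ (eqNew_consAr _ _ _))
  | comp g f ihg ihf =>
    intro k E' Γ' w y
    constructor
    · intro hy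
      refine compGph_elim hy fun E₁ Γ₁ w₁ hw₁ s t hs ht hst => ?_
      have h := Deriv.eqTrans hst (.eqComp ((ihf (w := Asg.comp w w₁) s).1 hs)
        ((ihg (w := Asg.comp w w₁) t).1 ht))
      exact h.of_eq (congrArg (Fml.eq (y.subst w₁))
        (congrArg₂ Tm.comp (Tm.subst_subst (g.subst σ) w w₁).symm
          (Tm.subst_subst (f.subst σ) w w₁).symm))
    · intro hy
      exact compGph_intro _ _ ((ihf _).2 (.eqRefl _)) ((ihg _).2 (.eqRefl _)) hy

end RAsg

/-- Along an assignment, the translation agrees with substitution. -/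
theorem star_ofAsg (φ : Fml V Δ) :
    ∀ {m : ℕ} {E : Tel W m} {Γ : Set (Fml W E)} (σ : CtxAsg Δ E),
      Deriv E Γ (φ.star (RAsg.ofAsg σ)) ↔ Deriv E Γ (φ.subst σ) := by
  induction φ with
  | eq f g =>
    intro m E Γ σ
    constructor
    · intro h
      have h₁ := star_eq_elim h Ext.refl (y := f.subst σ) ((RAsg.gph_ofAsg σ f _).2
        ((Deriv.eqRefl _).of_eq (congrArg (Fml.eq (f.subst σ)) (Tm.subst_id _).symm)))
      exact ((RAsg.gph_ofAsg σ g _).1 h₁).of_eq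
        (congrArg (Fml.eq (f.subst σ)) (Tm.subst_id (g.subst σ)))
    · intro h
      refine star_eq_intro fun E' Γ' w hw y hy => (RAsg.gph_ofAsg σ g _).2 ?_
      exact .eqTrans ((RAsg.gph_ofAsg σ f _).1 hy) (h.subst hw)
  | top => exact fun _ => Iff.rfl
  | bot => exact fun _ => Iff.rfl
  | and φ ψ h₁ h₂ =>
    exact fun σ => ⟨fun h => .andI ((h₁ σ).1 (.andE₁ h)) ((h₂ σ).1 (.andE₂ h)),
      fun h => .andI ((h₁ σ).2 (.andE₁ h)) ((h₂ σ).2 (.andE₂ h))⟩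
  | or φ ψ h₁ h₂ =>
    exact fun σ => ⟨
      fun h => .orE h (.orI₁ ((h₁ σ).1 (.hyp (Set.mem_insert _ _))))
        (.orI₂ ((h₂ σ).1 (.hyp (Set.mem_insert _ _)))),
      fun h => .orE h (.orI₁ ((h₁ σ).2 (.hyp (Set.mem_insert _ _))))
        (.orI₂ ((h₂ σ).2 (.hyp (Set.mem_insert _ _))))⟩
  | imp φ ψ h₁ h₂ =>
    exact fun σ => ⟨
      fun h => .impI ((h₂ σ).1 (.impE (h.mono (Set.subset_insert _ _))
        ((h₁ σ).2 (.hyp (Set.mem_insert _ _))))),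
      fun h => .impI ((h₂ σ).2 (.impE (h.mono (Set.subset_insert _ _))
        ((h₁ σ).1 (.hyp (Set.mem_insert _ _)))))⟩
  | allOb φ ih =>
    intro m E Γ σ
    have e := congrArg φ.star (RAsg.ofAsg_liftOb σ)
    exact ⟨fun h => .allObI ((ih _).1 ((Deriv.allOb_generic h).of_eq e)),
      fun h => .allObI (((ih _).2 (Deriv.allOb_generic h)).of_eq e.symm)⟩
  | exOb φ ih =>
    intro m E Γ σ
    have e := congrArg φ.star (RAsg.ofAsg_liftOb σ)
    exact ⟨fun h => Deriv.exOb_congr h fun Γ' _ h' => (ih _).1 (h'.of_eq e),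
      fun h => Deriv.exOb_congr h fun Γ' _ h' => ((ih _).2 h').of_eq e.symm⟩
  | allAr a b φ ih =>
    intro m E Γ σ
    have e := congrArg φ.star (RAsg.ofAsg_liftAr σ a b)
    exact ⟨fun h => .allArI ((ih _).1 ((Deriv.allAr_generic h).of_eq e)),
      fun h => .allArI (((ih _).2 (Deriv.allAr_generic h)).of_eq e.symm)⟩
  | exAr a b φ ih =>
    intro m E Γ σ
    have e := congrArg φ.star (RAsg.ofAsg_liftAr σ a b)
    exact ⟨fun h => Deriv.exAr_congr h fun Γ' _ h' => (ih _).1 (h'.of_eq e),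
      fun h => Deriv.exAr_congr h fun Γ' _ h' => ((ih _).2 h').of_eq e.symm⟩

end StarLemmas

/-! ### Soundness of the translation -/

section Soundness

variable {V : Voc.{u}} {W : Voc.{v}} {n m : ℕ}

/-- A relational assignment all of whose graphs are functional under the hypotheses `Γ`. -/
def RAsg.IsFunctional {Δ : Tel V n} {E : Tel W m} (ρ : RAsg Δ E) (Γ : Set (Fml W E)) : Prop :=
  ∀ (a b : ObX V n) (h : HomX Δ a b), Functional Γ (ρ.gr h)

namespace RAsg.IsFunctional

variable {Δ : Tel V n} {E : Tel W m} {ρ : RAsg Δ E} {Γ : Set (Fml W E)}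

theorem subst (hρ : ρ.IsFunctional Γ) {U : Voc.{w}} {k : ℕ} {E' : Tel U k} {Γ' : Set (Fml U E')}
    {θ : CtxAsg E E'} (hθ : Ext Γ Γ' θ) : (ρ.subst θ).IsFunctional Γ' :=
  fun a b h => (hρ a b h).subst hθ

theorem mono (hρ : ρ.IsFunctional Γ) {Γ' : Set (Fml W E)} (hΓ : Γ ⊆ Γ') :
    ρ.IsFunctional Γ' := fun a b h => (hρ a b h).mono hΓ

theorem gph (hρ : ρ.IsFunctional Γ) {a b : ObX V n} (t : Tm (HomX Δ) a b) :
    Functional Γ (ρ.gph t) := by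
  induction t with
  | sym h => exact hρ _ _ h
  | id a => exact .eqNew _
  | comp g f ihg ihf => exact ihf.compGph ihg

theorem liftOb (hρ : ρ.IsFunctional Γ) : ρ.liftOb.IsFunctional (Fml.wkOb '' Γ) := by
  rintro _ _ ⟨h⟩
  exact hρ.subst Ext.wkOb _ _ h

theorem liftAr (hρ : ρ.IsFunctional Γ) (a b : ObX V n) :
    (ρ.liftAr a b).IsFunctional (Fml.wkAr (ρ.ob a) (ρ.ob b) '' Γ) := by
  rintro _ _ (h | _)
  · exact hρ.subst (Ext.wkAr _ _) _ _ h
  · exact .eqNew _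

theorem precomp (hρ : ρ.IsFunctional Γ) {U : Voc.{w}} {k : ℕ} {Δ' : Tel U k}
    (σ : CtxAsg Δ' Δ) : (RAsg.precomp σ ρ).IsFunctional Γ :=
  fun _ _ h => hρ.gph (σ.ar h)

end RAsg.IsFunctional

/-- A functional graph that holds of `t` is equivalent to the graph of `t`. -/
theorem Functional.iff_eqNew {E : Tel W m} {Γ : Set (Fml W E)} {a b : ObX W m}
    {G : Fml W (E.ar a b)} (hG : Functional Γ G) {t : Tm (HomX E) a b}
    (ht : Deriv E Γ (G.instAr t)) {k : ℕ} {E' : Tel W k} {Γ' : Set (Fml W E')} {w : CtxAsg E E'}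
    (hw : Ext Γ Γ' w) (y : Tm (HomX E') (w.ob a) (w.ob b)) :
    Deriv E' Γ' (G.subst (CtxAsg.consAr w y)) ↔
      Deriv E' Γ' ((CatTheory.eqNew t).subst (CtxAsg.consAr w y)) := by
  have ht' : Deriv E' Γ' (G.subst (CtxAsg.consAr w (t.subst w))) :=
    (ht.subst hw).of_eq (Fml.instAr_subst G t w)
  constructor
  · intro hy
    exact (hG.unique E' Γ' w hw y _ hy ht').of_eq (eqNew_consAr t w y).symm
  · intro hy
    exact ht'.replace (.eqSymm (Deriv.of_eq hy (eqNew_consAr t w y)))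

namespace RAsg

theorem ofAsg_subst {U : Voc.{w}} {k : ℕ} {Δ : Tel V n} {E : Tel W m} {E' : Tel U k}
    (σ : CtxAsg Δ E) (θ : CtxAsg E E') : (ofAsg σ).subst θ = ofAsg (Asg.comp σ θ) :=
  ext' (fun _ => rfl) fun h => heq_of_eq (eqNew_liftAr (σ.ar h) θ)

theorem ofAsg_consAr {Δ : Tel V n} {E : Tel W m} (σ : CtxAsg Δ E) {a b : ObX V n}
    (t : Tm (HomX E) (σ.ob a) (σ.ob b)) :
    (ofAsg σ).consAr (a := a) (b := b) (eqNew t) = ofAsg (CtxAsg.consAr σ t) := by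
  refine ext' (fun _ => rfl) ?_
  rintro _ _ (h | _) <;> exact HEq.rfl

variable {Δ : Tel V n} {E : Tel W m} {ρ : RAsg Δ E} {Γ : Set (Fml W E)}

theorem liftOb_consOb (ρ : RAsg Δ E) (c : ObX W m) :
    ρ.liftOb.subst (CtxAsg.consOb (CtxAsg.id E) c) = ρ.consOb c :=
  (consOb_subst _ _ _).trans (congrArg (fun τ : RAsg Δ E => τ.consOb c)
    ((subst_subst ρ (CtxAsg.wkOb E) _).trans ρ.subst_id))

/-- An arrow-term whose graph holds of `t` may be replaced by `t` in a translation. -/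
theorem star_consAr {a b : ObX V n} {φ : Fml V (Δ.ar a b)} {G : Fml W (E.ar (ρ.ob a) (ρ.ob b))}
    (hG : Functional Γ G) {t : Tm (HomX E) (ρ.ob a) (ρ.ob b)} (ht : Deriv E Γ (G.instAr t)) :
    Deriv E Γ (φ.star (ρ.consAr G)) ↔ Deriv E Γ (φ.star (ρ.consAr (eqNew t))) := by
  have key : GrEquiv (Δ := Δ.ar a b) Γ ρ.ob (ρ.consAr G).gr (ρ.consAr (eqNew t)).gr := by
    rintro _ _ (h | _) k E' Γ' w hw y
    · exact Iff.rfl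
    · exact hG.iff_eqNew ht hw y
  exact ⟨GrEquiv.star φ key, GrEquiv.star φ key.symm⟩

theorem liftAr_consAr (ρ : RAsg Δ E) {a b : ObX V n} (t : Tm (HomX E) (ρ.ob a) (ρ.ob b)) :
    (ρ.liftAr a b).subst (CtxAsg.consAr (CtxAsg.id E) t) = ρ.consAr (eqNew t) := by
  refine (consAr_subst _ _ _).trans (consAr_congr (a := a) (b := b)
    ((subst_subst ρ (CtxAsg.wkAr E (ρ.ob a) (ρ.ob b)) (CtxAsg.consAr (CtxAsg.id E) t)).trans
      ρ.subst_id) (heq_of_eq ?_))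
  exact eqNew_liftAr (E := E.ar (ρ.ob a) (ρ.ob b)) (a := ρ.ob a) (b := ρ.ob b) (.sym AddAr.new)
    (CtxAsg.consAr (CtxAsg.id E) t)

end RAsg

/-- Soundness of the translation along functional relational assignments. Totality of the graphs
gives the values needed to instantiate arrow quantifiers at terms; single-valuedness makes the
translated equality symmetric. -/
theorem Deriv.star {Δ : Tel V n} {Γ : Set (Fml V Δ)} {φ : Fml V Δ} (h : Deriv Δ Γ φ) :
    ∀ {m : ℕ} {E : Tel W m} {Γ' : Set (Fml W E)} {ρ : RAsg Δ E}, ρ.IsFunctional Γ' →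
      (∀ γ ∈ Γ, Deriv E Γ' (γ.star ρ)) → Deriv E Γ' (φ.star ρ) := by
  have ins : ∀ {n m : ℕ} {Δ : Tel V n} {E : Tel W m} {Γ : Set (Fml V Δ)} {Γ' : Set (Fml W E)}
      {ρ : RAsg Δ E} (φ : Fml V Δ), (∀ γ ∈ Γ, Deriv E Γ' (γ.star ρ)) →
      ∀ γ ∈ insert φ Γ, Deriv E (insert (φ.star ρ) Γ') (γ.star ρ) := by
    rintro n m Δ E Γ Γ' ρ φ H γ (rfl | hγ)
    · exact .hyp (Set.mem_insert _ _)
    · exact (H γ hγ).mono (Set.subset_insert _ _)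
  have wO : ∀ {n m : ℕ} {Δ : Tel V n} {E : Tel W m} {Γ : Set (Fml V Δ)} {Γ' : Set (Fml W E)}
      {ρ : RAsg Δ E}, (∀ γ ∈ Γ, Deriv E Γ' (γ.star ρ)) →
      ∀ γ ∈ Fml.wkOb '' Γ, Deriv E.ob (Fml.wkOb '' Γ') (γ.star ρ.liftOb) := by
    rintro n m Δ E Γ Γ' ρ H _ ⟨γ, hγ, rfl⟩
    refine (H γ hγ).wkOb_image.of_eq ?_
    exact (Fml.star_subst γ ρ _).trans (Fml.subst_star γ (CtxAsg.wkOb Δ) ρ.liftOb).symm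
  have wA : ∀ {n m : ℕ} {Δ : Tel V n} {E : Tel W m} {Γ : Set (Fml V Δ)} {Γ' : Set (Fml W E)}
      {ρ : RAsg Δ E} (a b : ObX V n), (∀ γ ∈ Γ, Deriv E Γ' (γ.star ρ)) →
      ∀ γ ∈ Fml.wkAr a b '' Γ, Deriv (E.ar (ρ.ob a) (ρ.ob b))
        (Fml.wkAr (ρ.ob a) (ρ.ob b) '' Γ') (γ.star (ρ.liftAr a b)) := by
    rintro n m Δ E Γ Γ' ρ a b H _ ⟨γ, hγ, rfl⟩
    refine ((H γ hγ).wkAr_image _ _).of_eq ?_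
    exact (Fml.star_subst γ ρ _).trans
      (Fml.subst_star γ (CtxAsg.wkAr Δ a b) (ρ.liftAr a b)).symm
  -- Compatibility of the translation with instantiation: at an object, at a term of the source
  -- and at a term of the target.
  have eO : ∀ {n m : ℕ} {Δ : Tel V n} {E : Tel W m} (ρ : RAsg Δ E) (φ : Fml V Δ.ob)
      (c : ObX V n), (φ.instOb c).star ρ = (φ.star ρ.liftOb).instOb (ρ.ob c) := by
    intro n m Δ E ρ φ c
    refine (Fml.subst_star _ _ _).trans ?_
    refine Eq.trans ?_ (Fml.star_subst φ ρ.liftOb _).symm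
    exact congrArg φ.star ((RAsg.precomp_consOb _ _ _).trans (RAsg.liftOb_consOb _ _).symm)
  have eA : ∀ {n m : ℕ} {Δ : Tel V n} {E : Tel W m} (ρ : RAsg Δ E) {a b : ObX V n}
      (φ : Fml V (Δ.ar a b)) (t : Tm (HomX Δ) a b),
      (φ.instAr t).star ρ = φ.star (ρ.consAr (ρ.gph t)) := by
    intro n m Δ E ρ a b φ t
    exact (Fml.subst_star _ _ _).trans (congrArg φ.star (RAsg.precomp_consAr (CtxAsg.id Δ) t ρ))
  have eT : ∀ {n m : ℕ} {Δ : Tel V n} {E : Tel W m} (ρ : RAsg Δ E) {a b : ObX V n}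
      (φ : Fml V (Δ.ar a b)) (t : Tm (HomX E) (ρ.ob a) (ρ.ob b)),
      (φ.star (ρ.liftAr a b)).instAr t = φ.star (ρ.consAr (eqNew t)) := by
    intro n m Δ E ρ a b φ t
    exact (Fml.star_subst _ _ _).trans (congrArg φ.star (RAsg.liftAr_consAr ρ t))
  have eW : ∀ {n m k : ℕ} {Δ : Tel V n} {E : Tel W m} {E' : Tel W k} (ρ : RAsg Δ E)
      {a b : ObX V n} (φ : Fml V (Δ.ar a b)) (G : Fml W (E.ar (ρ.ob a) (ρ.ob b)))
      (w : CtxAsg E E'), (φ.star (ρ.consAr G)).subst w = φ.star ((ρ.subst w).consAr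
        (a := a) (b := b) (G.subst (CtxAsg.liftAr w (ρ.ob a) (ρ.ob b)))) := by
    intro n m k Δ E E' ρ a b φ G w
    exact (Fml.star_subst _ _ _).trans (congrArg φ.star (RAsg.consAr_subst ρ G w))
  induction h with
  | hyp h => exact fun hρ H => H _ h
  | topI => exact fun hρ H => .topI
  | botE _ ih => exact fun hρ H => .botE (ih hρ H)
  | andI _ _ ih₁ ih₂ => exact fun hρ H => .andI (ih₁ hρ H) (ih₂ hρ H)
  | andE₁ _ ih => exact fun hρ H => .andE₁ (ih hρ H)
  | andE₂ _ ih => exact fun hρ H => .andE₂ (ih hρ H)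
  | orI₁ _ ih => exact fun hρ H => .orI₁ (ih hρ H)
  | orI₂ _ ih => exact fun hρ H => .orI₂ (ih hρ H)
  | orE _ _ _ ih ih₁ ih₂ =>
    exact fun hρ H => .orE (ih hρ H) (ih₁ (hρ.mono (Set.subset_insert _ _)) (ins _ H))
      (ih₂ (hρ.mono (Set.subset_insert _ _)) (ins _ H))
  | impI _ ih => exact fun hρ H => .impI (ih (hρ.mono (Set.subset_insert _ _)) (ins _ H))
  | impE _ _ ih ih₁ => exact fun hρ H => .impE (ih hρ H) (ih₁ hρ H)
  | allObI _ ih => exact fun hρ H => .allObI (ih hρ.liftOb (wO H))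
  | allObE _ c ih => exact fun hρ H => (Deriv.allObE (ih hρ H) _).of_eq (eO _ _ c).symm
  | exObI c _ ih => exact fun hρ H => Deriv.exObI _ ((ih hρ H).of_eq (eO _ _ c))
  | @exObE _ _ _ φ ψ _ _ ih ih₁ =>
    intro m E Γ' ρ hρ H
    refine Deriv.exObE (ih hρ H) ?_
    refine (ih₁ (hρ.liftOb.mono (Set.subset_insert _ _)) (ins _ (wO H))).of_eq ?_
    exact (Fml.subst_star ψ (CtxAsg.wkOb _) ρ.liftOb).trans
      (Fml.star_subst ψ ρ (CtxAsg.wkOb E)).symm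
  | allArI _ ih => exact fun hρ H => .allArI (ih (hρ.liftAr _ _) (wA _ _ H))
  | @allArE _ _ _ a b φ _ t ih =>
    intro m E Γ' ρ hρ H
    refine Deriv.of_eq ?_ (eA ρ φ t).symm
    -- The term `t` of the source has a value `y` only at an extension.
    refine (hρ.gph t).elim Ext.refl fun E₁ Γ₁ w₁ hw₁ y hy => ?_
    refine Deriv.of_eq ?_ (eW ρ φ _ w₁).symm
    refine (RAsg.star_consAr (ρ := ρ.subst w₁) ((hρ.gph t).subst hw₁) (t := y)
      (hy.of_eq (Fml.liftAr_instAr (ρ.gph t) w₁ y).symm)).2 ?_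
    have h := ((ih hρ H).subst hw₁)
    have h' : Deriv E₁ Γ₁ ((Fml.allAr a b φ).star (ρ.subst w₁)) :=
      h.of_eq (Fml.star_subst (Fml.allAr a b φ) ρ w₁)
    exact (Deriv.allArE h' y).of_eq (eT (ρ.subst w₁) φ y)
  | @exArI _ _ _ a b φ t _ ih =>
    intro m E Γ' ρ hρ H
    refine (hρ.gph t).elim Ext.refl fun E₁ Γ₁ w₁ hw₁ y hy => ?_
    refine Deriv.of_eq ?_ (Fml.star_subst (Fml.exAr a b φ) ρ w₁).symm
    refine Deriv.exArI y (Deriv.of_eq ?_ (eT (ρ.subst w₁) φ y).symm)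
    refine (RAsg.star_consAr (ρ := ρ.subst w₁) ((hρ.gph t).subst hw₁) (t := y)
      (hy.of_eq (Fml.liftAr_instAr (ρ.gph t) w₁ y).symm)).1 ?_
    exact (((ih hρ H).of_eq (eA ρ φ t)).subst hw₁).of_eq (eW ρ φ _ w₁)
  | @exArE _ _ _ a b φ ψ _ _ ih ih₁ =>
    intro m E Γ' ρ hρ H
    refine Deriv.exArE (ih hρ H) ?_
    refine (ih₁ ((hρ.liftAr a b).mono (Set.subset_insert _ _)) (ins _ (wA a b H))).of_eq ?_
    exact (Fml.subst_star ψ (CtxAsg.wkAr _ a b) (ρ.liftAr a b)).trans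
      (Fml.star_subst ψ ρ (CtxAsg.wkAr E (ρ.ob a) (ρ.ob b))).symm
  | eqRefl f => exact fun hρ H => star_eq_intro fun E' Γ' w hw y hy => hy
  | @eqSymm _ _ _ _ _ f g _ ih =>
    intro m E Γ' ρ hρ H
    refine star_eq_intro fun E₁ Γ₁ w₁ hw₁ y hy => ?_
    refine (hρ.gph f).elim hw₁ fun E₂ Γ₂ w₂ hw₂ y' hy' => ?_
    refine Deriv.of_eq ?_ (Fml.consAr_subst _ _ _ _).symm
    refine Deriv.replace hy' ((hρ.gph g).unique E₂ Γ₂ _ (hw₁.trans hw₂) _ _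
      (star_eq_elim (ih hρ H) (hw₁.trans hw₂) hy')
      ((hy.subst hw₂).of_eq (Fml.consAr_subst _ _ _ _)))
  | eqTrans _ _ ih₁ ih₂ =>
    exact fun hρ H => star_eq_intro fun E' Γ' w hw y hy =>
      star_eq_elim (ih₂ hρ H) hw (star_eq_elim (ih₁ hρ H) hw hy)
  | eqComp _ _ ih₁ ih₂ =>
    intro m E Γ' ρ hρ H
    refine star_eq_intro fun E₁ Γ₁ w₁ hw₁ y hy => ?_
    refine compGph_elim hy fun E₂ Γ₂ w₂ hw₂ s t hs ht hst => ?_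
    refine Deriv.of_eq ?_ (Fml.consAr_subst _ _ _ _).symm
    exact compGph_intro s t (star_eq_elim (ih₁ hρ H) (hw₁.trans hw₂) hs)
      (star_eq_elim (ih₂ hρ H) (hw₁.trans hw₂) ht) hst
  | assoc f g h =>
    intro m E Γ' ρ hρ H
    refine star_eq_intro fun E₁ Γ₁ w₁ hw₁ y hy => ?_
    refine compGph_elim hy fun E₂ Γ₂ w₂ hw₂ s t hs ht hst => ?_
    refine Deriv.of_eq ?_ (Fml.consAr_subst _ _ _ _).symm
    refine compGph_elim hs fun E₃ Γ₃ w₃ hw₃ p q hp hq hpq => ?_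
    refine Deriv.of_eq ?_ (Fml.consAr_subst _ _ _ _).symm
    have ht' := (ht.subst hw₃).of_eq (Fml.consAr_subst _ _ _ _)
    refine compGph_intro p (.comp (t.subst w₃) q) hp
      (compGph_intro q (t.subst w₃) hq ht' (.eqRefl _)) ?_
    exact .eqTrans (hst.subst hw₃) (.eqTrans (.eqComp hpq (.eqRefl _)) (.assoc _ _ _))
  | idComp f =>
    intro m E Γ' ρ hρ H
    refine star_eq_intro fun E₁ Γ₁ w₁ hw₁ y hy => ?_
    exact compGph_intro y (.id _) hy ((Deriv.eqRefl _).of_eq (eqNew_consAr _ _ _).symm)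
      (.idComp y)
  | compId f =>
    intro m E Γ' ρ hρ H
    refine star_eq_intro fun E₁ Γ₁ w₁ hw₁ y hy => ?_
    exact compGph_intro (.id _) y ((Deriv.eqRefl _).of_eq (eqNew_consAr _ _ _).symm) hy
      (.compId y)

end Soundness

/-! ### Elimination of the defined arrow-constants -/

section Second

variable {T : Theory Pure.{0}}

/-- For a context with a single arrow-variable between constants, `∃!` amounts to functionality:
the isomorphism of contexts is an empty family, and its naturality square, with identities at the
constants, is the equality of the two arrows. -/
theorem functional_of_exUnique {V : Voc.{u}} {T : Theory V} {a b : V.O}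
    {P : Fml V (Tel.ar (V := V) Tel.nil a b)}
    (hP : T.Proves (exUnique (Tel.ar (V := V) Tel.nil a b) P)) :
    Functional (E := (Tel.nil : Tel V 0)) T (a := a) (b := b) P := by
  refine ⟨.andE₁ hP, fun E' Γ' w hw t t' ht ht' => ?_⟩
  have h₀ : Deriv E' Γ' (Fml.subst (exUnique (Tel.ar (V := V) Tel.nil a b) P) w) := hP.subst hw
  have h₁ := Deriv.allAr_elim (Deriv.allAr_elim (.andE₂ h₀) t) t'
  have h₂ := Deriv.impE h₁ (.andI (ht.of_eq ?_) (ht'.of_eq ?_))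
  · have h₃ : Deriv E' Γ' (.eq (.comp t' (.id _)) (.comp (.id _) t)) := .andE₂ (.andE₁ h₂)
    exact .eqTrans (.idComp _) (.eqTrans (.eqSymm h₃) (.eqSymm (.compId _)))
  · refine ((Fml.subst_subst _ _ _).trans (congrArg P.subst ?_)).symm
    exact CtxAsg.ext_ar rfl rfl HEq.rfl
  · refine ((Fml.subst_subst _ _ _).trans (congrArg P.subst ?_)).symm
    exact CtxAsg.ext_ar rfl rfl HEq.rfl

/-- The interpretation of the arrow-constants of the second extension by propositions of the
first: the constants of the first extension by their graphs, and a defined constant by its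
definition. -/
def elimConst (T : Theory Pure.{0}) :
    RAsg (Tel.nil : Tel (Voc2 T) 0) (Tel.nil : Tel (Voc1 T) 0) where
  ob a := a
  gr
    | .old h => eqNew (E := (Tel.nil : Tel (Voc1 T) 0)) (.sym h)
    | .const P _ => P

theorem elimConst_isFunctional : (elimConst T).IsFunctional (Theory1 T) := by
  rintro _ _ (h | ⟨P, hP⟩)
  · exact .eqNew _
  · exact functional_of_exUnique hP

/-- Theorems of the second extension translate to theorems of the first. The axiom of a defined
constant translates to its definition, applied to the unique arrow that satisfies it. -/
theorem Theory1_proves_star {φ : Sentence (Voc2 T)} (h : (Theory2 T).Proves φ) :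
    (Theory1 T).Proves (φ.star (elimConst T)) := by
  refine Deriv.star h elimConst_isFunctional ?_
  rintro _ (⟨ψ, hψ, rfl⟩ | ⟨a, b, P, hP, rfl⟩)
  · refine Deriv.of_eq ?_ (Fml.subst_star ψ (incl12 T) (elimConst T)).symm
    refine (star_ofAsg ψ (CtxAsg.id (Tel.nil : Tel (Voc1 T) 0))).2 ?_
    rw [Fml.subst_id]
    exact .hyp hψ
  · refine Deriv.of_eq ?_ ((Fml.subst_star P _ (elimConst T)).trans (congrArg P.star
      (RAsg.precomp_consAr (incl12 T) (a := a) (b := b) (.sym (Hom2.const P hP))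
        (elimConst T)))).symm
    have hF := functional_of_exUnique hP
    refine hF.elim Ext.refl fun E₁ Γ₁ w₁ hw₁ y hy => ?_
    refine Deriv.of_eq ?_ ((Fml.star_subst P _ w₁).trans (congrArg P.star
      (RAsg.consAr_subst (RAsg.ofAsg (CtxAsg.id (Tel.nil : Tel (Voc1 T) 0)))
        (a := a) (b := b) P w₁))).symm
    refine (RAsg.star_consAr (φ := P) (a := a) (b := b)
      (ρ := (RAsg.ofAsg (CtxAsg.id (Tel.nil : Tel (Voc1 T) 0))).subst w₁)
      (G := P.subst (CtxAsg.liftAr w₁ a b)) (hF.subst hw₁) (t := y)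
      (Deriv.of_eq hy (Fml.liftAr_instAr P w₁ y).symm)).2 ?_
    have e : ((RAsg.ofAsg (CtxAsg.id (Tel.nil : Tel (Voc1 T) 0))).subst w₁).consAr
        (a := a) (b := b) (eqNew y) = RAsg.ofAsg (CtxAsg.consAr w₁ y) :=
      (RAsg.consAr_congr (V := Voc1 T) (n := 0) (a := a) (b := b)
        (RAsg.ofAsg_subst (CtxAsg.id (Tel.nil : Tel (Voc1 T) 0)) w₁) HEq.rfl).trans
        (RAsg.ofAsg_consAr w₁ y)
    exact ((star_ofAsg P (CtxAsg.consAr w₁ y)).2 hy).of_eq (congrArg P.star e.symm)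

/-- Along a functional relational assignment with known values, the translation agrees with
substitution of the values. -/
theorem star_iff_subst {V : Voc.{u}} {W : Voc.{v}} {n m : ℕ} {Δ : Tel V n} {E : Tel W m}
    {Γ : Set (Fml W E)} {κ : RAsg Δ E} (hκ : κ.IsFunctional Γ)
    (c : ∀ {a b : ObX V n}, HomX Δ a b → Tm (HomX E) (κ.ob a) (κ.ob b))
    (hc : ∀ {a b : ObX V n} (h : HomX Δ a b), Deriv E Γ ((κ.gr h).instAr (c h))) (φ : Fml V Δ) :
    Deriv E Γ (φ.star κ) ↔ Deriv E Γ (φ.subst ⟨κ.ob, c⟩) := by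
  have key : GrEquiv Γ κ.ob κ.gr (fun h => eqNew (c h)) :=
    fun a b h k E' Γ' w hw y => (hκ a b h).iff_eqNew (hc h) hw y
  exact Iff.trans ⟨GrEquiv.star φ key, GrEquiv.star φ key.symm⟩ (star_ofAsg φ ⟨κ.ob, c⟩)

end Second

/-! ### Quantification over contexts -/

section PureContexts

variable {W : Voc.{v}} {n m k : ℕ}

/-- The pure language has no constants, so its empty context has only one interpretation. -/
theorem CtxAsg.eq_of_pure {E : Tel W m} (σ τ : CtxAsg (Tel.nil : Tel Pure.{u} 0) E) : σ = τ :=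
  Asg.ext' (fun a => PEmpty.elim a) fun {a} _ _ => PEmpty.elim a

/-- The assignment from the empty context of the pure language. -/
def CtxAsg.init (E : Tel W m) : CtxAsg (Tel.nil : Tel Pure.{u} 0) E where
  ob c := PEmpty.elim c
  ar {a _} _ := PEmpty.elim a

variable {Δ : Tel Pure.{u} n} {P : Fml Pure Δ} {E : Tel W m} {Γ : Set (Fml W E)}
  {σ₀ : CtxAsg (Tel.nil : Tel Pure.{u} 0) E}

theorem Deriv.exTel_elim (h : Deriv E Γ ((exTel Δ P).subst σ₀)) {χ : Fml W E}
    (H : ∀ {k : ℕ} (E' : Tel W k) (Γ' : Set (Fml W E')) (w : CtxAsg E E'), Ext Γ Γ' w →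
      ∀ σ : CtxAsg Δ E', Deriv E' Γ' (P.subst σ) → Deriv E' Γ' (χ.subst w)) : Deriv E Γ χ := by
  induction Δ with
  | nil => exact (H E Γ (CtxAsg.id E) Ext.refl σ₀ h).of_eq (Fml.subst_id χ)
  | ob Δ ih =>
    refine ih h fun E₁ Γ₁ w₁ hw₁ σ hσ => Deriv.exOb_elim hσ fun E₂ Γ₂ w₂ hw₂ c hc => ?_
    exact (H E₂ Γ₂ _ (hw₁.trans hw₂) _ hc).of_eq (Fml.subst_subst _ _ _).symm
  | ar Δ a b ih =>
    refine ih h fun E₁ Γ₁ w₁ hw₁ σ hσ => Deriv.exAr_elim hσ fun E₂ Γ₂ w₂ hw₂ c hc => ?_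
    exact (H E₂ Γ₂ _ (hw₁.trans hw₂) _ hc).of_eq (Fml.subst_subst _ _ _).symm

theorem Deriv.exTel_intro {σ : CtxAsg Δ E} (h : Deriv E Γ (P.subst σ)) :
    Deriv E Γ ((exTel Δ P).subst σ₀) := by
  induction Δ with
  | nil => exact h.of_eq (congrArg P.subst (CtxAsg.eq_of_pure _ _))
  | ob Δ ih =>
    obtain ⟨σ, c, rfl⟩ := CtxAsg.exists_consOb σ
    exact ih (Deriv.exOb_intro c h)
  | ar Δ a b ih =>
    obtain ⟨σ, t, rfl⟩ := CtxAsg.exists_consAr σ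
    exact ih (Deriv.exAr_intro t h)

theorem Deriv.allTel_elim (h : Deriv E Γ ((allTel Δ P).subst σ₀)) (σ : CtxAsg Δ E) :
    Deriv E Γ (P.subst σ) := by
  induction Δ with
  | nil => exact h.of_eq (congrArg P.subst (CtxAsg.eq_of_pure _ _))
  | ob Δ ih =>
    obtain ⟨σ, c, rfl⟩ := CtxAsg.exists_consOb σ
    exact Deriv.allOb_elim (ih h σ) c
  | ar Δ a b ih =>
    obtain ⟨σ, t, rfl⟩ := CtxAsg.exists_consAr σ
    exact Deriv.allAr_elim (ih h σ) t

theorem Deriv.allTel_intro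
    (H : ∀ {k : ℕ} (E' : Tel W k) (Γ' : Set (Fml W E')) (w : CtxAsg E E'), Ext Γ Γ' w →
      ∀ σ : CtxAsg Δ E', Deriv E' Γ' (P.subst σ)) : Deriv E Γ ((allTel Δ P).subst σ₀) := by
  induction Δ with
  | nil => exact H E Γ (CtxAsg.id E) Ext.refl σ₀
  | ob Δ ih =>
    exact ih (P := .allOb P) fun E₁ Γ₁ w₁ hw₁ σ => Deriv.allOb_intro fun E₂ Γ₂ w₂ hw₂ c =>
      H E₂ Γ₂ _ (hw₁.trans hw₂) _
  | ar Δ a b ih =>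
    exact ih (P := .allAr a b P) fun E₁ Γ₁ w₁ hw₁ σ => Deriv.allAr_intro fun E₂ Γ₂ w₂ hw₂ c =>
      H E₂ Γ₂ _ (hw₁.trans hw₂) _

/-- Assignments of two contexts to one context combine to an assignment of the concatenation. -/
theorem CtxAsg.exists_pair {Δ₁ : Tel Pure.{u} k} {Δ₂ : Tel Pure.{u} n} (σ₁ : CtxAsg Δ₁ E)
    (σ₂ : CtxAsg Δ₂ E) : ∃ θ : CtxAsg (Δ₁.append Δ₂) E,
      Asg.comp (asgL Δ₁ Δ₂) θ = σ₁ ∧ Asg.comp (asgR Δ₁ Δ₂) θ = σ₂ := by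
  induction Δ₂ with
  | nil => exact ⟨σ₁, Asg.ext' (fun _ => rfl) (fun _ => HEq.rfl), CtxAsg.eq_of_pure _ _⟩
  | ob Δ₂ ih =>
    obtain ⟨σ₂, c, rfl⟩ := CtxAsg.exists_consOb σ₂
    obtain ⟨θ, rfl, rfl⟩ := ih σ₂
    refine ⟨CtxAsg.consOb θ c, Asg.ext' (fun _ => rfl) (fun _ => HEq.rfl), ?_⟩
    refine Asg.ext' ?_ ?_
    · rintro (_ | a) <;> rfl
    · rintro _ _ ⟨h⟩
      exact HEq.rfl
  | ar Δ₂ a b ih =>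
    obtain ⟨σ₂, t, rfl⟩ := CtxAsg.exists_consAr σ₂
    obtain ⟨θ, rfl, rfl⟩ := ih σ₂
    refine ⟨CtxAsg.consAr θ t, Asg.ext' (fun _ => rfl) (fun _ => HEq.rfl), ?_⟩
    refine Asg.ext' (fun _ => rfl) ?_
    rintro _ _ (h | _) <;> exact HEq.rfl

end PureContexts

/-! ### Families of arrow-variables -/

section Families

variable {V : Voc.{u}} {W : Voc.{v}} {n m k : ℕ} {D : Tel V k} {E : Tel W m}
  {Γ : Set (Fml W E)}

/-- The values of `tauCons`. -/
def tauVal (σ : CtxAsg D E) : (n : ℕ) → (s₁ s₂ : ObX V n → ObX V k) →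
    (∀ A, Tm (HomX E) (σ.ob (s₁ A)) (σ.ob (s₂ A))) → {a b : ObX V k} →
    HomX (tauTel D n s₁ s₂) a b → Tm (HomX E) (σ.ob a) (σ.ob b)
  | 0, _, _, _, _, _, h => σ.ar h
  | n + 1, s₁, s₂, t, _, _, h =>
    match h with
    | .old h => tauVal σ n (fun A => s₁ (some A)) (fun A => s₂ (some A)) (fun A => t (some A)) h
    | .new => t none

/-- Extension of an assignment by a family of arrow-terms, one for each variable `τ_A`. -/
def tauCons (σ : CtxAsg D E) (n : ℕ) (s₁ s₂ : ObX V n → ObX V k)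
    (t : ∀ A, Tm (HomX E) (σ.ob (s₁ A)) (σ.ob (s₂ A))) : CtxAsg (tauTel D n s₁ s₂) E where
  ob := σ.ob
  ar h := tauVal σ n s₁ s₂ t h

/-- The extended assignment restricts to the given one. -/
theorem tauAsg_tauCons (σ : CtxAsg D E) (n : ℕ) (s₁ s₂ : ObX V n → ObX V k)
    (t : ∀ A, Tm (HomX E) (σ.ob (s₁ A)) (σ.ob (s₂ A))) :
    Asg.comp (tauAsg D n s₁ s₂) (tauCons σ n s₁ s₂ t) = σ := by
  refine Asg.ext' (fun _ => rfl) ?_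
  induction n with
  | zero => exact fun _ => HEq.rfl
  | succ n ih => exact fun {a b} h => ih _ _ (fun A => t (some A)) h

theorem comp_tauAsg_tauCons {U : Voc.{w}} {l : ℕ} {Θ : Tel U l} (ρ : CtxAsg Θ D)
    (σ : CtxAsg D E) (n : ℕ) (s₁ s₂ : ObX V n → ObX V k)
    (t : ∀ A, Tm (HomX E) (σ.ob (s₁ A)) (σ.ob (s₂ A))) :
    Asg.comp (Asg.comp ρ (tauAsg D n s₁ s₂)) (tauCons σ n s₁ s₂ t) = Asg.comp ρ σ :=
  (Asg.comp_assoc ρ (tauAsg D n s₁ s₂) (tauCons σ n s₁ s₂ t)).trans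
    (congrArg (Asg.comp ρ) (tauAsg_tauCons σ n s₁ s₂ t))

theorem Tm.subst_heq {σ σ' : CtxAsg D E} (h : σ = σ') {a b : ObX V k} (t : Tm (HomX D) a b) :
    HEq (t.subst σ) (t.subst σ') := by
  subst h; exact HEq.rfl

theorem Tm.subst_tauAsg_tauCons {a b : ObX V k} (r : Tm (HomX D) a b) (σ : CtxAsg D E) (n : ℕ)
    (s₁ s₂ : ObX V n → ObX V k) (t : ∀ A, Tm (HomX E) (σ.ob (s₁ A)) (σ.ob (s₂ A))) :
    (r.subst (tauAsg D n s₁ s₂)).subst (tauCons σ n s₁ s₂ t) = r.subst σ :=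
  (Tm.subst_subst r (tauAsg D n s₁ s₂) (tauCons σ n s₁ s₂ t)).trans
    (eq_of_heq (Tm.subst_heq (tauAsg_tauCons σ n s₁ s₂ t) r))

theorem consAr_tauCons (σ : CtxAsg D E) (n : ℕ) (s₁ s₂ : ObX V (n + 1) → ObX V k)
    (t : ∀ A, Tm (HomX E) (σ.ob (s₁ A)) (σ.ob (s₂ A))) :
    CtxAsg.consAr (tauCons σ n (fun A => s₁ (some A)) (fun A => s₂ (some A))
      (fun A => t (some A))) (a := s₁ none) (b := s₂ none) (t none)
      = tauCons σ (n + 1) s₁ s₂ t := by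
  refine Asg.ext' (fun _ => rfl) ?_
  rintro _ _ (h | _) <;> exact HEq.rfl

theorem tauCons_comp {U : Voc.{w}} {l : ℕ} {E' : Tel U l} (σ : CtxAsg D E) (n : ℕ)
    (s₁ s₂ : ObX V n → ObX V k) (t : ∀ A, Tm (HomX E) (σ.ob (s₁ A)) (σ.ob (s₂ A)))
    (w : CtxAsg E E') :
    Asg.comp (tauCons σ n s₁ s₂ t) w
      = tauCons (Asg.comp σ w) n s₁ s₂ (fun A => (t A).subst w) := by
  refine Asg.ext' (fun _ => rfl) ?_
  induction n with
  | zero => exact fun _ => HEq.rfl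
  | succ n ih =>
    rintro a b (h | _)
    · exact ih _ _ (fun A => t (some A)) h
    · exact HEq.rfl

theorem tauCons_congr {σ σ' : CtxAsg D E} (h : σ = σ') (n : ℕ) (s₁ s₂ : ObX V n → ObX V k)
    {t : ∀ A, Tm (HomX E) (σ.ob (s₁ A)) (σ.ob (s₂ A))}
    {t' : ∀ A, Tm (HomX E) (σ'.ob (s₁ A)) (σ'.ob (s₂ A))} (ht : ∀ A, HEq (t A) (t' A)) :
    tauCons σ n s₁ s₂ t = tauCons σ' n s₁ s₂ t' := by
  subst h
  exact congrArg _ (funext fun A => eq_of_heq (ht A))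

/-- One further value, chosen at a later stage, extends a family of values. -/
theorem consAr_tauCons_comp {U : Voc.{w}} {l l' : ℕ} {E' : Tel U l} {E'' : Tel U l'}
    (σ : CtxAsg D E) (w₁ : CtxAsg E E') (w₂ : CtxAsg E' E'') (n : ℕ)
    (s₁ s₂ : ObX V (n + 1) → ObX V k)
    (t : ∀ A, Tm (HomX E') (w₁.ob (σ.ob (s₁ (some A)))) (w₁.ob (σ.ob (s₂ (some A)))))
    (y : Tm (HomX E'') (w₂.ob (w₁.ob (σ.ob (s₁ none)))) (w₂.ob (w₁.ob (σ.ob (s₂ none))))) :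
    CtxAsg.consAr (Asg.comp (tauCons (Asg.comp σ w₁) n (fun A => s₁ (some A))
      (fun A => s₂ (some A)) t) w₂) (a := s₁ none) (b := s₂ none) y
      = tauCons (Asg.comp σ (Asg.comp w₁ w₂)) (n + 1) s₁ s₂
        (fun | none => y | some A => (t A).subst w₂) := by
  refine Eq.trans ?_ (consAr_tauCons (Asg.comp σ (Asg.comp w₁ w₂)) n s₁ s₂ _)
  refine CtxAsg.consAr_congr (a := s₁ none) (b := s₂ none) ((tauCons_comp (Asg.comp σ w₁) n
    (fun A => s₁ (some A)) (fun A => s₂ (some A)) t w₂).trans ?_) HEq.rfl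
  exact tauCons_congr (Asg.comp_assoc σ w₁ w₂) n _ _ fun _ => HEq.rfl

theorem tauCons_zero (σ : CtxAsg D E) (s₁ s₂ : ObX V 0 → ObX V k)
    (t : ∀ A, Tm (HomX E) (σ.ob (s₁ A)) (σ.ob (s₂ A))) : tauCons σ 0 s₁ s₂ t = σ :=
  Asg.ext' (fun _ => rfl) (fun _ => HEq.rfl)

theorem Deriv.allTau_elim (n : ℕ) (s₁ s₂ : ObX V n → ObX V k)
    {φ : Fml V (tauTel D n s₁ s₂)} {σ : CtxAsg D E}
    (h : Deriv E Γ ((allTau n s₁ s₂ φ).subst σ))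
    (t : ∀ A, Tm (HomX E) (σ.ob (s₁ A)) (σ.ob (s₂ A))) :
    Deriv E Γ (φ.subst (tauCons σ n s₁ s₂ t)) := by
  induction n with
  | zero => exact h.of_eq (congrArg φ.subst (tauCons_zero σ s₁ s₂ t).symm)
  | succ n ih =>
    exact (Deriv.allAr_elim (ih _ _ h fun A => t (some A)) (t none)).of_eq
      (congrArg φ.subst (consAr_tauCons σ n s₁ s₂ t))

theorem Deriv.exTau_intro (n : ℕ) (s₁ s₂ : ObX V n → ObX V k)
    {φ : Fml V (tauTel D n s₁ s₂)} {σ : CtxAsg D E}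
    (t : ∀ A, Tm (HomX E) (σ.ob (s₁ A)) (σ.ob (s₂ A)))
    (h : Deriv E Γ (φ.subst (tauCons σ n s₁ s₂ t))) :
    Deriv E Γ ((exTau n s₁ s₂ φ).subst σ) := by
  induction n with
  | zero => exact h.of_eq (congrArg φ.subst (tauCons_zero σ s₁ s₂ t))
  | succ n ih =>
    exact ih _ _ (fun A => t (some A)) (Deriv.exAr_intro (a := s₁ none) (b := s₂ none) (t none)
      (h.of_eq (congrArg φ.subst (consAr_tauCons σ n s₁ s₂ t).symm)))

end Families

section PureFamilies

variable {W : Voc.{v}} {n m k : ℕ} {D : Tel Pure.{u} k} {E : Tel W m} {Γ : Set (Fml W E)}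

/-- The variable `τ_A` takes the value `t A`. For constants `A` there would be an identity instead
of a variable, but the pure language has none. -/
theorem tauTm_tauCons (σ : CtxAsg D E) (n : ℕ) (s₁ s₂ : ObX Pure.{u} n → ObX Pure.{u} k)
    (hc : ∀ c : Pure.{u}.O, s₁ (constOb n c) = s₂ (constOb n c))
    (t : ∀ A, Tm (HomX E) (σ.ob (s₁ A)) (σ.ob (s₂ A))) (A : ObX Pure.{u} n) :
    (tauTm D n s₁ s₂ hc A).subst (tauCons σ n s₁ s₂ t) = t A := by
  induction n with
  | zero => exact PEmpty.elim A
  | succ n ih =>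
    rcases A with _ | A
    · rfl
    · refine (Tm.subst_subst _ _ _).trans ?_
      exact ih _ _ hc (fun A => t (some A)) A

theorem Deriv.allTau_intro (n : ℕ) (s₁ s₂ : ObX Pure.{u} n → ObX Pure.{u} k)
    {φ : Fml Pure (tauTel D n s₁ s₂)} {σ : CtxAsg D E}
    (H : ∀ {l : ℕ} (E' : Tel W l) (Γ' : Set (Fml W E')) (w : CtxAsg E E'), Ext Γ Γ' w →
      ∀ t : ∀ A, Tm (HomX E') (w.ob (σ.ob (s₁ A))) (w.ob (σ.ob (s₂ A))),
        Deriv E' Γ' (φ.subst (tauCons (Asg.comp σ w) n s₁ s₂ t))) :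
    Deriv E Γ ((allTau n s₁ s₂ φ).subst σ) := by
  induction n with
  | zero =>
    exact (H E Γ (CtxAsg.id E) Ext.refl (fun A => PEmpty.elim A)).of_eq
      (congrArg φ.subst ((tauCons_zero _ s₁ s₂ _).trans (CtxAsg.comp_id σ)))
  | succ n ih =>
    refine ih _ _ (φ := .allAr (s₁ none) (s₂ none) φ) fun E₁ Γ₁ w₁ hw₁ t => ?_
    refine Deriv.allAr_intro fun E₂ Γ₂ w₂ hw₂ y => ?_
    refine (H E₂ Γ₂ (Asg.comp w₁ w₂) (hw₁.trans hw₂)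
      (fun | none => y | some A => (t A).subst w₂)).of_eq (congrArg φ.subst ?_)
    exact (consAr_tauCons_comp σ w₁ w₂ n s₁ s₂ t y).symm

theorem Deriv.exTau_elim (n : ℕ) (s₁ s₂ : ObX Pure.{u} n → ObX Pure.{u} k)
    {φ : Fml Pure (tauTel D n s₁ s₂)} {σ : CtxAsg D E}
    (h : Deriv E Γ ((exTau n s₁ s₂ φ).subst σ)) {χ : Fml W E}
    (H : ∀ {l : ℕ} (E' : Tel W l) (Γ' : Set (Fml W E')) (w : CtxAsg E E'), Ext Γ Γ' w →
      ∀ t : ∀ A, Tm (HomX E') (w.ob (σ.ob (s₁ A))) (w.ob (σ.ob (s₂ A))),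
        Deriv E' Γ' (φ.subst (tauCons (Asg.comp σ w) n s₁ s₂ t)) → Deriv E' Γ' (χ.subst w)) :
    Deriv E Γ χ := by
  induction n with
  | zero =>
    exact (H E Γ (CtxAsg.id E) Ext.refl (fun A => PEmpty.elim A) (Deriv.of_eq h
      (congrArg φ.subst ((tauCons_zero _ s₁ s₂ _).trans (CtxAsg.comp_id σ)).symm))).of_eq
      (Fml.subst_id χ)
  | succ n ih =>
    refine ih _ _ h fun E₁ Γ₁ w₁ hw₁ t ht => ?_
    refine Deriv.exAr_elim ht fun E₂ Γ₂ w₂ hw₂ y hy => ?_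
    refine (H E₂ Γ₂ (Asg.comp w₁ w₂) (hw₁.trans hw₂)
      (fun | none => y | some A => (t A).subst w₂) (hy.of_eq (congrArg φ.subst ?_))).of_eq
      (Fml.subst_subst _ _ _).symm
    exact consAr_tauCons_comp σ w₁ w₂ n s₁ s₂ t y

end PureFamilies

/-! ### Context isomorphisms inside the theory -/

section Iso

variable {V : Voc.{u}} {W : Voc.{v}} {k m : ℕ} {D : Tel V k} {E : Tel W m} {Γ : Set (Fml W E)}
  {σ : CtxAsg D E} {a b : ObX V k}

/-- A two-sided inverse at the current stage proves invertibility. -/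
theorem isoTm_intro (t : Tm (HomX D) a b) (s : Tm (HomX E) (σ.ob b) (σ.ob a))
    (h₁ : (t.subst σ).arrow Γ ≫ s.arrow Γ = 𝟙 _) (h₂ : s.arrow Γ ≫ (t.subst σ).arrow Γ = 𝟙 _) :
    Deriv E Γ ((isoTm t).subst σ) := by
  have e := Tm.wkAr_subst_consAr t σ s
  refine Deriv.exAr_intro s (.andI ?_ ?_)
  · refine Deriv.of_eq (φ := .eq (.comp s (t.subst σ)) (.id (σ.ob a))) (arrow_eq_iff.1 h₁) ?_
    exact congrArg (fun t' => Fml.eq (Tm.comp s t') (Tm.id (σ.ob a))) e.symm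
  · refine Deriv.of_eq (φ := .eq (.comp (t.subst σ) s) (.id (σ.ob b))) (arrow_eq_iff.1 h₂) ?_
    exact congrArg (fun t' => Fml.eq (Tm.comp t' s) (Tm.id (σ.ob b))) e.symm

/-- An arrow-term that is provably invertible has an inverse at an extension. -/
theorem isoTm_elim {t : Tm (HomX D) a b} (h : Deriv E Γ ((isoTm t).subst σ)) {χ : Fml W E}
    (H : ∀ {l : ℕ} (E' : Tel W l) (Γ' : Set (Fml W E')) (w : CtxAsg E E'), Ext Γ Γ' w →
      ∀ s : Tm (HomX E') (w.ob (σ.ob b)) (w.ob (σ.ob a)),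
        ((t.subst σ).subst w).arrow Γ' ≫ s.arrow Γ' = 𝟙 _ →
        s.arrow Γ' ≫ ((t.subst σ).subst w).arrow Γ' = 𝟙 _ → Deriv E' Γ' (χ.subst w)) :
    Deriv E Γ χ := by
  refine Deriv.exAr_elim h fun E' Γ' w hw s hs => ?_
  have e : (t.subst (CtxAsg.wkAr D b a)).subst (CtxAsg.consAr (Asg.comp σ w) (a := b) (b := a) s)
      = (t.subst σ).subst w :=
    (Tm.wkAr_subst_consAr t (Asg.comp σ w) s).trans (Tm.subst_subst t σ w).symm
  refine H E' Γ' w hw s ((arrow_eq_iff (f := .comp s ((t.subst σ).subst w)) (g := .id _)).2 ?_)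
    ((arrow_eq_iff (f := .comp ((t.subst σ).subst w) s) (g := .id _)).2 ?_)
  · exact (Deriv.andE₁ hs).of_eq (congrArg (fun t' => Fml.eq (Tm.comp s t') (Tm.id _)) e)
  · exact (Deriv.andE₂ hs).of_eq (congrArg (fun t' => Fml.eq (Tm.comp t' s) (Tm.id _)) e)

end Iso

section PureIso

variable {W : Voc.{v}} {n k m : ℕ} {D : Tel Pure.{u} k} {E : Tel W m} {Γ : Set (Fml W E)}
  {σ : CtxAsg D E}

/-- A context isomorphism is a family of invertible arrows, natural in the arrow symbols. -/
theorem isoCtx_elim {Δ : Tel Pure.{u} n} {σ₁ σ₂ : CtxAsg Δ D}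
    {τ : ∀ A, Tm (HomX D) (σ₁.ob A) (σ₂.ob A)}
    (h : Deriv E Γ ((isoCtx Δ σ₁ σ₂ τ).subst σ)) :
    (∀ A, Deriv E Γ ((isoTm (τ A)).subst σ)) ∧ ∀ {a b : ObX Pure n} (f : HomX Δ a b),
      Deriv E Γ ((Fml.eq (.comp (σ₂.ar f) (τ a)) (.comp (τ b) (σ₁.ar f))).subst σ) := by
  induction Δ with
  | nil => exact ⟨fun A => PEmpty.elim A, fun {a} _ _ => PEmpty.elim a⟩
  | ob Δ ih =>
    obtain ⟨h₁, h₂⟩ := ih (.andE₁ h)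
    refine ⟨?_, ?_⟩
    · rintro (_ | A)
      · exact .andE₂ h
      · exact h₁ A
    · rintro _ _ ⟨f⟩
      exact h₂ f
  | ar Δ a b ih =>
    obtain ⟨h₁, h₂⟩ := ih (.andE₁ h)
    refine ⟨h₁, ?_⟩
    rintro _ _ (f | _)
    · exact h₂ f
    · exact .andE₂ h

theorem isoCtx_intro {Δ : Tel Pure.{u} n} {σ₁ σ₂ : CtxAsg Δ D}
    {τ : ∀ A, Tm (HomX D) (σ₁.ob A) (σ₂.ob A)}
    (h₁ : ∀ A, Deriv E Γ ((isoTm (τ A)).subst σ))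
    (h₂ : ∀ {a b : ObX Pure n} (f : HomX Δ a b),
      Deriv E Γ ((Fml.eq (.comp (σ₂.ar f) (τ a)) (.comp (τ b) (σ₁.ar f))).subst σ)) :
    Deriv E Γ ((isoCtx Δ σ₁ σ₂ τ).subst σ) := by
  induction Δ with
  | nil => exact .topI
  | ob Δ ih => exact .andI (ih (fun A => h₁ (some A)) fun f => h₂ (.old f)) (h₁ none)
  | ar Δ a b ih => exact .andI (ih h₁ fun f => h₂ (.old f)) (h₂ .new)

theorem eqTau_elim {s₁ s₂ : ObX Pure.{u} n → ObX Pure.{u} k}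
    {τ τ' : ∀ A, Tm (HomX D) (s₁ A) (s₂ A)} (h : Deriv E Γ ((eqTau n τ τ').subst σ))
    (A : ObX Pure.{u} n) : Deriv E Γ ((Fml.eq (τ A) (τ' A)).subst σ) := by
  induction n with
  | zero => exact PEmpty.elim A
  | succ n ih =>
    rcases A with _ | A
    · exact .andE₂ h
    · exact ih (Deriv.andE₁ h) A

theorem eqTau_intro {s₁ s₂ : ObX Pure.{u} n → ObX Pure.{u} k}
    {τ τ' : ∀ A, Tm (HomX D) (s₁ A) (s₂ A)}
    (h : ∀ A, Deriv E Γ ((Fml.eq (τ A) (τ' A)).subst σ)) :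
    Deriv E Γ ((eqTau n τ τ').subst σ) := by
  induction n with
  | zero => exact .topI
  | succ n ih => exact .andI (ih fun A => h (some A)) (h none)

/-- Inverses of finitely many isomorphisms may be chosen, at an extension. -/
theorem inverses_elim {s₁ s₂ : ObX Pure.{u} n → ObX Pure.{u} k}
    {τ : ∀ A, Tm (HomX D) (s₁ A) (s₂ A)} (h : ∀ A, Deriv E Γ ((isoTm (τ A)).subst σ))
    {χ : Fml W E}
    (H : ∀ {l : ℕ} (E' : Tel W l) (Γ' : Set (Fml W E')) (w : CtxAsg E E'), Ext Γ Γ' w →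
      ∀ v : ∀ A, Tm (HomX E') (w.ob (σ.ob (s₂ A))) (w.ob (σ.ob (s₁ A))),
        (∀ A, (((τ A).subst σ).subst w).arrow Γ' ≫ (v A).arrow Γ' = 𝟙 _) →
        (∀ A, (v A).arrow Γ' ≫ (((τ A).subst σ).subst w).arrow Γ' = 𝟙 _) →
        Deriv E' Γ' (χ.subst w)) :
    Deriv E Γ χ := by
  induction n with
  | zero =>
    exact (H E Γ (CtxAsg.id E) Ext.refl (fun A => PEmpty.elim A) (fun A => PEmpty.elim A)
      (fun A => PEmpty.elim A)).of_eq (Fml.subst_id χ)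
  | succ n ih =>
    refine ih (fun A => h (some A)) fun E₁ Γ₁ w₁ hw₁ v hv₁ hv₂ => ?_
    refine isoTm_elim (σ := Asg.comp σ w₁) ((h none).ext hw₁) fun E₂ Γ₂ w₂ hw₂ s hs₁ hs₂ => ?_
    refine Deriv.of_eq ?_ (Fml.subst_subst χ w₁ w₂).symm
    have e : ∀ A, (((τ A).subst σ).subst w₁).subst w₂
        = ((τ A).subst σ).subst (Asg.comp w₁ w₂) := fun A => Tm.subst_subst _ w₁ w₂
    have e₀ : ((τ none).subst (Asg.comp σ w₁)).subst w₂
        = ((τ none).subst σ).subst (Asg.comp w₁ w₂) :=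
      (congrArg (Tm.subst w₂) (Tm.subst_subst (τ none) σ w₁).symm).trans (e none)
    refine H E₂ Γ₂ (Asg.comp w₁ w₂) (hw₁.trans hw₂)
      (fun | none => s | some A => (v A).subst w₂) ?_ ?_
    · rintro (_ | A)
      · exact (congrArg (fun t => Tm.arrow Γ₂ t ≫ s.arrow Γ₂) e₀.symm).trans hs₁
      · exact (congrArg (fun t => Tm.arrow Γ₂ t ≫ ((v A).subst w₂).arrow Γ₂)
          (e (some A)).symm).trans (arrow_eq_subst (g := Tm.id _) (f := Tm.comp (v A) _)
            (hv₁ A) hw₂)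
    · rintro (_ | A)
      · exact (congrArg (fun t => s.arrow Γ₂ ≫ Tm.arrow Γ₂ t) e₀.symm).trans hs₂
      · exact (congrArg (fun t => ((v A).subst w₂).arrow Γ₂ ≫ Tm.arrow Γ₂ t)
          (e (some A)).symm).trans (arrow_eq_subst (g := Tm.id _) (f := Tm.comp _ (v A))
            (hv₂ A) hw₂)

/-- A provable context isomorphism yields one with chosen inverses, at an extension. -/
theorem isoCtx_elim_iso {Δ : Tel Pure.{u} n} {σ₁ σ₂ : CtxAsg Δ D}
    {τ : ∀ A, Tm (HomX D) (σ₁.ob A) (σ₂.ob A)} {ρ₁ ρ₂ : CtxAsg Δ E}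
    {t : ∀ A, Tm (HomX E) (ρ₁.ob A) (ρ₂.ob A)}
    (h : Deriv E Γ ((isoCtx Δ σ₁ σ₂ τ).subst σ)) (e₁ : Asg.comp σ₁ σ = ρ₁)
    (e₂ : Asg.comp σ₂ σ = ρ₂) (ht : ∀ A, HEq ((τ A).subst σ) (t A)) {χ : Fml W E}
    (H : ∀ {l : ℕ} (E' : Tel W l) (Γ' : Set (Fml W E')) (w : CtxAsg E E'), Ext Γ Γ' w →
      ∀ I : CtxIso Γ' (Asg.comp ρ₁ w) (Asg.comp ρ₂ w), (∀ A, I.hom A = (t A).subst w) →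
        Deriv E' Γ' (χ.subst w)) :
    Deriv E Γ χ := by
  subst e₁ e₂
  obtain rfl : (fun A => (τ A).subst σ) = t := funext fun A => eq_of_heq (ht A)
  obtain ⟨h₁, h₂⟩ := isoCtx_elim h
  refine inverses_elim h₁ fun E' Γ' w hw v hv₁ hv₂ => H E' Γ' w hw
    ⟨fun A => ((τ A).subst σ).subst w, v, hv₁, hv₂, fun {a b} f => ?_⟩ fun _ => rfl
  exact (arrow_eq_iff (f := .comp (((σ₂.ar f).subst σ).subst w) (((τ a).subst σ).subst w))
    (g := .comp (((τ b).subst σ).subst w) (((σ₁.ar f).subst σ).subst w))).2 ((h₂ f).subst hw)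

/-- Conversely, an isomorphism with chosen inverses proves that its components form a context
isomorphism. -/
theorem isoCtx_intro_iso {Δ : Tel Pure.{u} n} {σ₁ σ₂ : CtxAsg Δ D}
    {τ : ∀ A, Tm (HomX D) (σ₁.ob A) (σ₂.ob A)} {ρ₁ ρ₂ : CtxAsg Δ E}
    (I : CtxIso Γ ρ₁ ρ₂) (e₁ : Asg.comp σ₁ σ = ρ₁) (e₂ : Asg.comp σ₂ σ = ρ₂)
    (ht : ∀ A, HEq ((τ A).subst σ) (I.hom A)) : Deriv E Γ ((isoCtx Δ σ₁ σ₂ τ).subst σ) := by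
  subst e₁ e₂
  have hτ : ∀ A, (τ A).subst σ = I.hom A := fun A => eq_of_heq (ht A)
  refine isoCtx_intro (fun A => isoTm_intro (τ A) (I.inv A) ?_ ?_) fun {a b} f => ?_
  · exact (congrArg (fun t => Tm.arrow Γ t ≫ (I.inv A).arrow Γ) (hτ A)).trans (I.hom_inv A)
  · exact (congrArg (fun t => (I.inv A).arrow Γ ≫ Tm.arrow Γ t) (hτ A)).trans (I.inv_hom A)
  · have h := (arrow_eq_iff (f := .comp ((σ₂.ar f).subst σ) (I.hom a))
      (g := .comp (I.hom b) ((σ₁.ar f).subst σ))).1 (I.naturality f)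
    exact h.of_eq (congrArg₂ (fun t t' => Fml.eq (Tm.comp ((σ₂.ar f).subst σ) t)
      (Tm.comp t' ((σ₁.ar f).subst σ))) (hτ a).symm (hτ b).symm)

/-- The action of an isomorphism on assignments into its context. -/
def CtxIso.precomp {U : Voc.{x}} {Δ : Tel U k} {V : Voc.{w}} {Δ' : Tel V n} {E : Tel W m}
    {Γ : Set (Fml W E)} {σ₁ σ₂ : CtxAsg Δ' E} (θ : CtxAsg Δ Δ') (I : CtxIso Γ σ₁ σ₂) :
    CtxIso Γ (Asg.comp θ σ₁) (Asg.comp θ σ₂) where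
  hom A := I.hom (θ.ob A)
  inv A := I.inv (θ.ob A)
  hom_inv A := I.hom_inv (θ.ob A)
  inv_hom A := I.inv_hom (θ.ob A)
  naturality h := I.naturality_tm (θ.ar h)

end PureIso

/-! ### Unique descriptions -/

section Descriptions

/-- `Q` describes the context `Δ` uniquely in `T`: there is a `Δ` with `Q`, and any two such, in
any context that extends `T`, are isomorphic in exactly one way. The existence of an isomorphism
is stated as an elimination rule, as it may be available only at an extension. This is the same as
provability of `∃! Δ, Q`, by `IsDescr.of_exUnique` and `IsDescr.exUnique`. -/
structure IsDescr (T : Theory Pure.{u}) {n : ℕ} (Δ : Tel Pure.{u} n) (Q : Fml Pure Δ) : Prop where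
  exists_tel : T.Proves (exTel Δ Q)
  iso : ∀ {m : ℕ} {E : Tel Pure.{u} m} {Γ : Set (Fml Pure E)} (σ₁ σ₂ : CtxAsg Δ E),
    Ext T Γ (CtxAsg.init E) → Deriv E Γ (Q.subst σ₁) → Deriv E Γ (Q.subst σ₂) →
    ∀ {χ : Fml Pure E}, (∀ {l : ℕ} (E' : Tel Pure.{u} l) (Γ' : Set (Fml Pure E'))
      (w : CtxAsg E E'), Ext Γ Γ' w → CtxIso Γ' (Asg.comp σ₁ w) (Asg.comp σ₂ w) →
        Deriv E' Γ' (χ.subst w)) → Deriv E Γ χ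
  unique : ∀ {m : ℕ} {E : Tel Pure.{u} m} {Γ : Set (Fml Pure E)} {σ₁ σ₂ : CtxAsg Δ E},
    Ext T Γ (CtxAsg.init E) → Deriv E Γ (Q.subst σ₁) → Deriv E Γ (Q.subst σ₂) →
    ∀ (I J : CtxIso Γ σ₁ σ₂) (A : ObX Pure.{u} n), (I.hom A).arrow Γ = (J.hom A).arrow Γ

variable {T : Theory Pure.{u}} {n : ℕ} {Δ : Tel Pure.{u} n} {Q : Fml Pure Δ}

theorem Ext.trans_init {m k : ℕ} {E : Tel Pure.{u} m} {E' : Tel Pure.{u} k}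
    {Γ : Set (Fml Pure E)} {Γ' : Set (Fml Pure E')} {w : CtxAsg E E'}
    (h : Ext T Γ (CtxAsg.init E)) (hw : Ext Γ Γ' w) : Ext T Γ' (CtxAsg.init E') := by
  have := h.trans hw
  rwa [CtxAsg.eq_of_pure (Asg.comp (CtxAsg.init E) w) (CtxAsg.init E')] at this

/-- A context for which `∃!` is provable is uniquely described. -/
theorem IsDescr.of_exUnique (h : T.Proves (exUnique Δ Q)) : IsDescr T Δ Q := by
  have key : ∀ {m : ℕ} {E : Tel Pure.{u} m} {Γ : Set (Fml Pure E)}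
      (θ : CtxAsg (Δ.append Δ) E), Ext T Γ (CtxAsg.init E) →
      Deriv E Γ (Q.subst (Asg.comp (asgL Δ Δ) θ)) → Deriv E Γ (Q.subst (Asg.comp (asgR Δ Δ) θ)) →
      Deriv E Γ ((uniqueIso Δ).subst θ) := by
    intro m E Γ θ hT h₁ h₂
    have h₀ : Deriv E Γ ((exUnique Δ Q).subst (CtxAsg.init E)) := h.subst hT
    exact Deriv.impE (Deriv.allTel_elim (.andE₂ h₀) θ) (.andI
      (h₁.of_eq (Fml.subst_subst _ _ _).symm) (h₂.of_eq (Fml.subst_subst _ _ _).symm))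
  refine ⟨.andE₁ h, ?_, ?_⟩
  · intro m E Γ σ₁ σ₂ hT h₁ h₂ χ H
    obtain ⟨θ, rfl, rfl⟩ := CtxAsg.exists_pair σ₁ σ₂
    refine Deriv.exTau_elim _ _ _ (.andE₁ (key θ hT h₁ h₂)) fun E₁ Γ₁ w₁ hw₁ t ht => ?_
    have e : ∀ s : CtxAsg Δ (Δ.append Δ),
        Asg.comp (Asg.comp s (tauAsg (Δ.append Δ) n (injL n) (injR n n)))
          (tauCons (V := Pure) (Asg.comp θ w₁) n (injL n) (injR n n) t)
          = Asg.comp (Asg.comp s θ) w₁ :=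
      fun s => (comp_tauAsg_tauCons s (Asg.comp θ w₁) n (injL n) (injR n n) t).trans
        (Asg.comp_assoc s θ w₁).symm
    refine isoCtx_elim_iso (ρ₁ := Asg.comp (Asg.comp (asgL Δ Δ) θ) w₁)
      (ρ₂ := Asg.comp (Asg.comp (asgR Δ Δ) θ) w₁) (t := t) ht (e _) (e _)
      (fun A => heq_of_eq (tauTm_tauCons (Asg.comp θ w₁) n (injL n) (injR n n) _ t A))
      fun E₂ Γ₂ w₂ hw₂ I _ => ?_
    refine Deriv.of_eq ?_ (Fml.subst_subst χ w₁ w₂).symm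
    exact H E₂ Γ₂ (Asg.comp w₁ w₂) (hw₁.trans hw₂)
      (Asg.comp_assoc (Asg.comp (asgL Δ Δ) θ) w₁ w₂ ▸
        Asg.comp_assoc (Asg.comp (asgR Δ Δ) θ) w₁ w₂ ▸ I)
  · intro m E Γ σ₁ σ₂ hT h₁ h₂ I J A
    obtain ⟨θ, rfl, rfl⟩ := CtxAsg.exists_pair σ₁ σ₂
    let tI : ∀ A, Tm (HomX E) (θ.ob (injL n A)) (θ.ob (injR n n A)) := I.hom
    let tJ : ∀ A, Tm (HomX E) (θ.ob (injL n A)) (θ.ob (injR n n A)) := J.hom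
    have h₃ := Deriv.allTau_elim _ _ _ (Deriv.allTau_elim _ _ _
      (.andE₂ (key θ hT h₁ h₂)) tI) tJ
    have e : ∀ s : CtxAsg Δ (Δ.append Δ),
        Asg.comp (Asg.comp (Asg.comp s (tauAsg (Δ.append Δ) n (injL n) (injR n n)))
          (tauAsg (tauTel (Δ.append Δ) n (injL n) (injR n n)) n (injL n) (injR n n)))
          (tauCons (tauCons θ n (injL n) (injR n n) tI) n (injL n) (injR n n) tJ)
          = Asg.comp s θ := fun s =>
      (comp_tauAsg_tauCons _ (tauCons θ n (injL n) (injR n n) tI) n (injL n) (injR n n) tJ).trans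
        (comp_tauAsg_tauCons s θ n (injL n) (injR n n) tI)
    have eI : ∀ hc A, ((tauTm (Δ.append Δ) n (injL n) (injR n n) hc A).subst
        (tauAsg (tauTel (Δ.append Δ) n (injL n) (injR n n)) n (injL n) (injR n n))).subst
        (tauCons (tauCons θ n (injL n) (injR n n) tI) n (injL n) (injR n n) tJ)
          = I.hom A := fun hc A =>
      (Tm.subst_tauAsg_tauCons _ (tauCons θ n (injL n) (injR n n) tI) n (injL n) (injR n n)
        tJ).trans (tauTm_tauCons θ n (injL n) (injR n n) hc tI A)
    have eJ : ∀ hc A, (tauTm (tauTel (Δ.append Δ) n (injL n) (injR n n)) n (injL n) (injR n n)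
        hc A).subst (tauCons (tauCons θ n (injL n) (injR n n) tI) n (injL n) (injR n n) tJ)
          = J.hom A := fun hc A =>
      tauTm_tauCons (tauCons θ n (injL n) (injR n n) tI) n (injL n) (injR n n) hc tJ A
    have h₄ := eqTau_elim (Deriv.impE h₃ (.andI
      (isoCtx_intro_iso I (e _) (e _) fun A => heq_of_eq (eI _ A))
      (isoCtx_intro_iso J (e _) (e _) fun A => heq_of_eq (eJ _ A)))) A
    exact arrow_eq_iff.2 (h₄.of_eq (congrArg₂ Fml.eq (eI _ A) (eJ _ A)))

/-- A uniquely described context is one for which `∃!` is provable. -/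
theorem IsDescr.exUnique (D : IsDescr T Δ Q) : T.Proves (exUnique Δ Q) := by
  refine .andI D.exists_tel ?_
  refine (Deriv.allTel_intro (σ₀ := CtxAsg.id (Tel.nil : Tel Pure.{u} 0))
    fun E Γ w₀ hw₀ θ => ?_).of_eq (Fml.subst_id _)
  have hT₀ : Ext T Γ (CtxAsg.init E) := by rwa [CtxAsg.eq_of_pure (CtxAsg.init E) w₀]
  refine Deriv.imp_intro fun Γ' hΓ h => ?_
  have hT : Ext T Γ' (CtxAsg.init E) := hT₀.mono hΓ
  have h₁ : Deriv E Γ' (Q.subst (Asg.comp (asgL Δ Δ) θ)) :=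
    (Deriv.andE₁ h).of_eq (Fml.subst_subst _ _ _)
  have h₂ : Deriv E Γ' (Q.subst (Asg.comp (asgR Δ Δ) θ)) :=
    (Deriv.andE₂ h).of_eq (Fml.subst_subst _ _ _)
  refine .andI ?_ ?_
  · refine D.iso _ _ hT h₁ h₂ fun E₁ Γ₁ w₁ hw₁ I => ?_
    refine Deriv.of_eq ?_ (Fml.subst_subst _ θ w₁).symm
    let tI : ∀ A, Tm (HomX E₁) ((Asg.comp θ w₁).ob (injL n A)) ((Asg.comp θ w₁).ob (injR n n A)) :=
      I.hom
    have e : ∀ s : CtxAsg Δ (Δ.append Δ),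
        Asg.comp (Asg.comp s (tauAsg (Δ.append Δ) n (injL n) (injR n n)))
          (tauCons (Asg.comp θ w₁) n (injL n) (injR n n) tI)
          = Asg.comp (Asg.comp s θ) w₁ :=
      fun s => (comp_tauAsg_tauCons s (Asg.comp θ w₁) n (injL n) (injR n n) tI).trans
        (Asg.comp_assoc s θ w₁).symm
    exact Deriv.exTau_intro n (injL n) (injR n n) (σ := Asg.comp θ w₁) tI
      (isoCtx_intro_iso I (e _) (e _) fun A => heq_of_eq
        (tauTm_tauCons (Asg.comp θ w₁) n (injL n) (injR n n) _ tI A))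
  · refine Deriv.allTau_intro n (injL n) (injR n n) fun E₁ Γ₁ w₁ hw₁ t₁ => ?_
    refine Deriv.allTau_intro n (injL n) (injR n n) fun E₂ Γ₂ w₂ hw₂ t₂ => ?_
    refine Deriv.imp_intro fun Γ₃ hΓ₃ h₃ => ?_
    refine eqTau_intro fun A => ?_
    let tc := tauCons (Asg.comp (tauCons (Asg.comp θ w₁) n (injL n) (injR n n) t₁) w₂)
      n (injL n) (injR n n) t₂
    have e : ∀ s : CtxAsg Δ (Δ.append Δ),
        Asg.comp (Asg.comp (Asg.comp s (tauAsg (Δ.append Δ) n (injL n) (injR n n)))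
          (tauAsg (tauTel (Δ.append Δ) n (injL n) (injR n n)) n (injL n) (injR n n))) tc
          = Asg.comp (Asg.comp (Asg.comp s θ) w₁) w₂ := fun s =>
      (comp_tauAsg_tauCons _ _ n (injL n) (injR n n) t₂).trans
        ((Asg.comp_assoc (Asg.comp s (tauAsg (Δ.append Δ) n (injL n) (injR n n)))
          (tauCons (Asg.comp θ w₁) n (injL n) (injR n n) t₁) w₂).symm.trans
          (congrArg (fun ρ : CtxAsg Δ E₁ => Asg.comp ρ w₂)
            ((comp_tauAsg_tauCons s (Asg.comp θ w₁) n (injL n) (injR n n) t₁).trans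
              (Asg.comp_assoc s θ w₁).symm)))
    have e₁ : ∀ hc A, ((tauTm (Δ.append Δ) n (injL n) (injR n n) hc A).subst
        (tauAsg (tauTel (Δ.append Δ) n (injL n) (injR n n)) n (injL n) (injR n n))).subst tc
          = (t₁ A).subst w₂ := fun hc A =>
      (Tm.subst_tauAsg_tauCons _ _ n (injL n) (injR n n) t₂).trans
        ((Tm.subst_subst _ (tauCons (Asg.comp θ w₁) n (injL n) (injR n n) t₁) w₂).symm.trans
          (congrArg (Tm.subst w₂)
            (tauTm_tauCons (Asg.comp θ w₁) n (injL n) (injR n n) hc t₁ A)))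
    have e₂ : ∀ hc A, (tauTm (tauTel (Δ.append Δ) n (injL n) (injR n n)) n (injL n) (injR n n)
        hc A).subst tc = t₂ A := fun hc A =>
      tauTm_tauCons (Asg.comp (tauCons (Asg.comp θ w₁) n (injL n) (injR n n) t₁) w₂)
        n (injL n) (injR n n) hc t₂ A
    refine Deriv.of_eq ?_ (congrArg₂ Fml.eq (e₁ _ A) (e₂ _ A)).symm
    refine isoCtx_elim_iso (ρ₁ := Asg.comp (Asg.comp (Asg.comp (asgL Δ Δ) θ) w₁) w₂)
      (ρ₂ := Asg.comp (Asg.comp (Asg.comp (asgR Δ Δ) θ) w₁) w₂)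
      (t := fun A => (t₁ A).subst w₂) (.andE₁ h₃) (e (asgL Δ Δ))
      (e (asgR Δ Δ)) (fun A => heq_of_eq (e₁ _ A)) fun E₃ Γ₄ w₃ hw₃ I hI => ?_
    refine isoCtx_elim_iso (σ := Asg.comp tc w₃)
      (ρ₁ := Asg.comp (Asg.comp (Asg.comp (Asg.comp (asgL Δ Δ) θ) w₁) w₂) w₃)
      (ρ₂ := Asg.comp (Asg.comp (Asg.comp (Asg.comp (asgR Δ Δ) θ) w₁) w₂) w₃)
      (t := fun A => (t₂ A).subst w₃)
      ((Deriv.andE₂ h₃).ext hw₃)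
      ((Asg.comp_assoc _ tc w₃).symm.trans (congrArg (fun ρ : CtxAsg Δ E₂ => Asg.comp ρ w₃)
        (e (asgL Δ Δ))))
      ((Asg.comp_assoc _ tc w₃).symm.trans (congrArg (fun ρ : CtxAsg Δ E₂ => Asg.comp ρ w₃)
        (e (asgR Δ Δ))))
      (fun A => heq_of_eq ((Tm.subst_subst _ tc w₃).symm.trans
        (congrArg (Tm.subst w₃) (e₂ _ A)))) fun E₄ Γ₅ w₄ hw₄ J hJ => ?_
    have hT' : Ext T Γ₅ (CtxAsg.init E₄) :=
      ((((hT.trans_init hw₁).trans_init hw₂).mono hΓ₃).trans_init hw₃).trans_init hw₄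
    have h₅ := D.unique hT' (((((h₁.ext hw₁).ext hw₂).mono hΓ₃).ext hw₃).ext hw₄)
      (((((h₂.ext hw₁).ext hw₂).mono hΓ₃).ext hw₃).ext hw₄) (I.ext hw₄) J A
    refine arrow_eq_iff.1 (Eq.trans ?_ (h₅.trans ?_))
    · exact congrArg (fun t => (Tm.subst w₄ t).arrow Γ₅) (hI A).symm
    · exact congrArg (fun t => Tm.arrow Γ₅ t) (hJ A)

end Descriptions

/-! ### Concatenation of contexts -/

section Concatenation

/-- A family over the object-terms of a concatenation, from families over those of the two
contexts. -/
def joinOb {k : ℕ} : (n : ℕ) → {P : ObX Pure.{u} (k + n) → Sort v} →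
    (∀ a : ObX Pure.{u} k, P (injL n a)) → (∀ b : ObX Pure.{u} n, P (injR k n b)) →
    ∀ c : ObX Pure.{u} (k + n), P c
  | 0, _, l, _, c => l c
  | _ + 1, _, _, r, none => r none
  | n + 1, P, l, r, some c =>
    joinOb n (P := fun c => P (some c)) l (fun b => r (some b)) c

theorem joinOb_injL {k n : ℕ} {P : ObX Pure.{u} (k + n) → Sort v}
    (l : ∀ a : ObX Pure.{u} k, P (injL n a)) (r : ∀ b : ObX Pure.{u} n, P (injR k n b))
    (a : ObX Pure.{u} k) : joinOb n l r (injL n a) = l a := by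
  induction n with
  | zero => rfl
  | succ n ih => exact ih (P := fun c => P (some c)) l _

theorem joinOb_injR {k n : ℕ} {P : ObX Pure.{u} (k + n) → Sort v}
    (l : ∀ a : ObX Pure.{u} k, P (injL n a)) (r : ∀ b : ObX Pure.{u} n, P (injR k n b))
    (b : ObX Pure.{u} n) : joinOb n l r (injR k n b) = r b := by
  induction n with
  | zero => exact PEmpty.elim b
  | succ n ih =>
    rcases b with _ | b
    · rfl
    · exact ih (P := fun c => P (some c)) l (fun b => r (some b)) b

/-- An arrow symbol of a concatenation comes from one of the two contexts. -/
theorem homX_append_cases {k n : ℕ} {Δ₁ : Tel Pure.{u} k} {Δ₂ : Tel Pure.{u} n}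
    {P : ∀ {a b : ObX Pure.{u} (k + n)}, HomX (Δ₁.append Δ₂) a b → Prop}
    (hL : ∀ {a b : ObX Pure.{u} k} (h : HomX Δ₁ a b), P (homL Δ₁ Δ₂ h))
    (hR : ∀ {a b : ObX Pure.{u} n} (h : HomX Δ₂ a b), P (homR Δ₁ Δ₂ h))
    {a b : ObX Pure.{u} (k + n)} (h : HomX (Δ₁.append Δ₂) a b) : P h := by
  induction Δ₂ with
  | nil => exact hL h
  | ob Δ₂ ih =>
    rcases h with ⟨h⟩
    exact ih (P := fun h => P (AddOb.old h)) hL (fun h => hR (AddOb.old h)) h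
  | ar Δ₂ a₀ b₀ ih =>
    rcases h with h | _
    · exact ih (P := fun h => P (AddAr.old h)) hL (fun h => hR (AddAr.old h)) h
    · exact hR AddAr.new

/-- Isomorphisms between interpretations of two contexts combine to one of the concatenation. -/
theorem CtxIso.join {W : Voc.{v}} {k n m : ℕ} {Δ₁ : Tel Pure.{u} k} {Δ₂ : Tel Pure.{u} n}
    {E : Tel W m} {Γ : Set (Fml W E)} {σ σ' : CtxAsg (Δ₁.append Δ₂) E}
    (I : CtxIso Γ (Asg.comp (asgL Δ₁ Δ₂) σ) (Asg.comp (asgL Δ₁ Δ₂) σ'))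
    (J : CtxIso Γ (Asg.comp (asgR Δ₁ Δ₂) σ) (Asg.comp (asgR Δ₁ Δ₂) σ')) :
    Nonempty (CtxIso Γ σ σ') := by
  obtain ⟨hom₁, inv₁, a₁, b₁, c₁⟩ : ∃ (h : ∀ a, Tm (HomX E) (σ.ob (injL n a)) (σ'.ob (injL n a)))
      (i : ∀ a, Tm (HomX E) (σ'.ob (injL n a)) (σ.ob (injL n a))),
      (∀ a, (h a).arrow Γ ≫ (i a).arrow Γ = 𝟙 _) ∧ (∀ a, (i a).arrow Γ ≫ (h a).arrow Γ = 𝟙 _) ∧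
      ∀ {a b : ObX Pure.{u} k} (f : HomX Δ₁ a b),
        (h a).arrow Γ ≫ (σ'.ar (homL Δ₁ Δ₂ f)).arrow Γ
          = (σ.ar (homL Δ₁ Δ₂ f)).arrow Γ ≫ (h b).arrow Γ :=
    ⟨I.hom, I.inv, I.hom_inv, I.inv_hom, I.naturality⟩
  obtain ⟨hom₂, inv₂, a₂, b₂, c₂⟩ :
      ∃ (h : ∀ a, Tm (HomX E) (σ.ob (injR k n a)) (σ'.ob (injR k n a)))
      (i : ∀ a, Tm (HomX E) (σ'.ob (injR k n a)) (σ.ob (injR k n a))),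
      (∀ a, (h a).arrow Γ ≫ (i a).arrow Γ = 𝟙 _) ∧ (∀ a, (i a).arrow Γ ≫ (h a).arrow Γ = 𝟙 _) ∧
      ∀ {a b : ObX Pure.{u} n} (f : HomX Δ₂ a b),
        (h a).arrow Γ ≫ (σ'.ar (homR Δ₁ Δ₂ f)).arrow Γ
          = (σ.ar (homR Δ₁ Δ₂ f)).arrow Γ ≫ (h b).arrow Γ :=
    ⟨J.hom, J.inv, J.hom_inv, J.inv_hom, J.naturality⟩
  refine ⟨⟨joinOb n (P := fun c => Tm (HomX E) (σ.ob c) (σ'.ob c)) hom₁ hom₂,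
    joinOb n (P := fun c => Tm (HomX E) (σ'.ob c) (σ.ob c)) inv₁ inv₂, ?_, ?_, ?_⟩⟩
  · refine joinOb n (fun a => ?_) (fun b => ?_)
    · rw [joinOb_injL, joinOb_injL]; exact a₁ a
    · rw [joinOb_injR, joinOb_injR]; exact a₂ b
  · refine joinOb n (fun a => ?_) (fun b => ?_)
    · rw [joinOb_injL, joinOb_injL]; exact b₁ a
    · rw [joinOb_injR, joinOb_injR]; exact b₂ b
  · intro a b f
    refine homX_append_cases (P := fun {a b} f =>
      (joinOb n (P := fun c => Tm (HomX E) (σ.ob c) (σ'.ob c)) hom₁ hom₂ a).arrow Γ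
        ≫ (σ'.ar f).arrow Γ = (σ.ar f).arrow Γ ≫
      (joinOb n (P := fun c => Tm (HomX E) (σ.ob c) (σ'.ob c)) hom₁ hom₂ b).arrow Γ) ?_ ?_ f
    · intro a b f
      rw [joinOb_injL, joinOb_injL]; exact c₁ f
    · intro a b f
      rw [joinOb_injR, joinOb_injR]; exact c₂ f

end Concatenation

/-! ### Construction of descriptions -/

section Descriptions

variable {T : Theory Pure.{u}} {n k : ℕ} {Δ : Tel Pure.{u} n} {Q : Fml Pure Δ}

theorem IsDescr.nil : IsDescr T (Tel.nil : Tel Pure.{u} 0) .top where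
  exists_tel := .topI
  iso σ₁ σ₂ hT _ _ χ H := by
    refine (H _ _ (CtxAsg.id _) Ext.refl ⟨fun A => PEmpty.elim A, fun A => PEmpty.elim A,
      fun A => PEmpty.elim A, fun A => PEmpty.elim A, fun {a} _ _ => PEmpty.elim a⟩).of_eq
      (Fml.subst_id χ)
  unique _ _ _ _ _ A := PEmpty.elim A

/-- The hypotheses `T` and `Q` in the context `Δ`. -/
def descrHyp (T : Theory Pure.{u}) (Δ : Tel Pure.{u} n) (Q : Fml Pure Δ) : Set (Fml Pure Δ) :=
  insert Q ((fun ψ => Fml.subst ψ (CtxAsg.init Δ)) '' T)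

theorem Ext.descrHyp_init : Ext T (descrHyp T Δ Q) (CtxAsg.init Δ) :=
  (Ext.image _).mono (Set.subset_insert _ _)

theorem Deriv.descrHyp_self : Deriv Δ (descrHyp T Δ Q) Q := .hyp (Set.mem_insert _ _)

/-- A `Δ` with `Q`, in any context that extends `T`, is an extension of the hypotheses. -/
theorem Ext.descrHyp {m : ℕ} {E : Tel Pure.{u} m} {Γ : Set (Fml Pure E)} {σ : CtxAsg Δ E}
    (hT : Ext T Γ (CtxAsg.init E)) (hQ : Deriv E Γ (Q.subst σ)) :
    Ext (descrHyp T Δ Q) Γ σ := by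
  rintro _ (rfl | ⟨ψ, hψ, rfl⟩)
  · exact hQ
  · exact (hT ψ hψ).of_eq ((congrArg ψ.subst (CtxAsg.eq_of_pure _ _)).trans
      (Fml.subst_subst ψ (CtxAsg.init Δ) σ).symm)

/-- A description may be extended by an arrow that is itself uniquely described. -/
theorem IsDescr.consAr (D : IsDescr T Δ Q) {a b : ObX Pure.{u} n} {G : Fml Pure (Δ.ar a b)}
    (hG : Functional (descrHyp T Δ Q) G) : IsDescr T (Δ.ar a b) (.and (Q.wkAr a b) G) where
  exists_tel := by
    refine (Deriv.exTel_elim (σ₀ := CtxAsg.id (Tel.nil : Tel Pure.{u} 0))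
      (D.exists_tel.of_eq (Fml.subst_id _).symm) fun E Γ w hw σ hσ => ?_)
    have hT : Ext T Γ (CtxAsg.init E) := by rwa [CtxAsg.eq_of_pure (CtxAsg.init E) w]
    refine hG.elim (Ext.descrHyp hT hσ) fun E' Γ' w' hw' t ht => ?_
    refine Deriv.of_eq ?_ (Fml.subst_subst _ w w').symm
    refine Deriv.exTel_intro (σ := CtxAsg.consAr (Asg.comp σ w') (a := a) (b := b) t)
      (.andI ?_ ht)
    exact (hσ.ext hw').of_eq (Fml.subst_subst Q (CtxAsg.wkAr Δ a b)
      (CtxAsg.consAr (Asg.comp σ w') (a := a) (b := b) t)).symm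
  iso := by
    intro m E Γ σ₁ σ₂ hT h₁ h₂ χ H
    obtain ⟨σ₁, t₁, rfl⟩ := CtxAsg.exists_consAr σ₁
    obtain ⟨σ₂, t₂, rfl⟩ := CtxAsg.exists_consAr σ₂
    have q₁ : Deriv E Γ (Q.subst σ₁) :=
      (Deriv.andE₁ h₁).of_eq (Fml.subst_subst Q (CtxAsg.wkAr Δ a b) _)
    have q₂ : Deriv E Γ (Q.subst σ₂) :=
      (Deriv.andE₁ h₂).of_eq (Fml.subst_subst Q (CtxAsg.wkAr Δ a b) _)
    refine D.iso σ₁ σ₂ hT q₁ q₂ fun E₁ Γ₁ w₁ hw₁ I => ?_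
    have g₁ := ((Deriv.andE₂ h₁).subst hw₁).of_eq (Fml.consAr_subst G σ₁ t₁ w₁)
    have g₂ := ((Deriv.andE₂ h₂).subst hw₁).of_eq (Fml.consAr_subst G σ₂ t₂ w₁)
    -- Transported along the isomorphism, `t₁` satisfies `G` at the second interpretation; hence it
    -- is equal to `t₂` there, and the isomorphism is compatible with the new arrows.
    have g₃ := CtxIso.transport G (I.consAr (a := a) (b := b) (I.hom_comp_conj (t₁.subst w₁))) g₁
    have e := hG.unique E₁ Γ₁ _ ((Ext.descrHyp hT q₂).trans hw₁) _ _ g₃ g₂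
    have I' := I.consAr (a := a) (b := b) (t₁ := t₁.subst w₁) (t₂ := t₂.subst w₁)
      ((congrArg (fun f => (I.hom a).arrow Γ₁ ≫ f) (arrow_eq_iff.2 e).symm).trans
        (I.hom_comp_conj (t₁.subst w₁)))
    exact H E₁ Γ₁ w₁ hw₁ ((CtxAsg.consAr_comp σ₁ t₁ w₁).symm ▸
      (CtxAsg.consAr_comp σ₂ t₂ w₁).symm ▸ I')
  unique := by
    intro m E Γ σ₁ σ₂ hT h₁ h₂ I J A
    exact D.unique (σ₁ := Asg.comp (CtxAsg.wkAr Δ a b) σ₁) (σ₂ := Asg.comp (CtxAsg.wkAr Δ a b) σ₂)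
      hT ((Deriv.andE₁ h₁).of_eq (Fml.subst_subst _ _ _))
      ((Deriv.andE₁ h₂).of_eq (Fml.subst_subst _ _ _)) (I.precomp _) (J.precomp _) A

/-- Two descriptions combine to a description of the concatenation. -/
theorem IsDescr.append {Δ₁ : Tel Pure.{u} k} {Q₁ : Fml Pure Δ₁} {Δ₂ : Tel Pure.{u} n}
    {Q₂ : Fml Pure Δ₂} (D₁ : IsDescr T Δ₁ Q₁) (D₂ : IsDescr T Δ₂ Q₂) :
    IsDescr T (Δ₁.append Δ₂) (.and (Q₁.subst (asgL Δ₁ Δ₂)) (Q₂.subst (asgR Δ₁ Δ₂))) where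
  exists_tel := by
    refine (Deriv.exTel_elim (σ₀ := CtxAsg.id (Tel.nil : Tel Pure.{u} 0))
      (D₁.exists_tel.of_eq (Fml.subst_id _).symm) fun E₁ Γ₁ w₁ hw₁ σ₁ h₁ => ?_)
    refine (Deriv.exTel_elim (σ₀ := w₁) (D₂.exists_tel.subst hw₁) fun E₂ Γ₂ w₂ hw₂ σ₂ h₂ => ?_)
    refine Deriv.of_eq ?_ (Fml.subst_subst _ w₁ w₂).symm
    obtain ⟨θ, e₁, rfl⟩ := CtxAsg.exists_pair (Asg.comp σ₁ w₂) σ₂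
    refine Deriv.exTel_intro (σ := θ) (.andI ?_ (h₂.of_eq (Fml.subst_subst _ _ _).symm))
    exact (h₁.ext hw₂).of_eq ((congrArg Q₁.subst e₁.symm).trans (Fml.subst_subst _ _ _).symm)
  iso := by
    intro m E Γ σ₁ σ₂ hT h₁ h₂ χ H
    refine D₁.iso _ _ hT ((Deriv.andE₁ h₁).of_eq (Fml.subst_subst _ _ _))
      ((Deriv.andE₁ h₂).of_eq (Fml.subst_subst _ _ _)) fun E₁ Γ₁ w₁ hw₁ I => ?_
    refine D₂.iso _ _ (hT.trans_init hw₁)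
      (((Deriv.andE₂ h₁).of_eq (Fml.subst_subst _ _ _)).ext hw₁)
      (((Deriv.andE₂ h₂).of_eq (Fml.subst_subst _ _ _)).ext hw₁) fun E₂ Γ₂ w₂ hw₂ J => ?_
    refine Deriv.of_eq ?_ (Fml.subst_subst χ w₁ w₂).symm
    have e : ∀ {k' : ℕ} {Θ : Tel Pure.{u} k'} (s : CtxAsg Θ (Δ₁.append Δ₂))
        (σ : CtxAsg (Δ₁.append Δ₂) E),
        Asg.comp (Asg.comp (Asg.comp s σ) w₁) w₂ = Asg.comp s (Asg.comp σ (Asg.comp w₁ w₂)) :=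
      fun s σ => (Asg.comp_assoc (Asg.comp s σ) w₁ w₂).trans
        (Asg.comp_assoc s σ (Asg.comp w₁ w₂))
    have I' : CtxIso Γ₂ _ _ := I.ext hw₂
    rw [e, e] at I' J
    exact (I'.join J).elim (H E₂ Γ₂ (Asg.comp w₁ w₂) (hw₁.trans hw₂))
  unique := by
    intro m E Γ σ₁ σ₂ hT h₁ h₂ I J
    refine joinOb n ?_ ?_
    · exact D₁.unique hT ((Deriv.andE₁ h₁).of_eq (Fml.subst_subst _ _ _))
        ((Deriv.andE₁ h₂).of_eq (Fml.subst_subst _ _ _)) (I.precomp (asgL Δ₁ Δ₂))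
        (J.precomp (asgL Δ₁ Δ₂))
    · exact D₂.unique hT ((Deriv.andE₂ h₁).of_eq (Fml.subst_subst _ _ _))
        ((Deriv.andE₂ h₂).of_eq (Fml.subst_subst _ _ _)) (I.precomp (asgR Δ₁ Δ₂))
        (J.precomp (asgR Δ₁ Δ₂))

end Descriptions

/-! ### Compactness -/

section Compactness

variable {V : Voc.{u}} {n : ℕ}

/-- A deduction uses finitely many hypotheses. -/
theorem Deriv.exists_finite {Δ : Tel V n} {Γ : Set (Fml V Δ)} {φ : Fml V Δ} (h : Deriv Δ Γ φ) :
    ∃ Γ₀ ⊆ Γ, Γ₀.Finite ∧ Deriv Δ Γ₀ φ := by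
  have ins : ∀ {n : ℕ} {Δ : Tel V n} {Γ : Set (Fml V Δ)} {φ ψ : Fml V Δ},
      (∃ Γ₀ ⊆ insert φ Γ, Γ₀.Finite ∧ Deriv Δ Γ₀ ψ) →
      ∃ Γ₀ ⊆ Γ, Γ₀.Finite ∧ Deriv Δ (insert φ Γ₀) ψ := by
    rintro n Δ Γ φ ψ ⟨Γ₀, h₁, h₂, h₃⟩
    refine ⟨Γ₀ \ {φ}, ?_, h₂.subset Set.sdiff_subset, h₃.mono ?_⟩
    · rintro γ ⟨hγ, hφ⟩
      exact (h₁ hγ).resolve_left hφ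
    · intro γ hγ
      by_cases e : γ = φ
      · exact Or.inl e
      · exact Or.inr ⟨hγ, e⟩
  induction h with
  | @hyp _ _ _ φ h => exact ⟨{φ}, Set.singleton_subset_iff.2 h, Set.finite_singleton _, .hyp rfl⟩
  | topI => exact ⟨∅, Set.empty_subset _, Set.finite_empty, .topI⟩
  | botE _ ih => obtain ⟨Γ₀, h₁, h₂, h₃⟩ := ih; exact ⟨Γ₀, h₁, h₂, .botE h₃⟩
  | andI _ _ ih ih' =>
    obtain ⟨Γ₀, h₁, h₂, h₃⟩ := ih
    obtain ⟨Γ₁, k₁, k₂, k₃⟩ := ih'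
    exact ⟨Γ₀ ∪ Γ₁, Set.union_subset h₁ k₁, h₂.union k₂,
      .andI (h₃.mono Set.subset_union_left) (k₃.mono Set.subset_union_right)⟩
  | andE₁ _ ih => obtain ⟨Γ₀, h₁, h₂, h₃⟩ := ih; exact ⟨Γ₀, h₁, h₂, .andE₁ h₃⟩
  | andE₂ _ ih => obtain ⟨Γ₀, h₁, h₂, h₃⟩ := ih; exact ⟨Γ₀, h₁, h₂, .andE₂ h₃⟩
  | orI₁ _ ih => obtain ⟨Γ₀, h₁, h₂, h₃⟩ := ih; exact ⟨Γ₀, h₁, h₂, .orI₁ h₃⟩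
  | orI₂ _ ih => obtain ⟨Γ₀, h₁, h₂, h₃⟩ := ih; exact ⟨Γ₀, h₁, h₂, .orI₂ h₃⟩
  | orE _ _ _ ih ih' ih'' =>
    obtain ⟨Γ₀, h₁, h₂, h₃⟩ := ih
    obtain ⟨Γ₁, k₁, k₂, k₃⟩ := ins ih'
    obtain ⟨Γ₂, l₁, l₂, l₃⟩ := ins ih''
    refine ⟨Γ₀ ∪ (Γ₁ ∪ Γ₂), Set.union_subset h₁ (Set.union_subset k₁ l₁), h₂.union (k₂.union l₂),
      .orE (h₃.mono Set.subset_union_left) (k₃.mono (Set.insert_subset_insert ?_))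
        (l₃.mono (Set.insert_subset_insert ?_))⟩
    · exact Set.subset_union_left.trans Set.subset_union_right
    · exact Set.subset_union_right.trans Set.subset_union_right
  | impI _ ih => obtain ⟨Γ₀, h₁, h₂, h₃⟩ := ins ih; exact ⟨Γ₀, h₁, h₂, .impI h₃⟩
  | impE _ _ ih ih' =>
    obtain ⟨Γ₀, h₁, h₂, h₃⟩ := ih
    obtain ⟨Γ₁, k₁, k₂, k₃⟩ := ih'
    exact ⟨Γ₀ ∪ Γ₁, Set.union_subset h₁ k₁, h₂.union k₂,
      .impE (h₃.mono Set.subset_union_left) (k₃.mono Set.subset_union_right)⟩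
  | allObI _ ih =>
    obtain ⟨Γ₀, h₁, h₂, h₃⟩ := Set.exists_subset_image_finite_and.1 ih
    exact ⟨Γ₀, h₁, h₂, .allObI h₃⟩
  | allObE _ c ih => obtain ⟨Γ₀, h₁, h₂, h₃⟩ := ih; exact ⟨Γ₀, h₁, h₂, .allObE h₃ c⟩
  | exObI c _ ih => obtain ⟨Γ₀, h₁, h₂, h₃⟩ := ih; exact ⟨Γ₀, h₁, h₂, .exObI c h₃⟩
  | exObE _ _ ih ih' =>
    obtain ⟨Γ₀, h₁, h₂, h₃⟩ := ih
    obtain ⟨Γ₁, k₁, k₂, k₃⟩ := Set.exists_subset_image_finite_and.1 (ins ih')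
    exact ⟨Γ₀ ∪ Γ₁, Set.union_subset h₁ k₁, h₂.union k₂, .exObE (h₃.mono Set.subset_union_left)
      (k₃.mono (Set.insert_subset_insert (Set.image_mono Set.subset_union_right)))⟩
  | allArI _ ih =>
    obtain ⟨Γ₀, h₁, h₂, h₃⟩ := Set.exists_subset_image_finite_and.1 ih
    exact ⟨Γ₀, h₁, h₂, .allArI h₃⟩
  | allArE _ c ih => obtain ⟨Γ₀, h₁, h₂, h₃⟩ := ih; exact ⟨Γ₀, h₁, h₂, .allArE h₃ c⟩
  | exArI c _ ih => obtain ⟨Γ₀, h₁, h₂, h₃⟩ := ih; exact ⟨Γ₀, h₁, h₂, .exArI c h₃⟩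
  | exArE _ _ ih ih' =>
    obtain ⟨Γ₀, h₁, h₂, h₃⟩ := ih
    obtain ⟨Γ₁, k₁, k₂, k₃⟩ := Set.exists_subset_image_finite_and.1 (ins ih')
    exact ⟨Γ₀ ∪ Γ₁, Set.union_subset h₁ k₁, h₂.union k₂, .exArE (h₃.mono Set.subset_union_left)
      (k₃.mono (Set.insert_subset_insert (Set.image_mono Set.subset_union_right)))⟩
  | eqRefl f => exact ⟨∅, Set.empty_subset _, Set.finite_empty, .eqRefl f⟩
  | eqSymm _ ih => obtain ⟨Γ₀, h₁, h₂, h₃⟩ := ih; exact ⟨Γ₀, h₁, h₂, .eqSymm h₃⟩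
  | eqTrans _ _ ih ih' =>
    obtain ⟨Γ₀, h₁, h₂, h₃⟩ := ih
    obtain ⟨Γ₁, k₁, k₂, k₃⟩ := ih'
    exact ⟨Γ₀ ∪ Γ₁, Set.union_subset h₁ k₁, h₂.union k₂,
      .eqTrans (h₃.mono Set.subset_union_left) (k₃.mono Set.subset_union_right)⟩
  | eqComp _ _ ih ih' =>
    obtain ⟨Γ₀, h₁, h₂, h₃⟩ := ih
    obtain ⟨Γ₁, k₁, k₂, k₃⟩ := ih'
    exact ⟨Γ₀ ∪ Γ₁, Set.union_subset h₁ k₁, h₂.union k₂,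
      .eqComp (h₃.mono Set.subset_union_left) (k₃.mono Set.subset_union_right)⟩
  | assoc f g h => exact ⟨∅, Set.empty_subset _, Set.finite_empty, .assoc f g h⟩
  | idComp f => exact ⟨∅, Set.empty_subset _, Set.finite_empty, .idComp f⟩
  | compId f => exact ⟨∅, Set.empty_subset _, Set.finite_empty, .compId f⟩

/-- Functionality uses finitely many hypotheses, as it amounts to two propositions. -/
theorem Functional.exists_finite {m : ℕ} {E : Tel V m} {a b : ObX V m} {G : Fml V (E.ar a b)}
    {Γ : Set (Fml V E)} (h : Functional Γ G) : ∃ Γ₀ ⊆ Γ, Γ₀.Finite ∧ Functional Γ₀ G := by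
  obtain ⟨Γ₀, h₁, h₂, h₃⟩ := h.total.exists_finite
  obtain ⟨Γ₁, k₁, k₂, k₃⟩ := h.atMostOne.exists_finite
  exact ⟨Γ₀ ∪ Γ₁, Set.union_subset h₁ k₁, h₂.union k₂, h₃.mono Set.subset_union_left,
    fun E' Γ' w hw t t' => atMostOne_elim
      ((k₃.mono Set.subset_union_right).subst hw)⟩

theorem RAsg.IsFunctional.exists_finite {m : ℕ} {Θ : Tel Pure.{w} n} {E : Tel V m}
    {Γ : Set (Fml V E)} {κ : RAsg Θ E} (h : κ.IsFunctional Γ) :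
    ∃ Γ₀ ⊆ Γ, Γ₀.Finite ∧ κ.IsFunctional Γ₀ := by
  induction Θ with
  | nil => exact ⟨∅, Set.empty_subset _, Set.finite_empty, fun a _ _ => PEmpty.elim a⟩
  | ob Θ ih =>
    obtain ⟨Γ₀, h₁, h₂, h₃⟩ := ih (κ := ⟨fun a => κ.ob (some a), fun f => κ.gr (.old f)⟩)
      fun a b f => h _ _ (.old f)
    refine ⟨Γ₀, h₁, h₂, ?_⟩
    rintro _ _ ⟨f⟩
    exact h₃ _ _ f
  | ar Θ a b ih =>
    obtain ⟨Γ₀, h₁, h₂, h₃⟩ := ih (κ := ⟨κ.ob, fun f => κ.gr (.old f)⟩)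
      fun a b f => h _ _ (.old f)
    obtain ⟨Γ₁, k₁, k₂, k₃⟩ := (h _ _ AddAr.new).exists_finite
    refine ⟨Γ₀ ∪ Γ₁, Set.union_subset h₁ k₁, h₂.union k₂, ?_⟩
    rintro _ _ (f | _)
    · exact (h₃ _ _ f).mono Set.subset_union_left
    · exact k₃.mono Set.subset_union_right

end Compactness

/-! ### A common description for finitely many constants -/

section CommonDescription

variable {T : Theory Pure.{0}}

theorem Descr.isDescr (s : Descr T) : IsDescr T s.Δ s.P := .of_exUnique s.proves

/-- Finitely many of the descriptions whose constants make up the first extension can be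
interpreted at once in a single described context. The other constants are interpreted
arbitrarily. -/
theorem exists_common_descr (L : Finset (Descr T)) :
    ∃ (n : ℕ) (Δ : Tel Pure.{0} n) (Q : Fml Pure Δ), IsDescr T Δ Q ∧
      ∃ f : ∀ s : Descr T, CtxAsg s.Δ Δ, ∀ s ∈ L, Deriv Δ (descrHyp T Δ Q) (s.P.subst (f s)) := by
  classical
  induction L using Finset.induction_on with
  | empty =>
    -- Constants outside `L` need some value: all objects go to one object-term and all arrows to
    -- its identity, unless there are no constants at all.
    by_cases h : Nonempty (Ob1 T)
    · obtain ⟨s₀, a₀⟩ := h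
      exact ⟨s₀.n, s₀.Δ, s₀.P, s₀.isDescr,
        fun s => ⟨fun _ => a₀, fun _ => Tm.id (H := HomX s₀.Δ) a₀⟩, by simp⟩
    · exact ⟨0, Tel.nil, .top, .nil, fun s => ⟨fun a => (h ⟨s, a⟩).elim,
        fun {a} _ _ => (h ⟨s, a⟩).elim⟩, by simp⟩
  | insert s L _ ih =>
    obtain ⟨n, Δ, Q, D, f, hf⟩ := ih
    have D' := D.append s.isDescr
    have hQ := Deriv.descrHyp_self (T := T) (Q := .and (Q.subst (asgL Δ s.Δ))
      (s.P.subst (asgR Δ s.Δ)))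
    refine ⟨_, _, _, D', Function.update (β := fun s' : Descr T => CtxAsg s'.Δ (Δ.append s.Δ))
      (fun s' => Asg.comp (f s') (asgL Δ s.Δ)) s (asgR Δ s.Δ), fun s' hs' => ?_⟩
    by_cases h : s' = s
    · subst h
      exact (Deriv.andE₂ hQ).of_eq (congrArg s'.P.subst (Function.update_self
        (β := fun s : Descr T => CtxAsg s.Δ (Δ.append s'.Δ)) s' _ _).symm)
    · refine Deriv.of_eq ?_ (congrArg s'.P.subst (Function.update_of_ne
        (β := fun s' : Descr T => CtxAsg s'.Δ (Δ.append s.Δ)) h _ _).symm)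
      exact (hf s' ((Finset.mem_insert.1 hs').resolve_left h)).ext
        (Ext.descrHyp Ext.descrHyp_init (.andE₁ hQ))

/-- An interpretation of the constants of the first extension. -/
def Descr.interp {n : ℕ} {Δ : Tel Pure.{0} n} (f : ∀ s : Descr T, CtxAsg s.Δ Δ) :
    CtxAsg (Tel.nil : Tel (Voc1 T) 0) Δ where
  ob c := (f c.1).ob c.2
  ar
    | .const s g => (f s).ar g

/-- Finitely many axioms of the first extension hold in a single described context. -/
theorem exists_interp {Γ : Set (Sentence (Voc1 T))} (hΓ : Γ ⊆ Theory1 T) (hfin : Γ.Finite) :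
    ∃ (n : ℕ) (Δ : Tel Pure.{0} n) (Q : Fml Pure Δ), IsDescr T Δ Q ∧
      ∃ r : CtxAsg (Tel.nil : Tel (Voc1 T) 0) Δ, Ext Γ (descrHyp T Δ Q) r := by
  -- The axiom that a description contributes; finitely many descriptions suffice for `Γ`.
  let g : Descr T → Sentence (Voc1 T) := fun s => s.P.subst s.asg
  obtain ⟨L, -, hL, e⟩ := (Set.exists_subset_image_finite_and (f := g) (s := Set.univ)
    (p := fun t => t = Γ ∩ g '' Set.univ)).1
    ⟨_, Set.inter_subset_right, hfin.subset Set.inter_subset_left, rfl⟩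
  obtain ⟨n, Δ, Q, D, f, hf⟩ := exists_common_descr hL.toFinset
  refine ⟨n, Δ, Q, D, Descr.interp f, fun γ hγ => ?_⟩
  rcases hΓ hγ with ⟨ψ, hψ, rfl⟩ | ⟨s, hs⟩
  · refine (Ext.descrHyp_init ψ hψ).of_eq ((congrArg ψ.subst (CtxAsg.eq_of_pure _ _)).trans
      (Fml.subst_subst ψ (ofPure (Voc1 T)) (Descr.interp f)).symm)
  · obtain ⟨s', hs', rfl⟩ : γ ∈ g '' L := e ▸ ⟨hγ, s, trivial, hs.symm⟩
    exact (hf s' (hL.mem_toFinset.2 hs')).of_eq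
      (Fml.subst_subst s'.P s'.asg (Descr.interp f)).symm

end CommonDescription

/-! ### Values of uniquely described arrows -/

section Values

variable {T : Theory Pure.{u}}

/-- Uniquely described arrows over a described context have values in a larger described
context. -/
theorem IsDescr.exists_values {n : ℕ} {Δ : Tel Pure.{u} n} {Q : Fml Pure Δ} (D : IsDescr T Δ Q)
    {l : ℕ} {Θ : Tel Pure.{u} l} {κ : RAsg Θ Δ} (hκ : κ.IsFunctional (descrHyp T Δ Q)) :
    ∃ (m : ℕ) (Δ' : Tel Pure.{u} m) (Q' : Fml Pure Δ') (w : CtxAsg Δ Δ'), IsDescr T Δ' Q' ∧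
      Ext (descrHyp T Δ Q) (descrHyp T Δ' Q') w ∧
      ∃ c : ∀ {a b : ObX Pure l}, HomX Θ a b → Tm (HomX Δ') (w.ob (κ.ob a)) (w.ob (κ.ob b)),
        ∀ {a b : ObX Pure l} (h : HomX Θ a b),
          Deriv Δ' (descrHyp T Δ' Q') ((κ.gr h).subst (CtxAsg.consAr w (c h))) := by
  induction Θ with
  | nil =>
    exact ⟨n, Δ, Q, CtxAsg.id Δ, D, Ext.refl, fun {a} _ _ => PEmpty.elim a,
      fun {a} _ _ => PEmpty.elim a⟩
  | ob Θ ih =>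
    obtain ⟨m, Δ', Q', w, D', hw, c, hc⟩ :=
      ih (κ := ⟨fun a => κ.ob (some a), fun f => κ.gr (.old f)⟩) fun a b f => hκ _ _ (.old f)
    refine ⟨m, Δ', Q', w, D', hw, fun | .old f => c f, ?_⟩
    rintro _ _ ⟨f⟩
    exact hc f
  | ar Θ a b ih =>
    obtain ⟨m, Δ', Q', w, D', hw, c, hc⟩ :=
      ih (κ := ⟨κ.ob, fun f => κ.gr (.old f)⟩) fun a b f => hκ _ _ (.old f)
    have D'' := D'.consAr ((hκ _ _ AddAr.new).subst hw)
    have hQ := Deriv.descrHyp_self (T := T) (Q := .and (Q'.wkAr (w.ob (κ.ob a)) (w.ob (κ.ob b)))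
      ((κ.gr AddAr.new).subst (CtxAsg.liftAr w (κ.ob a) (κ.ob b))))
    have hw' := Ext.descrHyp Ext.descrHyp_init (.andE₁ hQ)
    refine ⟨m, _, _, _, D'', hw.trans hw', fun
      | .old f => (c f).subst (CtxAsg.wkAr Δ' (w.ob (κ.ob a)) (w.ob (κ.ob b)))
      | .new => .sym AddAr.new, ?_⟩
    rintro _ _ (f | _)
    · exact ((hc f).subst hw').of_eq (Fml.consAr_subst (κ.gr (.old f)) w (c f) _)
    · exact .andE₂ hQ

/-- A proposition that holds over a described context of uniquely described arrows holds of terms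
in a larger described context, whose description adds these arrows as variables. -/
theorem IsDescr.exists_exTel {n : ℕ} {Δ : Tel Pure.{u} n} {Q : Fml Pure Δ} (D : IsDescr T Δ Q)
    {l : ℕ} {Θ : Tel Pure.{u} l} {κ : RAsg Θ Δ} (hκ : κ.IsFunctional (descrHyp T Δ Q))
    {P : Fml Pure Θ} (hP : Deriv Δ (descrHyp T Δ Q) (P.star κ)) :
    ∃ (m : ℕ) (Δ' : Tel Pure.{u} m) (c : CtxAsg Θ Δ') (Q' : Fml Pure Δ'),
      T.Proves (CatTheory.exUnique Δ' Q') ∧ T.Proves (exTel Δ' (.and Q' (P.subst c))) := by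
  obtain ⟨m, Δ', Q', w, D', hw, c, hc⟩ := D.exists_values hκ
  have h₁ : Deriv Δ' (descrHyp T Δ' Q') (P.star (κ.subst w)) :=
    (hP.subst hw).of_eq (Fml.star_subst P κ w)
  have h₂ := (star_iff_subst (hκ.subst hw) c (fun h => (hc h).of_eq
    (Fml.liftAr_instAr (κ.gr h) w (c h)).symm) P).1 h₁
  refine ⟨m, Δ', ⟨(κ.subst w).ob, c⟩, Q', D'.exUnique, ?_⟩
  refine Deriv.exTel_elim (σ₀ := CtxAsg.id (Tel.nil : Tel Pure.{u} 0))
    (D'.exists_tel.of_eq (Fml.subst_id _).symm) fun E Γ v hv σ hσ => ?_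
  have hT : Ext T Γ (CtxAsg.init E) := by rwa [CtxAsg.eq_of_pure (CtxAsg.init E) v]
  exact Deriv.exTel_intro (σ := σ) (.andI hσ (h₂.subst (Ext.descrHyp hT hσ)))

end Values

/-! ### From the extensions back to the theory -/

section Conservativity

variable {T : Theory Pure.{0}}

/-- What the second extension proves about closed terms, `T` proves about terms over a uniquely
described context. -/
theorem Theory2.exists_exTel {l : ℕ} {Θ : Tel Pure.{0} l} {P : Fml Pure Θ}
    {ρ : CtxAsg Θ (Tel.nil : Tel (Voc2 T) 0)} (h : (Theory2 T).Proves (P.subst ρ)) :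
    ∃ (m : ℕ) (Δ : Tel Pure.{0} m) (c : CtxAsg Θ Δ) (Q : Fml Pure Δ),
      T.Proves (exUnique Δ Q) ∧ T.Proves (exTel Δ (.and Q (P.subst c))) := by
  have h₁ : (Theory1 T).Proves (P.star (RAsg.precomp ρ (elimConst T))) :=
    (Theory1_proves_star h).of_eq (Fml.subst_star P ρ (elimConst T))
  have hκ : (RAsg.precomp ρ (elimConst T)).IsFunctional (Theory1 T) :=
    elimConst_isFunctional.precomp ρ
  obtain ⟨Γ₁, s₁, f₁, h₁⟩ := Deriv.exists_finite h₁
  obtain ⟨Γ₂, s₂, f₂, h₂⟩ := hκ.exists_finite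
  obtain ⟨n, Δ, Q, D, r, hr⟩ := exists_interp (Set.union_subset s₁ s₂) (f₁.union f₂)
  refine D.exists_exTel (κ := (RAsg.precomp ρ (elimConst T)).subst r)
    ((h₂.mono Set.subset_union_right).subst hr) ?_
  exact ((h₁.mono Set.subset_union_left).subst hr).of_eq (Fml.star_subst P _ r)

variable {Tiny : Type u} [SmallCategory Tiny] {Γ : TComp T ⥤ Tiny}

/-- A slashed closed instance of `P` yields a definable instance in `T`. -/
theorem exists_exTel_of_FP {l : ℕ} {Θ : Tel Pure.{0} l} {P : Fml Pure Θ}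
    {θ : CtxAsg Θ (Tel.nil : Tel (catVoc (FreydCover Γ)) 0)}
    (h : FP (TStar Γ) (freydModel Γ) (P.subst θ)) :
    ∃ (m : ℕ) (Δ : Tel Pure.{0} m) (c : CtxAsg Θ Δ) (Q : Fml Pure Δ),
      T.Proves (exUnique Δ Q) ∧ T.Proves (exTel Δ (.and Q (P.subst c))) := by
  refine Theory2.exists_exTel (ρ := Asg.comp (Asg.comp θ (minus Γ)) (rep T)) ?_
  refine Deriv.of_eq ((TComp_proves_of_FP h).subst ext_rep) ?_
  exact (congrArg (fun φ => Fml.subst φ (rep T)) (Fml.subst_subst P θ (minus Γ))).trans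
    (Fml.subst_subst P _ (rep T))

/-- Slashed sentences of the pure language are theorems of `T`. -/
theorem proves_of_FP {φ : Sentence Pure.{0}}
    (h : FP (TStar Γ) (freydModel Γ) (φ.subst (ofPure (catVoc (FreydCover Γ))))) :
    T.Proves φ := by
  obtain ⟨m, Δ, c, Q, -, h₂⟩ := exists_exTel_of_FP h
  refine Deriv.exTel_elim (σ₀ := CtxAsg.id (Tel.nil : Tel Pure.{0} 0))
    (h₂.of_eq (Fml.subst_id _).symm) fun E Γ' w hw σ hσ => ?_
  exact (Deriv.andE₂ hσ).of_eq ((Fml.subst_subst φ c σ).trans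
    (congrArg φ.subst (CtxAsg.eq_of_pure _ _)))

end Conservativity
end CatTheory

theorem mainTheorem3
    (T : CatTheory.Theory CatTheory.Pure.{0})
    (one : CatTheory.TComp T) (_hone : Limits.IsTerminal one)
    {Tiny : Type u} [SmallCategory Tiny] (incl : Tiny ⥤ Type w) [incl.Faithful]
    (Γ : CatTheory.TComp T ⥤ Tiny)
    (_hΓ : Nonempty (Γ ⋙ incl ≅ CatTheory.globalSections.{w} one))
    (hFP : ∀ φ ∈ T, CatTheory.FP (CatTheory.TStar Γ) (CatTheory.freydModel Γ)
      (φ.subst (CatTheory.ofPure (CatTheory.catVoc (CatTheory.FreydCover Γ))))) :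
    T.Consistent ∧ T.ExistenceProperty ∧ T.DisjunctionProperty := by
  refine ⟨fun h => CatTheory.FP_of_proves hFP h, fun n Θ P h => ?_, fun φ ψ h => ?_⟩
  · obtain ⟨θ, hθ⟩ := CatTheory.FPat_exTel Θ P (CatTheory.FP_of_proves hFP h)
    exact CatTheory.exists_exTel_of_FP hθ
  · exact (CatTheory.FP_of_proves hFP h).imp CatTheory.proves_of_FP CatTheory.proves_of_FP
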